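/- Let $G$ be a locally compact (Hausdorff) group with a fixed left Haar (Radon) measure and modular function $\Delta$, normalised by $\int_G f(st)\,ds=\Delta(t)^{-1}\int_G f(s)\,ds$. Let $\mathcal A=(A_g)_{g\in G}$ be a Fell bundle over $G$. *Kernel algebras.* Let $k_c(\mathcal A)$ be the $*$-algebra of continuous compactly supported maps $k\colon G\times G\to\mathcal A$ with $k(s,t)\in A_{st^{-1}}$, with operations $(k*l)(s,t)=\int_G k(s,r)\,l(r,t)\,dr$ and $k^*(s,t)=k(t,s)^*$. Put $\|k\|_2=\bigl(\int_{G\times G}\|k(s,t)\|^2\,d(s,t)\bigr)^{1/2}$, and let $\mathbb K(\mathcal A)$ be the $C^*$-algebra obtained by completing $k_c(\mathcal A)$ with respect to $\|k\|_u=\sup_\pi\|\pi(k)\|$, where $\pi$ runs over all $*$-homomorphisms from $k_c(\mathcal A)$ into $C^*$-algebras with $\|\pi(k)\|\le\|k\|_2$ for all $k$. Let $k_b(\mathcal A)$ be the space of bounded measurable compactly supported maps $k\colon G\times G\to\mathcal A$ with $k(s,t)\in A_{st^{-1}}$, where measurable means that on each compact set $k$ is almost everywhere the pointwise limit of a sequence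 of continuous sections. The canonical map $k_c(\mathcal A)\to\mathbb K(\mathcal A)$ extends to $k_b(\mathcal A)$ by $\|\cdot\|_2$-continuity. The algebra $\mathbb K(\mathcal A)$ carries the structure map $j\colon C_0(G)\to\mathcal M(\mathbb K(\mathcal A))$ given by $(j(f)k)(s,t)=f(s)k(s,t)$ and $(k\,j(f))(s,t)=k(s,t)f(t)$, and the dual $G$-action $\widehat\delta_{\mathcal A}$ given by $(\widehat\delta_{\mathcal A,t}k)(s,r)=\Delta(t)\,k(st,rt)$, for $k\in k_c(\mathcal A)$. *Twisting.* Let $\sigma=(\mathbb T\hookrightarrow G_\sigma\overset{q}{\twoheadrightarrow}G)$ be a central extension of locally compact groups. The twisted Fell bundle is $\mathcal A_\sigma=q^*\mathcal A/\mathbb T$, the set of classes $[a,\tilde g]$ with $a\in A_{q(\tilde g)}$, $\tilde g\in G_\sigma$ and $[\bar z a,z\tilde g]=[a,\tilde g]$ for $z\in\mathbb T$, with operations $\lambda[a,\tilde g]+[a',\tilde g]=[\lambda a+a',\tilde g]$, $[a,\tilde g][b,\tilde h]=[ab,\tilde g\tilde h]$ and $[a,\tilde g]^*=[a^*,\tilde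 g^{-1}]$. A kernel $k$ of $\mathcal A_\sigma$ is identified with the function $G_\sigma\times G_\sigma\to\mathcal A$, again denoted $k$, such that $k(\tilde g,\tilde h)\in A_{gh^{-1}}$ and $k(g,h)=[k(\tilde g,\tilde h),\tilde g\tilde h^{-1}]$ for $g=q(\tilde g)$, $h=q(\tilde h)$. **Proposition.** Let $\mathfrak s\colon G\to G_\sigma$ be a Borel section of $q$, with cocycle $\omega=\partial\mathfrak s\colon G\times G\to\mathbb T$, $\omega(g,h)=\mathfrak s(g)\mathfrak s(h)\mathfrak s(gh)^{-1}$. Then there is a $*$-isomorphism $\Phi\colon\mathbb K(\mathcal A_\sigma)\to\mathbb K(\mathcal A)$ which maps each $k\in k_b(\mathcal A_\sigma)$ to the element $\Phi(k)\in k_b(\mathcal A)$ with $$\Phi(k)(g,h)=k(\mathfrak s(g),\mathfrak s(h))\qquad(g,h\in G).$$ It satisfies $\Phi(j^\sigma(f)x)=j(f)\Phi(x)$ and $\Phi(x\,j^\sigma(f))=\Phi(x)j(f)$ for all $f\in C_0(G)$ and $x\in\mathbb K(\mathcal A_\sigma)$, where $j^\sigma$ and $j$ are the structure maps of $\mathbb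 K(\mathcal A_\sigma)$ and $\mathbb K(\mathcal A)$. Moreover, there is a strongly continuous action $\widehat\delta^{\,\omega}$ of $G$ on $\mathbb K(\mathcal A)$ by $*$-automorphisms which maps $k_b(\mathcal A)$ to itself by $$\widehat\delta^{\,\omega}_t(k)(g,h)=\Delta(t)\,\overline{\omega(g,t)}\,\omega(h,t)\,k(gt,ht)\qquad(k\in k_b(\mathcal A),\ t,g,h\in G),$$ and $\Phi\circ\widehat\delta_{\mathcal A_\sigma,t}=\widehat\delta^{\,\omega}_t\circ\Phi$ for all $t\in G$. -/

import Mathlib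

open Filter Topology MeasureTheory

set_option linter.unusedSectionVars false

noncomputable section

universe u

/-- The fibre over `x` of a map `p : E → X`, as a type of its own: it carries a norm topology, and
no subspace topology by default. -/
@[ext] structure Fiber {X E : Type*} (p : E → X) (x : X) where
  val : E
  prop : p val = x

/-- A (complex) Banach bundle over `X` in the sense of Fell and Doran: an open continuous surjection
`p : E → X` whose fibres are Banach spaces such that the norm, the addition (on `E ×_X E`) and the
multiplication by each scalar are continuous on the total space, and such that `a → 0_x` as soon as
`‖a‖ → 0` and `p a → x`. -/
structure BanachBundle (X : Type u) [TopologicalSpace X] where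
  E : Type u
  [top : TopologicalSpace E]
  p : E → X
  continuous_p : Continuous p
  isOpenMap_p : IsOpenMap p
  [fibAddGroup : ∀ x, NormedAddCommGroup (Fiber p x)]
  [fibSpace : ∀ x, NormedSpace ℂ (Fiber p x)]
  [fibComplete : ∀ x, CompleteSpace (Fiber p x)]
  continuous_norm : Continuous fun a : E => ‖(⟨a, rfl⟩ : Fiber p (p a))‖
  continuous_add : Continuous fun w : {w : E × E // p w.1 = p w.2} =>
    ((⟨w.1.1, rfl⟩ : Fiber p (p w.1.1)) + ⟨w.1.2, w.2.symm⟩).val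
  continuous_smul : ∀ c : ℂ, Continuous fun a : E => (c • (⟨a, rfl⟩ : Fiber p (p a))).val
  nhds_zero : ∀ x : X,
    comap p (𝓝 x) ⊓ comap (fun a : E => ‖(⟨a, rfl⟩ : Fiber p (p a))‖) (𝓝 0) ≤
      𝓝 (0 : Fiber p x).val

namespace BanachBundle

attribute [instance] BanachBundle.top BanachBundle.fibAddGroup BanachBundle.fibSpace
  BanachBundle.fibComplete

variable {X : Type u} [TopologicalSpace X] (B : BanachBundle X)

/-- The fibre of a Banach bundle. -/
abbrev Fib (x : X) : Type u := Fiber B.p x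

variable {B}

theorem fib_norm {x : X} (a : B.Fib x) : ‖(⟨a.val, rfl⟩ : B.Fib (B.p a.val))‖ = ‖a‖ := by
  obtain ⟨a, rfl⟩ := a; rfl

theorem fib_add {x : X} (a b : B.Fib x) (h : B.p b.val = B.p a.val) :
    ((⟨a.val, rfl⟩ : B.Fib (B.p a.val)) + ⟨b.val, h⟩).val = (a + b).val := by
  obtain ⟨a, rfl⟩ := a; rfl

theorem fib_smul {x : X} (c : ℂ) (a : B.Fib x) :
    (c • (⟨a.val, rfl⟩ : B.Fib (B.p a.val))).val = (c • a).val := by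
  obtain ⟨a, rfl⟩ := a; rfl

variable {Y : Type*} [TopologicalSpace Y] {ν : Y → X}

/-- Continuity at a point of a section of the pull-back of the bundle along `ν`, i.e. of a map
`Y → E` which covers `ν`. -/
theorem tendsto_norm {l : Filter Y} {f : ∀ y, B.Fib (ν y)} {y₀ : Y}
    (hf : Tendsto (fun y => (f y).val) l (𝓝 (f y₀).val)) :
    Tendsto (fun y => ‖f y‖) l (𝓝 ‖f y₀‖) := by
  have h := (B.continuous_norm.tendsto (f y₀).val).comp hf
  simpa only [Function.comp_def, fib_norm] using h

theorem tendsto_add {x : X} {l : Filter Y} {f g : ∀ y, B.Fib (ν y)} {a b : B.Fib x}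
    (hf : Tendsto (fun y => (f y).val) l (𝓝 a.val))
    (hg : Tendsto (fun y => (g y).val) l (𝓝 b.val)) :
    Tendsto (fun y => (f y + g y).val) l (𝓝 (a + b).val) := by
  have hp : ∀ y, B.p (f y).val = B.p (g y).val := fun y => (f y).prop.trans (g y).prop.symm
  have hp0 : B.p a.val = B.p b.val := a.prop.trans b.prop.symm
  have h1 : Tendsto (fun y => (⟨((f y).val, (g y).val), hp y⟩ :
      {w : B.E × B.E // B.p w.1 = B.p w.2})) l (𝓝 ⟨(a.val, b.val), hp0⟩) := by
    rw [tendsto_subtype_rng]; exact hf.prodMk_nhds hg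
  have h := (B.continuous_add.tendsto _).comp h1
  simpa only [Function.comp_def, fib_add] using h

theorem tendsto_const_smul {x : X} {l : Filter Y} {f : ∀ y, B.Fib (ν y)} {a : B.Fib x} (c : ℂ)
    (hf : Tendsto (fun y => (f y).val) l (𝓝 a.val)) :
    Tendsto (fun y => (c • f y).val) l (𝓝 (c • a).val) := by
  have h := ((B.continuous_smul c).tendsto _).comp hf
  simpa only [Function.comp_def, fib_smul] using h

theorem tendsto_zero {x : X} {l : Filter Y} {f : ∀ y, B.Fib (ν y)} (hν : Tendsto ν l (𝓝 x))
    (hf : Tendsto (fun y => ‖f y‖) l (𝓝 0)) :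
    Tendsto (fun y => (f y).val) l (𝓝 (0 : B.Fib x).val) := by
  refine Tendsto.mono_right ?_ (B.nhds_zero x)
  rw [tendsto_inf, tendsto_comap_iff, tendsto_comap_iff]
  refine ⟨?_, ?_⟩
  · simpa only [Function.comp_def, (f _).prop] using hν
  · simpa only [Function.comp_def, fib_norm] using hf

theorem tendsto_smul {x : X} {l : Filter Y} {f : ∀ y, B.Fib (ν y)} {a : B.Fib x} {φ : Y → ℂ}
    {c : ℂ} (hφ : Tendsto φ l (𝓝 c)) (hf : Tendsto (fun y => (f y).val) l (𝓝 a.val)) :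
    Tendsto (fun y => (φ y • f y).val) l (𝓝 (c • a).val) := by
  have hν : Tendsto ν l (𝓝 x) := by
    have := (B.continuous_p.tendsto _).comp hf
    rw [a.prop] at this
    simpa only [Function.comp_def, (f _).prop] using this
  have hn : Tendsto (fun y => ‖f y‖) l (𝓝 ‖a‖) := by
    have h := (B.continuous_norm.tendsto a.val).comp hf
    simpa only [Function.comp_def, fib_norm] using h
  have h1 : Tendsto (fun y => ‖(φ y - c) • f y‖) l (𝓝 0) := by
    have : Tendsto (fun y => ‖φ y - c‖ * ‖f y‖) l (𝓝 (0 * ‖a‖)) :=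
      (tendsto_iff_norm_sub_tendsto_zero.1 hφ).mul hn
    simpa only [zero_mul, norm_smul] using this
  have h := tendsto_add (tendsto_const_smul c hf) (tendsto_zero (B := B) hν h1)
  rw [add_zero] at h
  refine h.congr fun y => ?_
  rw [← add_smul, add_sub_cancel]

/-- `f` is a continuous section of the pull-back of the bundle along `ν`. -/
def IsContSec (f : ∀ y, B.Fib (ν y)) : Prop := Continuous fun y => (f y).val

theorem IsContSec.norm {f : ∀ y, B.Fib (ν y)} (hf : IsContSec f) : Continuous fun y => ‖f y‖ :=
  continuous_iff_continuousAt.2 fun y => tendsto_norm (hf.tendsto y)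

theorem IsContSec.add {f g : ∀ y, B.Fib (ν y)} (hf : IsContSec f) (hg : IsContSec g) :
    IsContSec (fun y => f y + g y) :=
  continuous_iff_continuousAt.2 fun y => tendsto_add (hf.tendsto y) (hg.tendsto y)

theorem IsContSec.smul {f : ∀ y, B.Fib (ν y)} {φ : Y → ℂ} (hφ : Continuous φ) (hf : IsContSec f) :
    IsContSec (fun y => φ y • f y) :=
  continuous_iff_continuousAt.2 fun y => tendsto_smul (hφ.tendsto y) (hf.tendsto y)

theorem IsContSec.const_smul {f : ∀ y, B.Fib (ν y)} (c : ℂ) (hf : IsContSec f) :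
    IsContSec (fun y => c • f y) := hf.smul continuous_const

theorem IsContSec.sub {f g : ∀ y, B.Fib (ν y)} (hf : IsContSec f) (hg : IsContSec g) :
    IsContSec (fun y => f y - g y) := by
  have := hf.add (hg.const_smul (-1))
  simpa only [neg_smul, one_smul, ← sub_eq_add_neg] using this

theorem IsContSec.zero (hν : Continuous ν) : IsContSec (B := B) (fun y => (0 : B.Fib (ν y))) :=
  continuous_iff_continuousAt.2 fun y => tendsto_zero (hν.tendsto y) (by simp)

theorem IsContSec.comp {Z : Type*} [TopologicalSpace Z] {f : ∀ y, B.Fib (ν y)} (hf : IsContSec f)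
    {j : Z → Y} (hj : Continuous j) : IsContSec (fun z => f (j z)) :=
  Continuous.comp hf hj

/-- A section which is, near each point, a uniform limit of continuous sections is continuous. -/
theorem isContSec_of_approx (hν : Continuous ν) {f : ∀ y, B.Fib (ν y)}
    (h : ∀ y₀, ∀ ε > 0, ∃ g : ∀ y, B.Fib (ν y), IsContSec g ∧ ∀ᶠ y in 𝓝 y₀, ‖f y - g y‖ ≤ ε) :
    IsContSec f := by
  refine continuous_iff_continuousAt.2 fun y₀ => ?_
  intro O hO
  -- near `(f y₀, 0)` the addition takes its values in `O`
  have hadd := (B.continuous_add.tendsto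
    ⟨((f y₀).val, (0 : B.Fib (ν y₀)).val), (f y₀).prop.trans (0 : B.Fib (ν y₀)).prop.symm⟩)
  rw [fib_add, add_zero] at hadd
  have h1 := hadd hO
  obtain ⟨t, ht, htO⟩ := (mem_nhds_induced Subtype.val _ _).1 h1
  rw [nhds_prod_eq, mem_prod_iff] at ht
  obtain ⟨W, hW, Z, hZ, hWZ⟩ := ht
  have hZ' := B.nhds_zero (ν y₀) hZ
  rw [mem_inf_iff] at hZ'
  obtain ⟨Z₁, hZ₁, Z₂, hZ₂, hZ12⟩ := hZ'
  rw [mem_comap] at hZ₁ hZ₂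
  obtain ⟨U, hU, hUZ⟩ := hZ₁
  obtain ⟨D, hD, hDZ⟩ := hZ₂
  obtain ⟨δ, hδ, hδD⟩ := Metric.mem_nhds_iff.1 hD
  obtain ⟨g, hg, hfg⟩ := h y₀ (δ / 4) (by positivity)
  -- the set of all `w ∈ W` which are `δ / 2`-close to `g`
  have hclose : ∀ᶠ w in 𝓝 ((f y₀).val, y₀), ∀ hw : B.p w.1 = ν w.2,
      ‖(⟨w.1, hw⟩ : B.Fib (ν w.2)) - g w.2‖ < δ / 2 := by
    let T := {w : B.E × Y // B.p w.1 = ν w.2}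
    let F : ∀ w : T, B.Fib (ν w.1.2) := fun w => ⟨w.1.1, w.2⟩
    have hF : IsContSec F := continuous_fst.comp continuous_subtype_val
    have hG : IsContSec fun w : T => g w.1.2 :=
      hg.comp (continuous_snd.comp continuous_subtype_val)
    have hc := (hF.sub hG).norm
    have h0 : ‖F ⟨((f y₀).val, y₀), (f y₀).prop⟩ - g y₀‖ < δ / 2 := by
      have : ‖f y₀ - g y₀‖ ≤ δ / 4 := hfg.self_of_nhds
      change ‖f y₀ - g y₀‖ < δ / 2
      linarith
    have h2 : ∀ᶠ w in 𝓝 (⟨((f y₀).val, y₀), (f y₀).prop⟩ : T), ‖F w - g w.1.2‖ < δ / 2 :=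
      hc.continuousAt.eventually_lt continuousAt_const h0
    rw [nhds_induced, eventually_comap] at h2
    filter_upwards [h2] with w hw hw'
    exact hw ⟨w, hw'⟩ rfl
  rw [nhds_prod_eq, eventually_prod_iff] at hclose
  obtain ⟨P, hP, Q, hQ, hPQ⟩ := hclose
  have hopen : B.p '' (W ∩ {w | P w}) ∈ 𝓝 (ν y₀) := by
    have := B.isOpenMap_p.image_mem_nhds (inter_mem hW hP)
    rwa [(f y₀).prop] at this
  have hν3 : ∀ᶠ y in 𝓝 y₀, ν y ∈ B.p '' (W ∩ {w | P w}) := hν.continuousAt hopen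
  have hν4 : ∀ᶠ y in 𝓝 y₀, ν y ∈ U := hν.continuousAt hU
  change ∀ᶠ y in 𝓝 y₀, (f y).val ∈ O
  filter_upwards [hfg, hQ, hν3, hν4] with y hy1 hy2 hy3 hy4
  obtain ⟨w, ⟨hwW, hwP⟩, hwy⟩ := hy3
  have hd := hPQ hwP hy2 hwy
  set w' : B.Fib (ν y) := ⟨w, hwy⟩ with hw'
  have hsmall : ‖f y - w'‖ < δ := by
    have : f y - w' = (f y - g y) - (w' - g y) := by abel
    rw [this]
    refine (norm_sub_le _ _).trans_lt ?_
    change ‖w' - g y‖ < δ / 2 at hd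
    linarith
  have hz : (f y - w').val ∈ Z := by
    rw [hZ12]
    refine ⟨hUZ ?_, hDZ ?_⟩
    · change B.p _ ∈ U
      rw [(f y - w').prop]; exact hy4
    · apply hδD
      simp only [fib_norm, Metric.mem_ball, dist_zero_right, norm_norm, hsmall]
  have hpp : B.p w = B.p (f y - w').val := hwy.trans (f y - w').prop.symm
  have hres := htO (show (⟨(w, (f y - w').val), hpp⟩ : {w : B.E × B.E // B.p w.1 = B.p w.2}) ∈ _
    from hWZ ⟨hwW, hz⟩)
  have e := fib_add w' (f y - w') hpp.symm
  rw [add_sub_cancel] at e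
  change _ ∈ O at hres
  rw [← e]
  exact hres

/-- Within one fibre, the topology of the total space is that of the norm. -/
theorem isContSec_const {x : X} {f : Y → B.Fib x} (hf : IsContSec (ν := fun _ => x) f) :
    Continuous f := by
  refine continuous_iff_continuousAt.2 fun y₀ => ?_
  rw [ContinuousAt, tendsto_iff_norm_sub_tendsto_zero]
  have hc : IsContSec (B := B) (ν := fun _ : Y => x) (fun _ => f y₀) := continuous_const
  have := (hf.sub hc).norm.tendsto y₀
  simpa only [sub_self, norm_zero] using this

end BanachBundle

/-- A Fell bundle over `G` (a `C*`-algebraic bundle in the sense of Fell and Doran): a Banach bundle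
with a continuous associative bilinear multiplication `A_g × A_h → A_{gh}` and a continuous
conjugate-linear involution `A_g → A_{g⁻¹}` such that `‖a b‖ ≤ ‖a‖ ‖b‖`, `‖a*‖ = ‖a‖`,
`‖a* a‖ = ‖a‖²`, and `a* a` is positive in the `C*`-algebra `A_e`, i.e. `a* a = c* c` with
`c ∈ A_e`. -/
structure FellBundle (G : Type u) [Group G] [TopologicalSpace G] extends BanachBundle G where
  protected mul : E → E → E
  protected p_mul : ∀ a b, p (mul a b) = p a * p b
  protected mul_assoc : ∀ a b c, mul (mul a b) c = mul a (mul b c)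
  protected continuous_mul : Continuous fun w : E × E => mul w.1 w.2
  protected mul_add : ∀ {g h : G} (a : Fiber p g) (b b' : Fiber p h), mul a.val (b + b').val =
    ((⟨mul a.val b.val, by rw [p_mul, a.prop, b.prop]⟩ : Fiber p (g * h)) +
      ⟨mul a.val b'.val, by rw [p_mul, a.prop, b'.prop]⟩).val
  protected add_mul : ∀ {g h : G} (a a' : Fiber p g) (b : Fiber p h), mul (a + a').val b.val =
    ((⟨mul a.val b.val, by rw [p_mul, a.prop, b.prop]⟩ : Fiber p (g * h)) +
      ⟨mul a'.val b.val, by rw [p_mul, a'.prop, b.prop]⟩).val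
  protected mul_smul : ∀ {g h : G} (c : ℂ) (a : Fiber p g) (b : Fiber p h), mul a.val (c • b).val =
    (c • (⟨mul a.val b.val, by rw [p_mul, a.prop, b.prop]⟩ : Fiber p (g * h))).val
  protected smul_mul : ∀ {g h : G} (c : ℂ) (a : Fiber p g) (b : Fiber p h), mul (c • a).val b.val =
    (c • (⟨mul a.val b.val, by rw [p_mul, a.prop, b.prop]⟩ : Fiber p (g * h))).val
  protected norm_mul_le : ∀ a b : E, ‖(⟨mul a b, rfl⟩ : Fiber p (p (mul a b)))‖ ≤
    ‖(⟨a, rfl⟩ : Fiber p (p a))‖ * ‖(⟨b, rfl⟩ : Fiber p (p b))‖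
  protected star : E → E
  protected p_star : ∀ a, p (star a) = (p a)⁻¹
  protected star_star : ∀ a, star (star a) = a
  protected star_mul : ∀ a b, star (mul a b) = mul (star b) (star a)
  protected continuous_star : Continuous star
  protected star_add : ∀ {g : G} (a b : Fiber p g), star (a + b).val =
    ((⟨star a.val, by rw [p_star, a.prop]⟩ : Fiber p g⁻¹) +
      ⟨star b.val, by rw [p_star, b.prop]⟩).val
  protected star_smul : ∀ {g : G} (c : ℂ) (a : Fiber p g), star (c • a).val =
    (starRingEnd ℂ c • (⟨star a.val, by rw [p_star, a.prop]⟩ : Fiber p g⁻¹)).val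
  protected norm_star : ∀ a : E, ‖(⟨star a, rfl⟩ : Fiber p (p (star a)))‖ = ‖(⟨a, rfl⟩ : Fiber p (p a))‖
  protected norm_star_mul_self : ∀ a : E, ‖(⟨mul (star a) a, rfl⟩ : Fiber p (p (mul (star a) a)))‖ =
    ‖(⟨a, rfl⟩ : Fiber p (p a))‖ ^ 2
  protected star_mul_self_pos : ∀ a : E, ∃ c : E, p c = 1 ∧ mul (star a) a = mul (star c) c

/-- A twist over `G`: a central extension `𝕋 → H → G` of locally compact groups. -/
structure Twist (G : Type u) [Group G] [TopologicalSpace G] where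
  H : Type u
  [group : Group H]
  [top : TopologicalSpace H]
  [topGroup : IsTopologicalGroup H]
  [locallyCompact : LocallyCompactSpace H]
  [t2 : T2Space H]
  ι : Circle →* H
  q : H →* G
  continuous_ι : Continuous ι
  injective_ι : Function.Injective ι
  continuous_q : Continuous q
  isOpenMap_q : IsOpenMap q
  surjective_q : Function.Surjective q
  ker_q : ∀ x : H, q x = 1 ↔ ∃ z : Circle, ι z = x
  central : ∀ (z : Circle) (x : H), ι z * x = x * ι z

namespace Twist

attribute [instance] Twist.group Twist.top Twist.topGroup Twist.locallyCompact Twist.t2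

variable {G : Type u} [Group G] [TopologicalSpace G] (σ : Twist G)

instance : MeasurableSpace σ.H := borel σ.H

instance : BorelSpace σ.H := ⟨rfl⟩

theorem q_ι (z : Circle) : σ.q (σ.ι z) = 1 := (σ.ker_q _).2 ⟨z, rfl⟩

theorem exists_ι {x y : σ.H} (h : σ.q y = σ.q x) : ∃ z : Circle, y = σ.ι z * x := by
  obtain ⟨z, hz⟩ := (σ.ker_q (y * x⁻¹)).1 (by rw [map_mul, map_inv, h, mul_inv_cancel])
  exact ⟨z, by rw [hz, inv_mul_cancel_right]⟩

theorem isInducing_ι : IsInducing σ.ι :=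
  (σ.continuous_ι.isClosedEmbedding σ.injective_ι).isInducing

variable {σ}

theorem exists_cocycle {s : G → σ.H} (hs : ∀ g, σ.q (s g) = g) (g h : G) :
    ∃ z : Circle, σ.ι z = s g * s h * (s (g * h))⁻¹ :=
  (σ.ker_q _).1 (by rw [map_mul, map_mul, map_inv, hs, hs, hs, mul_inv_cancel])

/-- The cocycle `ω = ∂s` of a section `s` of `q`, that is `ω(g,h) = s(g) s(h) s(gh)⁻¹ ∈ 𝕋`. -/
def cocycle {s : G → σ.H} (hs : ∀ g, σ.q (s g) = g) (g h : G) : Circle :=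
  (exists_cocycle hs g h).choose

theorem ι_cocycle {s : G → σ.H} (hs : ∀ g, σ.q (s g) = g) (g h : G) :
    σ.ι (cocycle hs g h) = s g * s h * (s (g * h))⁻¹ :=
  (exists_cocycle hs g h).choose_spec

end Twist

namespace FellBundle

open BanachBundle

variable {G : Type u} [Group G] [TopologicalSpace G] (A : FellBundle G)

/-- Scalar multiplication on the total space. -/
def sm (c : ℂ) (a : A.E) : A.E := (c • (⟨a, rfl⟩ : A.Fib (A.p a))).val

variable {A}

theorem p_sm (c : ℂ) (a : A.E) : A.p (A.sm c a) = A.p a := (c • (⟨a, rfl⟩ : A.Fib (A.p a))).prop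

theorem sm_val {g : G} (c : ℂ) (a : A.Fib g) : A.sm c a.val = (c • a).val :=
  BanachBundle.fib_smul c a

theorem one_sm (a : A.E) : A.sm 1 a = a := by rw [sm, one_smul]

theorem sm_sm (c d : ℂ) (a : A.E) : A.sm c (A.sm d a) = A.sm (c * d) a := by
  change A.sm c ((d • (⟨a, rfl⟩ : A.Fib (A.p a))).val) = _
  rw [sm_val, smul_smul]; rfl

theorem sm_mul (c : ℂ) (a b : A.E) : A.mul (A.sm c a) b = A.sm c (A.mul a b) := by
  have h := A.smul_mul c (⟨a, rfl⟩ : A.Fib (A.p a)) (⟨b, rfl⟩ : A.Fib (A.p b))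
  rw [← sm_val] at h
  exact h.trans (sm_val _ _).symm

theorem mul_sm (c : ℂ) (a b : A.E) : A.mul a (A.sm c b) = A.sm c (A.mul a b) := by
  have h := A.mul_smul c (⟨a, rfl⟩ : A.Fib (A.p a)) (⟨b, rfl⟩ : A.Fib (A.p b))
  rw [← sm_val] at h
  exact h.trans (sm_val _ _).symm

theorem star_sm (c : ℂ) (a : A.E) : A.star (A.sm c a) = A.sm (starRingEnd ℂ c) (A.star a) := by
  have h := A.star_smul c (⟨a, rfl⟩ : A.Fib (A.p a))
  rw [← sm_val] at h
  exact h.trans (sm_val _ _).symm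

theorem continuous_sm (c : ℂ) : Continuous (A.sm c) := A.continuous_smul c

/-! ### The twisted Fell bundle -/

variable (A) (σ : Twist G)

/-- The total space of the pull-back bundle `q^* A` over the extension. -/
abbrev PullE : Type u := {w : A.E × σ.H // A.p w.1 = σ.q w.2}

variable {A σ} in
/-- The element `(a, x)` of the pull-back. -/
def pmk (a : A.E) (x : σ.H) (h : A.p a = σ.q x) : PullE A σ := ⟨(a, x), h⟩

theorem circle_conj_mul (z w : Circle) :
    (((z * w)⁻¹ : Circle) : ℂ) = ((z⁻¹ : Circle) : ℂ) * ((w⁻¹ : Circle) : ℂ) := by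
  rw [mul_inv, Circle.coe_mul]

/-- The diagonal action `z · (a, x) = (z̄ a, z x)` of the circle. -/
instance : MulAction Circle (PullE A σ) where
  smul z w := ⟨(A.sm ((z⁻¹ : Circle) : ℂ) w.1.1, σ.ι z * w.1.2), by
    rw [p_sm, map_mul, σ.q_ι, one_mul]; exact w.2⟩
  one_smul _ := Subtype.ext (Prod.ext
    (by change A.sm (((1 : Circle)⁻¹ : Circle) : ℂ) _ = _; rw [inv_one, Circle.coe_one, one_sm])
    (by change σ.ι 1 * _ = _; rw [map_one, one_mul]))
  mul_smul z z' w := Subtype.ext (Prod.ext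
    (by
      change A.sm (((z * z')⁻¹ : Circle) : ℂ) _ =
        A.sm ((z⁻¹ : Circle) : ℂ) (A.sm ((z'⁻¹ : Circle) : ℂ) _)
      rw [sm_sm, circle_conj_mul])
    (by
      change σ.ι (z * z') * _ = σ.ι z * (σ.ι z' * _)
      rw [map_mul, _root_.mul_assoc]))

theorem smul_pull_fst (z : Circle) (w : PullE A σ) :
    (z • w).1.1 = A.sm ((z⁻¹ : Circle) : ℂ) w.1.1 := rfl

theorem smul_pull_snd (z : Circle) (w : PullE A σ) : (z • w).1.2 = σ.ι z * w.1.2 := rfl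

instance : ContinuousConstSMul Circle (PullE A σ) where
  continuous_const_smul _ := Continuous.subtype_mk
    (((continuous_sm _).comp (continuous_fst.comp continuous_subtype_val)).prodMk
      (continuous_const.mul (continuous_snd.comp continuous_subtype_val))) _

/-- The total space `q^* A / 𝕋` of the twisted Fell bundle. -/
def TwE : Type u := Quotient (MulAction.orbitRel Circle (PullE A σ))

instance : TopologicalSpace (TwE A σ) := instTopologicalSpaceQuotient

variable {A σ}

/-- The class `[a, x]`. -/
def tmk (w : PullE A σ) : TwE A σ := Quotient.mk _ w

theorem isOpenQuotientMap_tmk : IsOpenQuotientMap (tmk (A := A) (σ := σ)) :=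
  MulAction.isOpenQuotientMap_quotientMk

theorem tmk_eq_iff {w w' : PullE A σ} : tmk w = tmk w' ↔ ∃ z : Circle, z • w' = w := by
  refine (Quotient.eq (r := MulAction.orbitRel Circle (PullE A σ))).trans ?_
  exact MulAction.orbitRel_apply

theorem tmk_smul (z : Circle) (w : PullE A σ) : tmk (z • w) = tmk w := tmk_eq_iff.2 ⟨z, rfl⟩

/-- The bundle projection `[a, x] ↦ p(a) = q(x)`. -/
def twP : TwE A σ → G :=
  Quotient.lift (fun w => σ.q w.1.2) fun w w' h => by
    obtain ⟨z, rfl⟩ := MulAction.orbitRel_apply.1 h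
    change σ.q (σ.ι z * w'.1.2) = _
    rw [map_mul, σ.q_ι, one_mul]

theorem twP_tmk (w : PullE A σ) : twP (tmk w) = σ.q w.1.2 := rfl

theorem twP_tmk' (w : PullE A σ) : twP (tmk w) = A.p w.1.1 := w.2.symm

/-- For a fixed lift `x` of `g`, the map `A_g → A_{σ,g}`, `a ↦ [a, x]`. -/
def tfun {g : G} (x : σ.H) (hx : σ.q x = g) (a : A.Fib g) : Fiber (twP (A := A) (σ := σ)) g :=
  ⟨tmk (pmk a.val x (a.prop.trans hx.symm)), hx⟩

theorem tfun_shift {g : G} (x : σ.H) (hx : σ.q x = g) (a : A.Fib g) (z : Circle)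
    (hx' : σ.q (σ.ι z * x) = g) : tfun (σ.ι z * x) hx' (((z⁻¹ : Circle) : ℂ) • a) = tfun x hx a := by
  refine Fiber.ext ?_
  have h := tmk_smul z (pmk a.val x (a.prop.trans hx.symm))
  have e : z • (pmk a.val x (a.prop.trans hx.symm)) =
      pmk (((z⁻¹ : Circle) : ℂ) • a).val (σ.ι z * x) (Fiber.prop _ |>.trans hx'.symm) :=
    Subtype.ext (Prod.ext (sm_val _ a) rfl)
  rw [e] at h
  exact h

theorem tfun_bijective {g : G} (x : σ.H) (hx : σ.q x = g) :
    Function.Bijective (tfun (A := A) x hx) := by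
  constructor
  · intro a b hab
    obtain ⟨z, hz⟩ := tmk_eq_iff.1 (congrArg Fiber.val hab)
    have h2 : σ.ι z * x = x := congrArg (fun w : PullE A σ => w.1.2) hz
    have h3 : z = 1 := σ.injective_ι (by rw [map_one]; exact mul_eq_right.1 h2)
    subst h3
    rw [one_smul] at hz
    exact Fiber.ext (congrArg (fun w : PullE A σ => w.1.1) hz).symm
  · rintro ⟨e, he⟩
    obtain ⟨w, rfl⟩ := isOpenQuotientMap_tmk.surjective e
    obtain ⟨z, hz⟩ := σ.exists_ι (x := w.1.2) (y := x) (hx.trans he.symm)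
    subst hz
    have hp : A.p (z • w).1.1 = g := (z • w).2.trans hx
    refine ⟨⟨(z • w).1.1, hp⟩, Fiber.ext ?_⟩
    exact tmk_smul z w

/-- A lift of `g` to the extension. -/
def lift (σ : Twist G) (g : G) : σ.H := (σ.surjective_q g).choose

theorem q_lift (g : G) : σ.q (lift σ g) = g := (σ.surjective_q g).choose_spec

/-- The identification of `A_{σ,g}` with `A_g` by means of a lift `x` of `g`: the element `[a, x]`
corresponds to `a`. -/
def coordEquiv {g : G} (x : σ.H) (hx : σ.q x = g) :
    Fiber (twP (A := A) (σ := σ)) g ≃ A.Fib g := (Equiv.ofBijective _ (tfun_bijective x hx)).symm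

theorem coordEquiv_tfun {g : G} (x : σ.H) (hx : σ.q x = g) (a : A.Fib g) :
    coordEquiv x hx (tfun x hx a) = a := (Equiv.ofBijective _ (tfun_bijective x hx)).symm_apply_apply a

theorem tfun_coordEquiv {g : G} (x : σ.H) (hx : σ.q x = g) (a : Fiber (twP (A := A) (σ := σ)) g) :
    tfun x hx (coordEquiv x hx a) = a := (Equiv.ofBijective _ (tfun_bijective x hx)).apply_symm_apply a

/- The Banach space structure of `A_{σ,g}`; by the lemmas below it does not depend on the lift. -/
instance (g : G) : NormedAddCommGroup (Fiber (twP (A := A) (σ := σ)) g) :=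
  (coordEquiv (lift σ g) (q_lift g)).normedAddCommGroup

instance (g : G) : NormedSpace ℂ (Fiber (twP (A := A) (σ := σ)) g) :=
  (coordEquiv (lift σ g) (q_lift g)).normedSpace ℂ

theorem coord_lift_add {g : G} (a b : Fiber (twP (A := A) (σ := σ)) g) :
    coordEquiv (lift σ g) (q_lift g) (a + b) =
      coordEquiv (lift σ g) (q_lift g) a + coordEquiv (lift σ g) (q_lift g) b :=
  (coordEquiv (lift σ g) (q_lift g)).apply_symm_apply _

theorem coord_lift_smul {g : G} (c : ℂ) (a : Fiber (twP (A := A) (σ := σ)) g) :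
    coordEquiv (lift σ g) (q_lift g) (c • a) = c • coordEquiv (lift σ g) (q_lift g) a :=
  (coordEquiv (lift σ g) (q_lift g)).apply_symm_apply _

theorem coord_lift_norm {g : G} (a : Fiber (twP (A := A) (σ := σ)) g) :
    ‖coordEquiv (lift σ g) (q_lift g) a‖ = ‖a‖ := rfl

theorem tfun_eq_lift {g : G} (x : σ.H) (hx : σ.q x = g) : ∃ z : Circle, ∀ a : A.Fib g,
    tfun x hx a = tfun (lift σ g) (q_lift g) (((z⁻¹ : Circle) : ℂ) • a) := by
  obtain ⟨z, hz⟩ := σ.exists_ι (x := x) (y := lift σ g) ((q_lift g).trans hx.symm)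
  refine ⟨z, fun a => ?_⟩
  rw [← tfun_shift x hx a z (by rw [← hz]; exact q_lift g)]
  congr 1
  exact hz.symm

/-- `[a, x] + [b, x] = [a + b, x]` for every lift `x`. -/
theorem tfun_add {g : G} (x : σ.H) (hx : σ.q x = g) (a b : A.Fib g) :
    tfun x hx (a + b) = tfun x hx a + tfun x hx b := by
  obtain ⟨z, hz⟩ := tfun_eq_lift (A := A) x hx
  refine (coordEquiv (lift σ g) (q_lift g)).injective ?_
  rw [coord_lift_add, hz, hz, hz, coordEquiv_tfun, coordEquiv_tfun, coordEquiv_tfun, smul_add]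

/-- `c [a, x] = [c a, x]` for every lift `x`. -/
theorem tfun_smul {g : G} (x : σ.H) (hx : σ.q x = g) (c : ℂ) (a : A.Fib g) :
    tfun x hx (c • a) = c • tfun x hx a := by
  obtain ⟨z, hz⟩ := tfun_eq_lift (A := A) x hx
  refine (coordEquiv (lift σ g) (q_lift g)).injective ?_
  rw [coord_lift_smul, hz, hz, coordEquiv_tfun, coordEquiv_tfun, smul_comm]

/-- `‖[a, x]‖ = ‖a‖` for every lift `x`. -/
theorem norm_tfun {g : G} (x : σ.H) (hx : σ.q x = g) (a : A.Fib g) : ‖tfun x hx a‖ = ‖a‖ := by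
  obtain ⟨z, hz⟩ := tfun_eq_lift (A := A) x hx
  rw [← coord_lift_norm, hz, coordEquiv_tfun, norm_smul, Circle.norm_coe, one_mul]

instance (g : G) : CompleteSpace (Fiber (twP (A := A) (σ := σ)) g) := by
  let e : Fiber (twP (A := A) (σ := σ)) g ≃ᵢ A.Fib g :=
    { coordEquiv (lift σ g) (q_lift g) with isometry_toFun := fun _ _ => rfl }
  exact e.completeSpace

theorem exists_tfun {g : G} (a : Fiber (twP (A := A) (σ := σ)) g) (x : σ.H) (hx : σ.q x = g) :
    ∃ a₀ : A.Fib g, a = tfun x hx a₀ := ⟨_, (tfun_coordEquiv x hx a).symm⟩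

theorem tmk_fib (w : PullE A σ) : (⟨tmk w, rfl⟩ : Fiber twP (twP (tmk w))) =
    tfun w.1.2 rfl (⟨w.1.1, w.2⟩ : A.Fib (σ.q w.1.2)) := rfl

theorem isOpenMap_pull_snd : IsOpenMap fun w : PullE A σ => w.1.2 := by
  rw [isOpenMap_iff_nhds_le]
  intro w S hS
  rw [mem_map] at hS
  obtain ⟨t, ht, htS⟩ := (mem_nhds_induced Subtype.val w _).1 hS
  rw [nhds_prod_eq, mem_prod_iff] at ht
  obtain ⟨W, hW, V, hV, hWV⟩ := ht
  have h1 : A.p '' W ∈ 𝓝 (σ.q w.1.2) := by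
    rw [← w.2]; exact A.isOpenMap_p.image_mem_nhds hW
  filter_upwards [hV, σ.continuous_q.continuousAt h1] with y hy1 hy2
  obtain ⟨b, hb, hby⟩ := hy2
  exact htS (show (pmk b y hby : PullE A σ) ∈ _ from hWV ⟨hb, hy1⟩)

theorem isOpenMap_twP : IsOpenMap (twP (A := A) (σ := σ)) := by
  intro O hO
  have h : twP '' O = σ.q '' ((fun w : PullE A σ => w.1.2) '' (tmk ⁻¹' O)) := by
    rw [Set.image_image]
    change _ = (fun w => twP (tmk w)) '' _
    rw [← Set.image_image twP tmk, Set.image_preimage_eq _ isOpenQuotientMap_tmk.surjective]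
  rw [h]
  exact σ.isOpenMap_q _ (isOpenMap_pull_snd _ (hO.preimage isOpenQuotientMap_tmk.continuous))

variable (A σ) in
/-- The Banach bundle underlying the twisted Fell bundle `A_σ = q^* A / 𝕋`. -/
def twistedBanach : BanachBundle G where
  E := TwE A σ
  p := twP
  continuous_p := isOpenQuotientMap_tmk.continuous_comp_iff.1
    (σ.continuous_q.comp (continuous_snd.comp continuous_subtype_val))
  isOpenMap_p := isOpenMap_twP
  continuous_norm := by
    refine isOpenQuotientMap_tmk.continuous_comp_iff.1 ?_
    have h : IsContSec (B := A.toBanachBundle) (ν := fun w : PullE A σ => σ.q w.1.2)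
        (fun w => ⟨w.1.1, w.2⟩) := continuous_fst.comp continuous_subtype_val
    refine h.norm.congr fun w => ?_
    exact (norm_tfun w.1.2 rfl (⟨w.1.1, w.2⟩ : A.Fib (σ.q w.1.2))).symm
  continuous_add := by
    let D : Set (TwE A σ × TwE A σ) := {w | twP w.1 = twP w.2}
    let m : PullE A σ × PullE A σ → TwE A σ × TwE A σ := Prod.map tmk tmk
    have hm : IsOpenQuotientMap m := isOpenQuotientMap_tmk.prodMap isOpenQuotientMap_tmk
    have hmD : IsOpenQuotientMap (D.restrictPreimage m) :=
      ⟨D.restrictPreimage_surjective hm.surjective, hm.continuous.restrictPreimage,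
        hm.isOpenMap.restrictPreimage D⟩
    refine hmD.continuous_comp_iff.1 ?_
    have hq : ∀ w : m ⁻¹' D, σ.q w.1.2.1.2 = σ.q w.1.1.1.2 := fun w => w.2.symm
    choose z hz using fun w : m ⁻¹' D => σ.exists_ι (hq w)
    have cx : Continuous fun w : m ⁻¹' D => w.1.1.1.2 := continuous_snd.comp
      (continuous_subtype_val.comp (continuous_fst.comp continuous_subtype_val))
    have cy : Continuous fun w : m ⁻¹' D => w.1.2.1.2 := continuous_snd.comp
      (continuous_subtype_val.comp (continuous_snd.comp continuous_subtype_val))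
    have ca : Continuous fun w : m ⁻¹' D => w.1.1.1.1 := continuous_fst.comp
      (continuous_subtype_val.comp (continuous_fst.comp continuous_subtype_val))
    have cb : Continuous fun w : m ⁻¹' D => w.1.2.1.1 := continuous_fst.comp
      (continuous_subtype_val.comp (continuous_snd.comp continuous_subtype_val))
    have hzc : Continuous z := by
      rw [σ.isInducing_ι.continuous_iff]
      refine (cy.mul cx.inv).congr fun w => ?_
      change w.1.2.1.2 * (w.1.1.1.2)⁻¹ = σ.ι (z w)
      rw [hz w, mul_inv_cancel_right]
    let f₁ : ∀ w : m ⁻¹' D, A.Fib (σ.q w.1.1.1.2) := fun w => ⟨w.1.1.1.1, w.1.1.2⟩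
    let f₂ : ∀ w : m ⁻¹' D, A.Fib (σ.q w.1.1.1.2) := fun w => ⟨w.1.2.1.1, w.1.2.2.trans (hq w)⟩
    have hf₁ : IsContSec f₁ := ca
    have hf₂ : IsContSec f₂ := cb
    have hs := hf₁.add (hf₂.smul ((continuous_subtype_val : Continuous ((↑) : Circle → ℂ)).comp hzc))
    have hc : Continuous fun w : m ⁻¹' D =>
        tmk (pmk (f₁ w + (z w : ℂ) • f₂ w).val w.1.1.1.2 (Fiber.prop _)) :=
      isOpenQuotientMap_tmk.continuous.comp (Continuous.subtype_mk (hs.prodMk cx) _)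
    refine hc.congr fun w => ?_
    have e₁ : (⟨tmk w.1.1, rfl⟩ : Fiber (twP (A := A) (σ := σ)) (twP (tmk w.1.1))) =
      tfun w.1.1.1.2 rfl (f₁ w) := rfl
    have e₂ : (⟨tmk w.1.2, hq w⟩ : Fiber (twP (A := A) (σ := σ)) (twP (tmk w.1.1))) =
        tfun w.1.1.1.2 rfl ((z w : ℂ) • f₂ w) := by
      have hx' : σ.q (σ.ι (z w) * w.1.1.1.2) = σ.q w.1.1.1.2 := by
        rw [map_mul, σ.q_ι, one_mul]
      have := tfun_shift (A := A) w.1.1.1.2 rfl ((z w : ℂ) • f₂ w) (z w) hx'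
      rw [smul_smul, ← Circle.coe_mul, inv_mul_cancel, Circle.coe_one, one_smul] at this
      rw [← this]
      refine Fiber.ext (congrArg tmk (Subtype.ext (Prod.ext rfl (hz w))))
    change (tfun w.1.1.1.2 rfl (f₁ w + (z w : ℂ) • f₂ w)).val =
      ((⟨tmk w.1.1, rfl⟩ : Fiber (twP (A := A) (σ := σ)) (twP (tmk w.1.1))) +
        ⟨tmk w.1.2, hq w⟩).val
    rw [tfun_add, e₁, e₂]
    rfl
  continuous_smul c := by
    refine isOpenQuotientMap_tmk.continuous_comp_iff.1 ?_
    have h : IsContSec (B := A.toBanachBundle) (ν := fun w : PullE A σ => σ.q w.1.2)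
        (fun w => ⟨w.1.1, w.2⟩) := continuous_fst.comp continuous_subtype_val
    have hc : Continuous fun w : PullE A σ =>
        tmk (pmk (c • (⟨w.1.1, w.2⟩ : A.Fib (σ.q w.1.2))).val w.1.2 (Fiber.prop _)) :=
      isOpenQuotientMap_tmk.continuous.comp (Continuous.subtype_mk
        ((h.const_smul c).prodMk (continuous_snd.comp continuous_subtype_val)) _)
    refine hc.congr fun w => ?_
    exact congrArg Fiber.val (tfun_smul w.1.2 rfl c (⟨w.1.1, w.2⟩ : A.Fib (σ.q w.1.2)))
  nhds_zero g := by
    intro O hO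
    have e0 : (0 : Fiber (twP (A := A) (σ := σ)) g) = tfun (lift σ g) (q_lift g) 0 := by
      have := tfun_smul (A := A) (lift σ g) (q_lift g) 0 0
      rw [zero_smul, zero_smul] at this
      exact this.symm
    rw [e0] at hO
    have h1 := isOpenQuotientMap_tmk.continuous.continuousAt hO
    rw [mem_map] at h1
    obtain ⟨t, ht, htO⟩ := (mem_nhds_induced Subtype.val _ _).1 h1
    change t ∈ 𝓝 ((0 : A.Fib g).val, lift σ g) at ht
    rw [nhds_prod_eq, mem_prod_iff] at ht
    obtain ⟨W, hW, V, hV, hWV⟩ := ht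
    obtain ⟨Z₁, hZ₁, Z₂, hZ₂, hZ12⟩ := mem_inf_iff.1 (A.nhds_zero g hW)
    obtain ⟨U, hU, hUZ⟩ := mem_comap.1 hZ₁
    obtain ⟨D, hD, hDZ⟩ := mem_comap.1 hZ₂
    have hqV : σ.q '' V ∈ 𝓝 g := by
      have := σ.isOpenMap_q.image_mem_nhds hV
      rwa [q_lift] at this
    refine mem_of_superset (inter_mem_inf (preimage_mem_comap (inter_mem hU hqV))
      (preimage_mem_comap hD)) ?_
    rintro e ⟨⟨heU, x, hxV, hxe⟩, heD⟩
    obtain ⟨a, ha⟩ := exists_tfun (⟨e, rfl⟩ : Fiber (twP (A := A) (σ := σ)) (twP e)) x hxe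
    have hn : ‖(⟨a.val, rfl⟩ : A.Fib (A.p a.val))‖ ∈ D := by
      rw [fib_norm, ← norm_tfun x hxe a, ← ha]; exact heD
    have haW : a.val ∈ W := by
      rw [hZ12]
      exact ⟨hUZ (show A.p a.val ∈ U by rw [a.prop]; exact heU), hDZ hn⟩
    have := htO (show (pmk a.val x (a.prop.trans hxe.symm) : PullE A σ) ∈ _ from hWV ⟨haW, hxV⟩)
    have e' : e = tmk (pmk a.val x (a.prop.trans hxe.symm)) := congrArg Fiber.val ha
    rw [e']
    exact this

/-- The multiplication `[a, x] [b, y] = [a b, x y]`. -/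
def twMul : TwE A σ → TwE A σ → TwE A σ :=
  Quotient.map₂ (fun w w' => pmk (A.mul w.1.1 w'.1.1) (w.1.2 * w'.1.2)
    (by rw [A.p_mul, w.2, w'.2, map_mul])) fun w₁ w₂ h w₁' w₂' h' => by
    obtain ⟨z, rfl⟩ := MulAction.orbitRel_apply.1 h
    obtain ⟨z', rfl⟩ := MulAction.orbitRel_apply.1 h'
    refine MulAction.orbitRel_apply.2 ⟨z * z', Subtype.ext (Prod.ext ?_ ?_)⟩
    · change A.sm (((z * z')⁻¹ : Circle) : ℂ) (A.mul w₂.1.1 w₂'.1.1) =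
        A.mul (A.sm ((z⁻¹ : Circle) : ℂ) w₂.1.1) (A.sm ((z'⁻¹ : Circle) : ℂ) w₂'.1.1)
      rw [sm_mul, mul_sm, sm_sm, circle_conj_mul]
    · change σ.ι (z * z') * (w₂.1.2 * w₂'.1.2) = σ.ι z * w₂.1.2 * (σ.ι z' * w₂'.1.2)
      rw [map_mul, _root_.mul_assoc, _root_.mul_assoc, ← _root_.mul_assoc (σ.ι z'), σ.central z',
        _root_.mul_assoc]

/-- The involution `[a, x]* = [a*, x⁻¹]`. -/
def twStar : TwE A σ → TwE A σ :=
  Quotient.map (fun w => pmk (A.star w.1.1) (w.1.2)⁻¹ (by rw [A.p_star, w.2, map_inv]))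
    fun w₁ w₂ h => by
    obtain ⟨z, rfl⟩ := MulAction.orbitRel_apply.1 h
    refine MulAction.orbitRel_apply.2 ⟨z⁻¹, Subtype.ext (Prod.ext ?_ ?_)⟩
    · change A.sm (((z⁻¹)⁻¹ : Circle) : ℂ) (A.star w₂.1.1) =
        A.star (A.sm ((z⁻¹ : Circle) : ℂ) w₂.1.1)
      rw [star_sm, inv_inv, Circle.coe_inv_eq_conj, Complex.conj_conj]
    · change σ.ι z⁻¹ * (w₂.1.2)⁻¹ = (σ.ι z * w₂.1.2)⁻¹
      rw [map_inv, mul_inv_rev, ← map_inv, σ.central]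

/-- The product of elements of the fibres over `g` and `h`, in the fibre over `k = g h`. -/
def fmul {g h k : G} (hk : g * h = k) (a : A.Fib g) (b : A.Fib h) : A.Fib k :=
  ⟨A.mul a.val b.val, by rw [A.p_mul, a.prop, b.prop, hk]⟩

/-- The adjoint of an element of the fibre over `g`, in the fibre over `k = g⁻¹`. -/
def fstar {g k : G} (hk : g⁻¹ = k) (a : A.Fib g) : A.Fib k :=
  ⟨A.star a.val, by rw [A.p_star, a.prop, hk]⟩

variable [IsTopologicalGroup G]

variable (A σ) in
/-- The twisted Fell bundle `A_σ = q^* A / 𝕋`. -/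
def twisted : FellBundle G where
  toBanachBundle := twistedBanach A σ
  mul := twMul
  p_mul a b := by
    obtain ⟨v, rfl⟩ := isOpenQuotientMap_tmk.surjective a
    obtain ⟨w, rfl⟩ := isOpenQuotientMap_tmk.surjective b
    exact map_mul σ.q _ _
  mul_assoc a b c := by
    obtain ⟨v, rfl⟩ := isOpenQuotientMap_tmk.surjective a
    obtain ⟨w, rfl⟩ := isOpenQuotientMap_tmk.surjective b
    obtain ⟨u, rfl⟩ := isOpenQuotientMap_tmk.surjective c
    exact congrArg tmk (Subtype.ext (Prod.ext (A.mul_assoc _ _ _) (_root_.mul_assoc _ _ _)))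
  continuous_mul := by
    refine (isOpenQuotientMap_tmk.prodMap isOpenQuotientMap_tmk).continuous_comp_iff.1 ?_
    have c1 : Continuous fun w : PullE A σ => w.1.1 := continuous_fst.comp continuous_subtype_val
    have c2 : Continuous fun w : PullE A σ => w.1.2 := continuous_snd.comp continuous_subtype_val
    exact isOpenQuotientMap_tmk.continuous.comp (Continuous.subtype_mk
      ((A.continuous_mul.comp ((c1.comp continuous_fst).prodMk (c1.comp continuous_snd))).prodMk
        ((c2.comp continuous_fst).mul (c2.comp continuous_snd))) _)
  mul_add {g h} a b b' := by
    obtain ⟨a₀, rfl⟩ := exists_tfun a _ (q_lift g)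
    obtain ⟨b₀, rfl⟩ := exists_tfun b _ (q_lift h)
    obtain ⟨b₁, rfl⟩ := exists_tfun b' _ (q_lift h)
    have hx : σ.q (lift σ g * lift σ h) = g * h := by rw [map_mul, q_lift, q_lift]
    have e := congrArg Fiber.val
      (tfun_add (lift σ g * lift σ h) hx (fmul rfl a₀ b₀) (fmul rfl a₀ b₁))
    have e' := congrArg Fiber.val (tfun_add (lift σ h) (q_lift h) b₀ b₁)
    refine Eq.trans (congrArg (twMul _) e'.symm) (Eq.trans ?_ e)
    exact congrArg tmk (Subtype.ext (Prod.ext (A.mul_add a₀ b₀ b₁) rfl))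
  add_mul {g h} a a' b := by
    obtain ⟨a₀, rfl⟩ := exists_tfun a _ (q_lift g)
    obtain ⟨a₁, rfl⟩ := exists_tfun a' _ (q_lift g)
    obtain ⟨b₀, rfl⟩ := exists_tfun b _ (q_lift h)
    have hx : σ.q (lift σ g * lift σ h) = g * h := by rw [map_mul, q_lift, q_lift]
    have e := congrArg Fiber.val
      (tfun_add (lift σ g * lift σ h) hx (fmul rfl a₀ b₀) (fmul rfl a₁ b₀))
    have e' := congrArg Fiber.val (tfun_add (lift σ g) (q_lift g) a₀ a₁)
    refine Eq.trans (congrArg (fun t => twMul t _) e'.symm) (Eq.trans ?_ e)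
    exact congrArg tmk (Subtype.ext (Prod.ext (A.add_mul a₀ a₁ b₀) rfl))
  mul_smul {g h} c a b := by
    obtain ⟨a₀, rfl⟩ := exists_tfun a _ (q_lift g)
    obtain ⟨b₀, rfl⟩ := exists_tfun b _ (q_lift h)
    have hx : σ.q (lift σ g * lift σ h) = g * h := by rw [map_mul, q_lift, q_lift]
    have e := congrArg Fiber.val (tfun_smul (lift σ g * lift σ h) hx c (fmul rfl a₀ b₀))
    have e' := congrArg Fiber.val (tfun_smul (lift σ h) (q_lift h) c b₀)
    refine Eq.trans (congrArg (twMul _) e'.symm) (Eq.trans ?_ e)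
    exact congrArg tmk (Subtype.ext (Prod.ext (A.mul_smul c a₀ b₀) rfl))
  smul_mul {g h} c a b := by
    obtain ⟨a₀, rfl⟩ := exists_tfun a _ (q_lift g)
    obtain ⟨b₀, rfl⟩ := exists_tfun b _ (q_lift h)
    have hx : σ.q (lift σ g * lift σ h) = g * h := by rw [map_mul, q_lift, q_lift]
    have e := congrArg Fiber.val (tfun_smul (lift σ g * lift σ h) hx c (fmul rfl a₀ b₀))
    have e' := congrArg Fiber.val (tfun_smul (lift σ g) (q_lift g) c a₀)
    refine Eq.trans (congrArg (fun t => twMul t _) e'.symm) (Eq.trans ?_ e)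
    exact congrArg tmk (Subtype.ext (Prod.ext (A.smul_mul c a₀ b₀) rfl))
  norm_mul_le a b := by
    obtain ⟨v, rfl⟩ := isOpenQuotientMap_tmk.surjective a
    obtain ⟨w, rfl⟩ := isOpenQuotientMap_tmk.surjective b
    have h := A.norm_mul_le v.1.1 w.1.1
    have n1 := norm_tfun v.1.2 rfl (⟨v.1.1, v.2⟩ : A.Fib (σ.q v.1.2))
    have n2 := norm_tfun w.1.2 rfl (⟨w.1.1, w.2⟩ : A.Fib (σ.q w.1.2))
    have hp : A.p (A.mul v.1.1 w.1.1) = σ.q (v.1.2 * w.1.2) := by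
      rw [A.p_mul, v.2, w.2, map_mul]
    have n3 := norm_tfun (v.1.2 * w.1.2) rfl (⟨A.mul v.1.1 w.1.1, hp⟩ : A.Fib _)
    rw [← fib_norm] at n1 n2 n3
    refine (le_of_eq n3).trans (h.trans (le_of_eq ?_))
    exact congrArg₂ (· * ·) n1.symm n2.symm
  star := twStar
  p_star a := by
    obtain ⟨v, rfl⟩ := isOpenQuotientMap_tmk.surjective a
    exact map_inv σ.q _
  star_star a := by
    obtain ⟨v, rfl⟩ := isOpenQuotientMap_tmk.surjective a
    exact congrArg tmk (Subtype.ext (Prod.ext (A.star_star _) (inv_inv _)))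
  star_mul a b := by
    obtain ⟨v, rfl⟩ := isOpenQuotientMap_tmk.surjective a
    obtain ⟨w, rfl⟩ := isOpenQuotientMap_tmk.surjective b
    exact congrArg tmk (Subtype.ext (Prod.ext (A.star_mul _ _) (mul_inv_rev _ _)))
  continuous_star := by
    refine isOpenQuotientMap_tmk.continuous_comp_iff.1 ?_
    have c1 : Continuous fun w : PullE A σ => w.1.1 := continuous_fst.comp continuous_subtype_val
    have c2 : Continuous fun w : PullE A σ => w.1.2 := continuous_snd.comp continuous_subtype_val
    exact isOpenQuotientMap_tmk.continuous.comp (Continuous.subtype_mk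
      ((A.continuous_star.comp c1).prodMk c2.inv) _)
  star_add {g} a b := by
    obtain ⟨a₀, rfl⟩ := exists_tfun a _ (q_lift g)
    obtain ⟨b₀, rfl⟩ := exists_tfun b _ (q_lift g)
    have hx : σ.q (lift σ g)⁻¹ = g⁻¹ := by rw [map_inv, q_lift]
    have e := congrArg Fiber.val (tfun_add (lift σ g)⁻¹ hx (fstar rfl a₀) (fstar rfl b₀))
    have e' := congrArg Fiber.val (tfun_add (lift σ g) (q_lift g) a₀ b₀)
    refine Eq.trans (congrArg twStar e'.symm) (Eq.trans ?_ e)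
    exact congrArg tmk (Subtype.ext (Prod.ext (A.star_add a₀ b₀) rfl))
  star_smul {g} c a := by
    obtain ⟨a₀, rfl⟩ := exists_tfun a _ (q_lift g)
    have hx : σ.q (lift σ g)⁻¹ = g⁻¹ := by rw [map_inv, q_lift]
    have e := congrArg Fiber.val (tfun_smul (lift σ g)⁻¹ hx (starRingEnd ℂ c) (fstar rfl a₀))
    have e' := congrArg Fiber.val (tfun_smul (lift σ g) (q_lift g) c a₀)
    refine Eq.trans (congrArg twStar e'.symm) (Eq.trans ?_ e)
    exact congrArg tmk (Subtype.ext (Prod.ext (A.star_smul c a₀) rfl))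
  norm_star a := by
    obtain ⟨v, rfl⟩ := isOpenQuotientMap_tmk.surjective a
    have h := A.norm_star v.1.1
    have n1 := norm_tfun v.1.2 rfl (⟨v.1.1, v.2⟩ : A.Fib (σ.q v.1.2))
    have hp : A.p (A.star v.1.1) = σ.q (v.1.2)⁻¹ := by rw [A.p_star, v.2, map_inv]
    have n3 := norm_tfun (v.1.2)⁻¹ rfl (⟨A.star v.1.1, hp⟩ : A.Fib _)
    rw [← fib_norm] at n1 n3
    exact n3.trans (h.trans n1.symm)
  norm_star_mul_self a := by
    obtain ⟨v, rfl⟩ := isOpenQuotientMap_tmk.surjective a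
    have h := A.norm_star_mul_self v.1.1
    have n1 := norm_tfun v.1.2 rfl (⟨v.1.1, v.2⟩ : A.Fib (σ.q v.1.2))
    have hp : A.p (A.mul (A.star v.1.1) v.1.1) = σ.q ((v.1.2)⁻¹ * v.1.2) := by
      rw [A.p_mul, A.p_star, v.2, map_mul, map_inv]
    have n3 := norm_tfun ((v.1.2)⁻¹ * v.1.2) rfl (⟨A.mul (A.star v.1.1) v.1.1, hp⟩ : A.Fib _)
    rw [← fib_norm] at n1 n3
    exact n3.trans (h.trans (congrArg (· ^ 2) n1.symm))
  star_mul_self_pos a := by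
    obtain ⟨v, rfl⟩ := isOpenQuotientMap_tmk.surjective a
    obtain ⟨c, hc, hcc⟩ := A.star_mul_self_pos v.1.1
    refine ⟨tmk (pmk c 1 (by rw [hc, map_one])), map_one σ.q, ?_⟩
    exact congrArg tmk (Subtype.ext (Prod.ext hcc (by
      change (v.1.2)⁻¹ * v.1.2 = 1⁻¹ * 1
      rw [inv_mul_cancel, inv_one, one_mul])))

end FellBundle

namespace BanachBundle

variable {X : Type u} [TopologicalSpace X] {B : BanachBundle X}
variable {Y : Type*} [TopologicalSpace Y] {ν : Y → X}
variable {R : Type*} [TopologicalSpace R] [T2Space R] [MeasurableSpace R] [BorelSpace R]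
variable {μ : Measure R} [IsFiniteMeasureOnCompacts μ]

theorem isContSec_slice {F : ∀ y, R → B.Fib (ν y)}
    (hF : IsContSec (ν := fun w : Y × R => ν w.1) (fun w => F w.1 w.2)) (y : Y) :
    Continuous (F y) :=
  isContSec_const (hF.comp (Continuous.prodMk_right y))

theorem integrable_slice {F : ∀ y, R → B.Fib (ν y)}
    (hF : IsContSec (ν := fun w : Y × R => ν w.1) (fun w => F w.1 w.2)) {C : Set R}
    (hC : IsCompact C) (hs : ∀ y r, r ∉ C → F y r = 0) (y : Y) : Integrable (F y) μ :=
  (isContSec_slice hF y).integrable_of_hasCompactSupport (HasCompactSupport.intro hC (hs y))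

/-- Integration of a continuous family of sections with values in a fixed fibre. -/
theorem isContSec_integral (hν : Continuous ν) {F : ∀ y, R → B.Fib (ν y)}
    (hF : IsContSec (ν := fun w : Y × R => ν w.1) (fun w => F w.1 w.2)) {C : Set R}
    (hC : IsCompact C) (hs : ∀ y r, r ∉ C → F y r = 0) :
    IsContSec (fun y => ∫ r, F y r ∂μ) := by
  refine isContSec_of_approx hν fun y₀ ε hε => ?_
  obtain ⟨δ, hδ, hδε⟩ : ∃ δ > 0, δ * μ.real C ≤ ε := by
    refine ⟨ε / (μ.real C + 1), by positivity, ?_⟩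
    rw [div_mul_eq_mul_div, div_le_iff₀ (by positivity)]
    nlinarith [measureReal_nonneg (μ := μ) (s := C)]
  have hfin : ∀ T, μ (T ∩ C) ≠ ⊤ := fun T =>
    ((measure_mono Set.inter_subset_right).trans_lt hC.measure_lt_top).ne
  -- approximation of the integral over the measurable subsets of a small set
  let P : Set R → Prop := fun S => ∃ S', S ⊆ S' ∧ MeasurableSet S' ∧ ∀ T ⊆ S', MeasurableSet T →
    ∃ g : ∀ y, B.Fib (ν y), IsContSec g ∧
      ∀ᶠ y in 𝓝 y₀, ‖∫ r in T ∩ C, F y r ∂μ - g y‖ ≤ δ * μ.real (T ∩ C)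
  have hP : P C := by
    refine hC.induction_on (p := P) ?_ ?_ ?_ ?_
    · refine ⟨∅, le_rfl, MeasurableSet.empty, fun T hT _ => ⟨_, IsContSec.zero hν, ?_⟩⟩
      rw [Set.subset_empty_iff.1 hT]
      simp
    · rintro S S₁ hSS ⟨S', h1, h2⟩
      exact ⟨S', hSS.trans h1, h2⟩
    · rintro S S₁ ⟨S', h1, h2, h3⟩ ⟨S₁', h1', h2', h3'⟩
      refine ⟨S' ∪ S₁', Set.union_subset_union h1 h1', h2.union h2', fun T hT hTm => ?_⟩
      obtain ⟨g, hg, hge⟩ := h3 (T ∩ S') Set.inter_subset_right (hTm.inter h2)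
      obtain ⟨g₁, hg₁, hge₁⟩ := h3' (T \ S')
        (fun x hx => (hT hx.1).resolve_left hx.2) (hTm.diff h2)
      refine ⟨_, hg.add hg₁, ?_⟩
      have hTu : T ∩ C = (T ∩ S' ∩ C) ∪ ((T \ S') ∩ C) := by
        rw [← Set.union_inter_distrib_right, Set.inter_union_sdiff]
      have hd : Disjoint (T ∩ S' ∩ C) ((T \ S') ∩ C) :=
        (Set.disjoint_sdiff_right.mono_left Set.inter_subset_right).mono
          Set.inter_subset_left Set.inter_subset_left
      have hm : MeasurableSet ((T \ S') ∩ C) := (hTm.diff h2).inter hC.measurableSet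
      filter_upwards [hge, hge₁] with y hy hy₁
      have hi := integrable_slice (μ := μ) hF hC hs y
      rw [hTu, setIntegral_union hd hm hi.integrableOn hi.integrableOn,
        measureReal_union hd hm (hfin _) (hfin _), mul_add]
      refine le_trans (le_of_eq ?_) ((norm_add_le _ _).trans (add_le_add hy hy₁))
      congr 1; abel
    · intro r₀ _
      have hG : IsContSec (B := B) (ν := fun w : Y × R => ν w.1) (fun w => F w.1 r₀) :=
        hF.comp (j := fun w : Y × R => (w.1, r₀)) (continuous_fst.prodMk continuous_const)
      have h0 : ∀ᶠ w in 𝓝 (y₀, r₀), ‖F w.1 w.2 - F w.1 r₀‖ < δ :=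
        (hF.sub hG).norm.continuousAt.eventually_lt continuousAt_const (by simpa using hδ)
      rw [nhds_prod_eq, eventually_prod_iff] at h0
      obtain ⟨p, hp, p', hp', hpp⟩ := h0
      obtain ⟨U, hU, hUo, hrU⟩ := mem_nhds_iff.1 hp'
      refine ⟨U, mem_nhdsWithin_of_mem_nhds (hUo.mem_nhds hrU), U, le_rfl, hUo.measurableSet,
        fun T hT hTm => ⟨fun y => ((μ.real (T ∩ C) : ℝ) : ℂ) • F y r₀, ?_, ?_⟩⟩
      · exact (hF.comp (j := fun y => (y, r₀)) (continuous_id.prodMk continuous_const)).const_smul _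
      · filter_upwards [hp] with y hy
        have hi := integrable_slice (μ := μ) hF hC hs y
        have hc : ∫ _ in T ∩ C, F y r₀ ∂μ = ((μ.real (T ∩ C) : ℝ) : ℂ) • F y r₀ := by
          rw [setIntegral_const, Complex.coe_smul]
        rw [← hc, ← integral_sub hi.integrableOn (integrableOn_const (hfin T))]
        refine norm_setIntegral_le_of_norm_le_const (hfin T).lt_top fun r hr => ?_
        exact (hpp hy (hU (hT hr.1))).le
  obtain ⟨S', hCS, -, h3⟩ := hP
  obtain ⟨g, hg, hge⟩ := h3 C hCS hC.measurableSet
  refine ⟨g, hg, ?_⟩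
  filter_upwards [hge] with y hy
  rw [Set.inter_self] at hy
  rw [setIntegral_eq_integral_of_forall_compl_eq_zero (fun r hr => hs y r hr)] at hy
  exact hy.trans hδε

end BanachBundle

namespace FellBundle

open BanachBundle

section Fib

variable {G : Type u} [Group G] [TopologicalSpace G] {A : FellBundle G} {g h k : G}

theorem fmul_add (hk : g * h = k) (a : A.Fib g) (b b' : A.Fib h) :
    fmul hk a (b + b') = fmul hk a b + fmul hk a b' := by
  subst hk; exact Fiber.ext (A.mul_add a b b')

theorem add_fmul (hk : g * h = k) (a a' : A.Fib g) (b : A.Fib h) :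
    fmul hk (a + a') b = fmul hk a b + fmul hk a' b := by
  subst hk; exact Fiber.ext (A.add_mul a a' b)

theorem fmul_smul (hk : g * h = k) (c : ℂ) (a : A.Fib g) (b : A.Fib h) :
    fmul hk a (c • b) = c • fmul hk a b := by
  subst hk; exact Fiber.ext (A.mul_smul c a b)

theorem smul_fmul (hk : g * h = k) (c : ℂ) (a : A.Fib g) (b : A.Fib h) :
    fmul hk (c • a) b = c • fmul hk a b := by
  subst hk; exact Fiber.ext (A.smul_mul c a b)

theorem norm_fmul_le (hk : g * h = k) (a : A.Fib g) (b : A.Fib h) :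
    ‖fmul hk a b‖ ≤ ‖a‖ * ‖b‖ := by
  have h := A.norm_mul_le a.val b.val
  rw [fib_norm, fib_norm] at h
  exact le_trans (le_of_eq (fib_norm (fmul hk a b)).symm) h

theorem fstar_add (hk : g⁻¹ = k) (a b : A.Fib g) : fstar hk (a + b) = fstar hk a + fstar hk b := by
  subst hk; exact Fiber.ext (A.star_add a b)

theorem fstar_smul (hk : g⁻¹ = k) (c : ℂ) (a : A.Fib g) :
    fstar hk (c • a) = starRingEnd ℂ c • fstar hk a := by
  subst hk; exact Fiber.ext (A.star_smul c a)

theorem norm_fstar (hk : g⁻¹ = k) (a : A.Fib g) : ‖fstar hk a‖ = ‖a‖ := by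
  have h := A.norm_star a.val
  rw [fib_norm] at h
  exact (fib_norm (fstar hk a)).symm.trans h

theorem fstar_fstar (hk : g⁻¹ = k) (hk' : k⁻¹ = g) (a : A.Fib g) : fstar hk' (fstar hk a) = a :=
  Fiber.ext (A.star_star _)

/-- Left multiplication by an element of a fibre, as a bounded operator. -/
def fmulL (hk : g * h = k) (a : A.Fib g) : A.Fib h →L[ℂ] A.Fib k :=
  LinearMap.mkContinuous
    { toFun := fmul hk a, map_add' := fmul_add hk a, map_smul' := fun c b => fmul_smul hk c a b }
    ‖a‖ (norm_fmul_le hk a)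

/-- Right multiplication by an element of a fibre, as a bounded operator. -/
def fmulR (hk : g * h = k) (b : A.Fib h) : A.Fib g →L[ℂ] A.Fib k :=
  LinearMap.mkContinuous
    { toFun := fun a => fmul hk a b, map_add' := fun a a' => add_fmul hk a a' b,
      map_smul' := fun c a => smul_fmul hk c a b }
    ‖b‖ fun a => (norm_fmul_le hk a b).trans_eq (mul_comm _ _)

/-- The involution of a fibre, as a bounded real-linear operator. -/
def fstarL (hk : g⁻¹ = k) : A.Fib g →L[ℝ] A.Fib k :=
  LinearMap.mkContinuous
    { toFun := fstar hk, map_add' := fstar_add hk,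
      map_smul' := fun c a => by
        change fstar hk ((c : ℂ) • a) = (c : ℂ) • fstar hk a
        rw [fstar_smul, Complex.conj_ofReal] }
    1 fun a => by rw [one_mul]; exact (norm_fstar hk a).le

theorem isContSec_fmul {Y : Type*} [TopologicalSpace Y] {ν₁ ν₂ ν : Y → G} {f : ∀ y, A.Fib (ν₁ y)}
    {f' : ∀ y, A.Fib (ν₂ y)} (hν : ∀ y, ν₁ y * ν₂ y = ν y) (hf : IsContSec f)
    (hf' : IsContSec f') : IsContSec fun y => fmul (hν y) (f y) (f' y) :=
  A.continuous_mul.comp (Continuous.prodMk hf hf')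

theorem isContSec_fstar {Y : Type*} [TopologicalSpace Y] {ν₁ ν : Y → G} {f : ∀ y, A.Fib (ν₁ y)}
    (hν : ∀ y, (ν₁ y)⁻¹ = ν y) (hf : IsContSec f) : IsContSec fun y => fstar (hν y) (f y) :=
  A.continuous_star.comp hf

end Fib

variable {G : Type u} [Group G] [TopologicalSpace G] [IsTopologicalGroup G]

theorem continuous_ν : Continuous fun x : G × G => x.1 * x.2⁻¹ :=
  continuous_fst.mul continuous_snd.inv

/-- The continuous compactly supported kernels `k(s,t) ∈ A_{st⁻¹}`. -/
def kernelSubmodule (A : FellBundle G) : Submodule ℂ (∀ s t : G, A.Fib (s * t⁻¹)) where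
  carrier := {k | IsContSec (ν := fun x : G × G => x.1 * x.2⁻¹) (fun x => k x.1 x.2) ∧
    ∃ K : Set (G × G), IsCompact K ∧ ∀ s t, (s, t) ∉ K → k s t = 0}
  add_mem' := by
    rintro k l ⟨hk, K, hK, hkK⟩ ⟨hl, L, hL, hlL⟩
    refine ⟨hk.add hl, K ∪ L, hK.union hL, fun s t h => ?_⟩
    rw [Set.mem_union, not_or] at h
    change k s t + l s t = 0
    rw [hkK _ _ h.1, hlL _ _ h.2, add_zero]
  zero_mem' := ⟨IsContSec.zero continuous_ν, ∅, isCompact_empty, fun _ _ _ => rfl⟩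
  smul_mem' := by
    rintro c k ⟨hk, K, hK, hkK⟩
    refine ⟨hk.const_smul c, K, hK, fun s t h => ?_⟩
    change c • k s t = 0
    rw [hkK _ _ h, smul_zero]

variable [MeasurableSpace G]

/-- The `*`-algebra `k_c(A)` of continuous compactly supported kernels; the Haar measure `μ` enters
the definition of the convolution. -/
def KernelC (A : FellBundle G) (_μ : Measure G) : Type u := kernelSubmodule A

namespace KernelC

variable {A : FellBundle G} {μ : Measure G}

instance : AddCommGroup (KernelC A μ) := inferInstanceAs (AddCommGroup (kernelSubmodule A))

instance : Module ℂ (KernelC A μ) := inferInstanceAs (Module ℂ (kernelSubmodule A))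

instance : CoeFun (KernelC A μ) (fun _ => ∀ s t : G, A.Fib (s * t⁻¹)) := ⟨fun k => k.1⟩

/-- The kernel given by a continuous compactly supported function. -/
def ofFun (f : ∀ s t : G, A.Fib (s * t⁻¹))
    (h : IsContSec (ν := fun x : G × G => x.1 * x.2⁻¹) (fun x => f x.1 x.2))
    (h' : ∃ K : Set (G × G), IsCompact K ∧ ∀ s t, (s, t) ∉ K → f s t = 0) : KernelC A μ :=
  ⟨f, h, h'⟩

@[ext] theorem ext {k l : KernelC A μ} (h : ∀ s t, k s t = l s t) : k = l :=
  Subtype.ext (funext fun s => funext fun t => h s t)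

@[simp] theorem add_apply (k l : KernelC A μ) (s t : G) : (k + l) s t = k s t + l s t := rfl
@[simp] theorem sub_apply (k l : KernelC A μ) (s t : G) : (k - l) s t = k s t - l s t := rfl
@[simp] theorem neg_apply (k : KernelC A μ) (s t : G) : (-k) s t = -k s t := rfl
@[simp] theorem zero_apply (s t : G) : (0 : KernelC A μ) s t = 0 := rfl
@[simp] theorem smul_apply (c : ℂ) (k : KernelC A μ) (s t : G) : (c • k) s t = c • k s t := rfl
@[simp] theorem ofFun_apply (f : ∀ s t : G, A.Fib (s * t⁻¹)) (h h') (s t : G) :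
    (ofFun f h h' : KernelC A μ) s t = f s t := rfl

theorem cont (k : KernelC A μ) :
    IsContSec (ν := fun x : G × G => x.1 * x.2⁻¹) (fun x => k x.1 x.2) := k.2.1

theorem exists_box (k : KernelC A μ) : ∃ C : Set G, IsCompact C ∧ (∀ s t, s ∉ C → k s t = 0) ∧
    ∀ s t, t ∉ C → k s t = 0 := by
  obtain ⟨K, hK, hkK⟩ := k.2.2
  refine ⟨Prod.fst '' K ∪ Prod.snd '' K, (hK.image continuous_fst).union (hK.image continuous_snd),
    fun s t h => hkK s t fun hst => h (Or.inl ⟨_, hst, rfl⟩),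
    fun s t h => hkK s t fun hst => h (Or.inr ⟨_, hst, rfl⟩)⟩

theorem mul_aux (s r t : G) : s * r⁻¹ * (r * t⁻¹) = s * t⁻¹ := by
  rw [mul_assoc, inv_mul_cancel_left]

theorem star_aux (s t : G) : (t * s⁻¹)⁻¹ = s * t⁻¹ := by rw [mul_inv_rev, inv_inv]

instance : Star (KernelC A μ) where
  star k := ofFun (fun s t => fstar (star_aux s t) (k t s))
    (isContSec_fstar (fun x : G × G => star_aux x.1 x.2)
      (k.cont.comp (j := fun x : G × G => (x.2, x.1)) (continuous_snd.prodMk continuous_fst)))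
    (by
      obtain ⟨C, hC, h1, h2⟩ := k.exists_box
      refine ⟨C ×ˢ C, hC.prod hC, fun s t h => ?_⟩
      have : k t s = 0 := by
        by_cases hs : s ∈ C
        · exact h1 _ _ fun ht => h ⟨hs, ht⟩
        · exact h2 _ _ hs
      rw [this]
      exact (fstarL (A := A) (star_aux s t)).map_zero)

/-- `k*(s,t) = k(t,s)*`. -/
theorem star_apply (k : KernelC A μ) (s t : G) : (star k) s t = fstar (star_aux s t) (k t s) := rfl

variable [T2Space G] [BorelSpace G] [IsFiniteMeasureOnCompacts μ]

theorem isContSec_integrand (k l : KernelC A μ) :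
    IsContSec (ν := fun w : (G × G) × G => w.1.1 * w.1.2⁻¹)
      (fun w => fmul (mul_aux w.1.1 w.2 w.1.2) (k w.1.1 w.2) (l w.2 w.1.2)) :=
  isContSec_fmul (fun w : (G × G) × G => mul_aux w.1.1 w.2 w.1.2)
    (k.cont.comp (j := fun w : (G × G) × G => (w.1.1, w.2)) (by fun_prop))
    (l.cont.comp (j := fun w : (G × G) × G => (w.2, w.1.2)) (by fun_prop))

theorem fmul_zero' {g h k : G} (hk : g * h = k) (a : A.Fib g) : fmul hk a (0 : A.Fib h) = 0 :=
  (fmulL hk a).map_zero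

theorem zero_fmul' {g h k : G} (hk : g * h = k) (b : A.Fib h) : fmul hk (0 : A.Fib g) b = 0 :=
  (fmulR hk b).map_zero

instance : Mul (KernelC A μ) where
  mul k l := ofFun (fun s t => ∫ r, fmul (mul_aux s r t) (k s r) (l r t) ∂μ)
    (by
      obtain ⟨C, hC, h1, h2⟩ := k.exists_box
      exact isContSec_integral continuous_ν (isContSec_integrand k l) hC fun y r hr => by
        rw [h2 _ _ hr, zero_fmul'])
    (by
      obtain ⟨C, hC, h1, h2⟩ := k.exists_box
      obtain ⟨D, hD, h1', h2'⟩ := l.exists_box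
      refine ⟨C ×ˢ D, hC.prod hD, fun s t h => ?_⟩
      refine integral_eq_zero_of_ae (Eventually.of_forall fun r => ?_)
      change fmul _ _ _ = 0
      by_cases hs : s ∈ C
      · rw [h2' _ _ fun ht => h ⟨hs, ht⟩, fmul_zero']
      · rw [h1 _ _ hs, zero_fmul'])

/-- `(k * l)(s,t) = ∫ k(s,r) l(r,t) dr`. -/
theorem mul_apply (k l : KernelC A μ) (s t : G) :
    (k * l) s t = ∫ r, fmul (mul_aux s r t) (k s r) (l r t) ∂μ := rfl

theorem integrable_integrand (k l : KernelC A μ) (s t : G) :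
    Integrable (fun r => fmul (mul_aux s r t) (k s r) (l r t)) μ := by
  obtain ⟨C, hC, h1, h2⟩ := k.exists_box
  exact integrable_slice
    (F := fun (w : G × G) r => fmul (mul_aux w.1 r w.2) (k w.1 r) (l r w.2))
    (isContSec_integrand k l) hC (fun y r hr => by rw [h2 _ _ hr, zero_fmul']) (s, t)

theorem mul_assoc' (k l m : KernelC A μ) : k * l * m = k * (l * m) := by
  refine KernelC.ext fun s t => ?_
  obtain ⟨C, hC, h1, h2⟩ := k.exists_box
  obtain ⟨D, hD, h1', h2'⟩ := l.exists_box
  let f : G → G → A.Fib (s * t⁻¹) := fun u r =>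
    fmul (mul_aux s u t) (fmul (mul_aux s r u) (k s r) (l r u)) (m u t)
  have hf : Continuous (Function.uncurry f) := by
    refine isContSec_const ?_
    refine isContSec_fmul (fun w : G × G => mul_aux s w.1 t)
      (isContSec_fmul (fun w : G × G => mul_aux s w.2 w.1)
        (k.cont.comp (j := fun w : G × G => (s, w.2)) (by fun_prop))
        (l.cont.comp (j := fun w : G × G => (w.2, w.1)) (by fun_prop)))
      (m.cont.comp (j := fun w : G × G => (w.1, t)) (by fun_prop))
  have hfs : HasCompactSupport (Function.uncurry f) := by
    refine HasCompactSupport.intro (hD.prod hC) fun w hw => ?_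
    change fmul (mul_aux s w.1 t) (fmul (mul_aux s w.2 w.1) (k s w.2) (l w.2 w.1)) (m w.1 t) = 0
    by_cases h : w.2 ∈ C
    · rw [h2' _ _ fun h' => hw ⟨h', h⟩, fmul_zero', zero_fmul']
    · rw [h2 _ _ h, zero_fmul', zero_fmul']
  have e1 : (k * l * m) s t = ∫ u, ∫ r, f u r ∂μ ∂μ := by
    rw [mul_apply]
    congr 1
    ext1 u
    exact ((fmulR (mul_aux s u t) (m u t)).integral_comp_comm (integrable_integrand k l s u)).symm
  have e2 : (k * (l * m)) s t = ∫ r, ∫ u, f u r ∂μ ∂μ := by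
    rw [mul_apply]
    congr 1
    ext1 r
    refine ((fmulL (mul_aux s r t) (k s r)).integral_comp_comm
      (integrable_integrand l m r t)).symm.trans ?_
    congr 1
    ext1 u
    exact Fiber.ext (A.mul_assoc _ _ _).symm
  rw [e1, e2]
  exact integral_integral_swap_of_hasCompactSupport hf hfs

instance : NonUnitalRing (KernelC A μ) where
  zero_mul k := by
    refine KernelC.ext fun s t => ?_
    rw [mul_apply]
    simp [zero_fmul']
  mul_zero k := by
    refine KernelC.ext fun s t => ?_
    rw [mul_apply]
    simp [fmul_zero']
  left_distrib k l m := by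
    refine KernelC.ext fun s t => ?_
    rw [add_apply, mul_apply, mul_apply, mul_apply,
      ← integral_add (integrable_integrand k l s t) (integrable_integrand k m s t)]
    simp only [add_apply, fmul_add]
  right_distrib k l m := by
    refine KernelC.ext fun s t => ?_
    rw [add_apply, mul_apply, mul_apply, mul_apply,
      ← integral_add (integrable_integrand k m s t) (integrable_integrand l m s t)]
    simp only [add_apply, add_fmul]
  mul_assoc := mul_assoc'

instance : IsScalarTower ℂ (KernelC A μ) (KernelC A μ) where
  smul_assoc c k l := by
    refine KernelC.ext fun s t => ?_
    simp only [smul_eq_mul, smul_apply, mul_apply, smul_fmul, integral_smul]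

instance : SMulCommClass ℂ (KernelC A μ) (KernelC A μ) where
  smul_comm c k l := by
    refine KernelC.ext fun s t => ?_
    simp only [smul_eq_mul, smul_apply, mul_apply, fmul_smul, integral_smul]

instance : StarRing (KernelC A μ) where
  star_involutive k := by
    refine KernelC.ext fun s t => ?_
    exact fstar_fstar (star_aux t s) (star_aux s t) _
  star_mul k l := by
    refine KernelC.ext fun s t => ?_
    rw [star_apply, mul_apply, mul_apply]
    refine ((fstarL (A := A) (star_aux s t)).integral_comp_comm
      (integrable_integrand k l t s)).symm.trans ?_
    congr 1
    ext1 r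
    exact Fiber.ext (A.star_mul _ _)
  star_add k l := by
    refine KernelC.ext fun s t => ?_
    exact fstar_add (star_aux s t) _ _

instance : StarModule ℂ (KernelC A μ) where
  star_smul c k := by
    refine KernelC.ext fun s t => ?_
    exact fstar_smul (star_aux s t) _ _

end KernelC

end FellBundle

/-! ### Completion of a non-unital `C*`-seminormed algebra -/

section CStarCompletion

open UniformSpace UniformSpace.Completion

variable {R : Type*} [NonUnitalSeminormedRing R]

/-- The multiplication of the completion. -/
@[reducible] def completionMul : Mul (Completion R) :=
  ⟨Function.curry <| (isDenseInducing_coe.prodMap isDenseInducing_coe).extend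
    ((↑) ∘ Function.uncurry (· * ·))⟩

attribute [local instance] completionMul

theorem completion_coe_mul (a b : R) : ((a * b : R) : Completion R) = a * b :=
  ((isDenseInducing_coe.prodMap isDenseInducing_coe).extend_eq
    ((continuous_coe R).comp (@continuous_mul R _ _ _)) (a, b)).symm

theorem completion_continuous_mul : ContinuousMul (Completion R) where
  continuous_mul := by
    let m := (AddMonoidHom.mul : R →+ R →+ R).compr₂ toCompl
    have : Continuous fun p : R × R => m p.1 p.2 := (continuous_coe R).comp continuous_mul
    have di : IsDenseInducing (toCompl : R → Completion R) := isDenseInducing_coe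
    exact (di.extend_Z_bilin di this :)

attribute [local instance] completion_continuous_mul

/-- The completion as a normed ring. -/
@[reducible] def completionRing : NonUnitalNormedRing (Completion R) where
  __ := (inferInstance : NormedAddCommGroup (Completion R))
  __ := (completionMul : Mul (Completion R))
  zero_mul a := Completion.induction_on a (isClosed_eq (by fun_prop) continuous_const)
    fun a => by rw [← coe_zero, ← completion_coe_mul, zero_mul]
  mul_zero a := Completion.induction_on a (isClosed_eq (by fun_prop) continuous_const)
    fun a => by rw [← coe_zero, ← completion_coe_mul, mul_zero]
  mul_assoc a b c := Completion.induction_on₃ a b c (isClosed_eq (by fun_prop) (by fun_prop))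
    fun a b c => by simp only [← completion_coe_mul, mul_assoc]
  left_distrib a b c := Completion.induction_on₃ a b c (isClosed_eq (by fun_prop) (by fun_prop))
    fun a b c => by simp only [← completion_coe_mul, ← coe_add, mul_add]
  right_distrib a b c := Completion.induction_on₃ a b c (isClosed_eq (by fun_prop) (by fun_prop))
    fun a b c => by simp only [← completion_coe_mul, ← coe_add, add_mul]
  norm_mul_le a b := by
    induction a, b using induction_on₂ with
    | hp => apply isClosed_le <;> fun_prop
    | ih a b => simpa only [← completion_coe_mul, norm_coe] using norm_mul_le a b

attribute [local instance] completionRing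

variable [StarRing R] [NormedStarGroup R]

/-- The involution of the completion. -/
@[reducible] def completionStar : Star (Completion R) := ⟨Completion.map star⟩

attribute [local instance] completionStar

theorem completion_uc_star : UniformContinuous (star : R → R) :=
  (starNormedAddGroupHom : NormedAddGroupHom R R).uniformContinuous

theorem completion_coe_star (a : R) : ((star a : R) : Completion R) = star (a : Completion R) :=
  (Completion.map_coe completion_uc_star a).symm

theorem completion_continuous_star : Continuous (star : Completion R → Completion R) :=
  Completion.continuous_map

attribute [local fun_prop] completion_continuous_star

/-- The completion as a star ring. -/
@[reducible] def completionStarRing : StarRing (Completion R) where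
  __ := (completionStar : Star (Completion R))
  star_involutive a := Completion.induction_on a
    (isClosed_eq (completion_continuous_star.comp completion_continuous_star) continuous_id)
    fun a => by rw [← completion_coe_star, ← completion_coe_star, star_star]
  star_mul a b := Completion.induction_on₂ a b
    (isClosed_eq (completion_continuous_star.comp continuous_mul)
      ((completion_continuous_star.comp continuous_snd).mul
        (completion_continuous_star.comp continuous_fst)))
    fun a b => by
      rw [← completion_coe_mul, ← completion_coe_star, ← completion_coe_star,
        ← completion_coe_star, ← completion_coe_mul, star_mul]
  star_add a b := Completion.induction_on₂ a b
    (isClosed_eq (completion_continuous_star.comp continuous_add)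
      ((completion_continuous_star.comp continuous_fst).add
        (completion_continuous_star.comp continuous_snd)))
    fun a b => by
      rw [← coe_add, ← completion_coe_star, ← completion_coe_star,
        ← completion_coe_star, ← coe_add, star_add]

attribute [local instance] completionStarRing

variable [NormedSpace ℂ R] [IsScalarTower ℂ R R] [SMulCommClass ℂ R R] [StarModule ℂ R]

/-- The (Hausdorff) completion of a `*`-algebra with respect to a `C*`-seminorm, as a
`C*`-algebra. -/
@[reducible] def completionCStar (h : ∀ a : R, ‖a‖ * ‖a‖ ≤ ‖star a * a‖) :
    NonUnitalCStarAlgebra (Completion R) where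
  norm_mul_self_le a := Completion.induction_on a
    (isClosed_le (continuous_norm.mul continuous_norm)
      (continuous_norm.comp (completion_continuous_star.mul continuous_id)))
    fun a => by
      rw [← completion_coe_star, ← completion_coe_mul, norm_coe, norm_coe]
      exact h a
  smul_assoc c a b := Completion.induction_on₂ a b
    (isClosed_eq ((continuous_fst.const_smul c).mul continuous_snd)
      ((continuous_fst.mul continuous_snd).const_smul c))
    fun a b => by
      simp only [smul_eq_mul, ← coe_smul, ← completion_coe_mul, smul_mul_assoc]
  smul_comm c a b := Completion.induction_on₂ a b
    (isClosed_eq ((continuous_fst.mul continuous_snd).const_smul c)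
      (continuous_fst.mul (continuous_snd.const_smul c)))
    fun a b => by
      simp only [smul_eq_mul, ← coe_smul, ← completion_coe_mul, mul_smul_comm]
  star_smul c a := Completion.induction_on a
    (isClosed_eq (completion_continuous_star.comp (continuous_const_smul c))
      ((continuous_const_smul (star c)).comp completion_continuous_star))
    fun a => by
      simp only [← completion_coe_star, ← coe_smul, star_smul]

end CStarCompletion

/-! ### The product of a Haar measure with itself -/

/-- The space `G × G` with its Borel `σ`-algebra (which, without countability assumptions, can be
larger than the product `σ`-algebra). -/
def Sq (G : Type u) : Type u := G × G

section SqMeasure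

open CompactlySupported

variable {G : Type u} [TopologicalSpace G]

instance : TopologicalSpace (Sq G) := inferInstanceAs (TopologicalSpace (G × G))

instance [T2Space G] : T2Space (Sq G) := inferInstanceAs (T2Space (G × G))

instance [LocallyCompactSpace G] : LocallyCompactSpace (Sq G) :=
  inferInstanceAs (LocallyCompactSpace (G × G))

instance : MeasurableSpace (Sq G) := borel (Sq G)

instance : BorelSpace (Sq G) := ⟨rfl⟩

variable [T2Space G] [MeasurableSpace G] [BorelSpace G]
variable (μ : Measure G) [IsFiniteMeasureOnCompacts μ]

theorem exists_box_cc (f : C_c(Sq G, ℝ)) : ∃ C : Set G, IsCompact C ∧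
    (∀ s t, s ∉ C → f (s, t) = 0) ∧ ∀ s t, t ∉ C → f (s, t) = 0 := by
  have hK : IsCompact (tsupport f) := f.hasCompactSupport
  refine ⟨Prod.fst '' (tsupport f : Set (G × G)) ∪ Prod.snd '' (tsupport f : Set (G × G)),
    (IsCompact.image (X := G × G) hK continuous_fst).union
      (IsCompact.image (X := G × G) hK continuous_snd), fun s t h => ?_, fun s t h => ?_⟩
  · by_contra h'
    exact h (Or.inl ⟨(s, t), subset_tsupport f h', rfl⟩)
  · by_contra h'
    exact h (Or.inr ⟨(s, t), subset_tsupport f h', rfl⟩)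

theorem continuous_cc (f : C_c(Sq G, ℝ)) : Continuous (Function.uncurry fun s t : G => f (s, t)) :=
  f.continuous

theorem integrable_inner (f : C_c(Sq G, ℝ)) (s : G) : Integrable (fun t => f (s, t)) μ := by
  obtain ⟨C, hC, -, h2⟩ := exists_box_cc f
  exact ((continuous_cc f).comp (Continuous.prodMk_right s)).integrable_of_hasCompactSupport
    (HasCompactSupport.intro hC fun t ht => h2 s t ht)

theorem integrable_outer (f : C_c(Sq G, ℝ)) : Integrable (fun s => ∫ t, f (s, t) ∂μ) μ := by
  obtain ⟨C, hC, h1, h2⟩ := exists_box_cc f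
  have hc : ContinuousOn (fun s => ∫ t, f (s, t) ∂μ) Set.univ :=
    continuousOn_integral_of_compact_support hC (continuous_cc f).continuousOn
      fun s t _ ht => h2 s t ht
  refine (continuousOn_univ.1 hc).integrable_of_hasCompactSupport
    (HasCompactSupport.intro hC fun s hs => ?_)
  simp [h1 s _ hs]

/-- The positive functional `f ↦ ∫∫ f(s,t) dt ds` on `C_c(G × G)`. -/
def sqFunctional : C_c(Sq G, ℝ) →ₚ[ℝ] ℝ :=
  PositiveLinearMap.mk₀
    { toFun := fun f => ∫ s, ∫ t, f (s, t) ∂μ ∂μ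
      map_add' := fun f g => by
        rw [← integral_add (integrable_outer μ f) (integrable_outer μ g)]
        congr 1
        ext1 s
        rw [← integral_add (integrable_inner μ f s) (integrable_inner μ g s)]
        rfl
      map_smul' := fun c f => by
        rw [RingHom.id_apply, ← integral_smul]
        congr 1
        ext1 s
        rw [← integral_smul]
        rfl }
    fun f hf => integral_nonneg fun s => integral_nonneg fun t => hf (s, t)

variable [LocallyCompactSpace G]

/-- The Radon product `μ × μ`: the Radon measure on `G × G` with
`∫ f d(μ × μ) = ∫∫ f(s,t) dt ds` for all `f ∈ C_c(G × G)`. -/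
def sqMeasure : Measure (Sq G) := RealRMK.rieszMeasure (sqFunctional μ)

theorem integral_sqMeasure (f : C_c(Sq G, ℝ)) :
    ∫ x, f x ∂sqMeasure μ = ∫ s, ∫ t, f (s, t) ∂μ ∂μ :=
  RealRMK.integral_rieszMeasure (sqFunctional μ) f

instance : (sqMeasure μ).Regular := RealRMK.regular_rieszMeasure _

end SqMeasure

namespace FellBundle

open BanachBundle

variable {G : Type u} [Group G] [TopologicalSpace G] [IsTopologicalGroup G] [T2Space G]
  [LocallyCompactSpace G] [MeasurableSpace G] [BorelSpace G]

namespace KernelC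

variable {A : FellBundle G} {μ : Measure G} [IsFiniteMeasureOnCompacts μ]

/-- The norm `‖k‖₂ = (∫ ‖k(s,t)‖² d(s,t))^{1/2}`. -/
def l2norm (k : KernelC A μ) : ℝ := √(∫ x : Sq G, ‖k x.1 x.2‖ ^ 2 ∂sqMeasure μ)

end KernelC

/-- The continuous `*`-representations of `k_c(A)`: the `*`-homomorphisms `π` into a `C*`-algebra
with `‖π(k)‖ ≤ ‖k‖₂`. (Replacing the target by the closure of the image, one sees that the
restriction to one universe is harmless.) -/
structure KernelRep (A : FellBundle G) (μ : Measure G) [IsFiniteMeasureOnCompacts μ] where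
  D : Type u
  [cstar : NonUnitalCStarAlgebra D]
  π : KernelC A μ →⋆ₙₐ[ℂ] D
  bound : ∀ k, ‖π k‖ ≤ k.l2norm

attribute [instance] KernelRep.cstar

namespace KernelC

variable {A : FellBundle G} {μ : Measure G} [IsFiniteMeasureOnCompacts μ]

/-- The universal norm `‖k‖_u = sup_π ‖π(k)‖`. -/
def unorm (k : KernelC A μ) : ℝ := ⨆ ρ : KernelRep A μ, ‖ρ.π k‖

theorem le_unorm (k : KernelC A μ) (ρ : KernelRep A μ) : ‖ρ.π k‖ ≤ unorm k :=
  le_ciSup (f := fun ρ : KernelRep A μ => ‖ρ.π k‖)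
    ⟨k.l2norm, by rintro _ ⟨ρ, rfl⟩; exact ρ.bound k⟩ ρ

theorem unorm_nonneg (k : KernelC A μ) : 0 ≤ unorm k := Real.iSup_nonneg fun _ => norm_nonneg _

theorem unorm_le {k : KernelC A μ} {c : ℝ} (hc : 0 ≤ c) (h : ∀ ρ : KernelRep A μ, ‖ρ.π k‖ ≤ c) :
    unorm k ≤ c := Real.iSup_le h hc

theorem unorm_le_l2norm (k : KernelC A μ) : unorm k ≤ k.l2norm :=
  unorm_le (Real.sqrt_nonneg _) fun ρ => ρ.bound k

instance : SeminormedAddCommGroup (KernelC A μ) :=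
  AddGroupSeminorm.toSeminormedAddCommGroup
    { toFun := unorm
      map_zero' := le_antisymm (unorm_le le_rfl fun ρ => by simp) (unorm_nonneg _)
      add_le' := fun k l => unorm_le (add_nonneg (unorm_nonneg _) (unorm_nonneg _)) fun ρ => by
        rw [map_add]
        exact (norm_add_le _ _).trans (add_le_add (le_unorm k ρ) (le_unorm l ρ))
      neg' := fun k => by simp only [unorm, map_neg, norm_neg] }

theorem norm_def (k : KernelC A μ) : ‖k‖ = unorm k := rfl

instance : NonUnitalSeminormedRing (KernelC A μ) where
  __ := (inferInstance : SeminormedAddCommGroup (KernelC A μ))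
  __ := (inferInstance : NonUnitalRing (KernelC A μ))
  norm_mul_le k l := unorm_le (mul_nonneg (unorm_nonneg _) (unorm_nonneg _)) fun ρ => by
    rw [map_mul]
    exact (norm_mul_le _ _).trans
      (mul_le_mul (le_unorm k ρ) (le_unorm l ρ) (norm_nonneg _) (unorm_nonneg _))

instance : NormedStarGroup (KernelC A μ) where
  norm_star_le k := unorm_le (unorm_nonneg _) fun ρ => by
    rw [map_star, _root_.norm_star]; exact le_unorm k ρ

instance : NormedSpace ℂ (KernelC A μ) where
  norm_smul_le c k := unorm_le (mul_nonneg (norm_nonneg _) (unorm_nonneg _)) fun ρ => by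
    rw [map_smul, norm_smul]
    exact mul_le_mul_of_nonneg_left (le_unorm k ρ) (norm_nonneg _)

theorem norm_mul_self_le (k : KernelC A μ) : ‖k‖ * ‖k‖ ≤ ‖star k * k‖ := by
  have h : unorm k ≤ √(unorm (star k * k)) := unorm_le (Real.sqrt_nonneg _) fun ρ => by
    refine Real.le_sqrt_of_sq_le ?_
    rw [sq, ← CStarRing.norm_star_mul_self, ← map_star, ← map_mul]
    exact le_unorm _ ρ
  calc unorm k * unorm k ≤ √(unorm (star k * k)) * √(unorm (star k * k)) :=
        mul_self_le_mul_self (unorm_nonneg _) h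
    _ = unorm (star k * k) := Real.mul_self_sqrt (unorm_nonneg _)

end KernelC

/-- The kernel `C*`-algebra `𝕂(A)`: the completion of `k_c(A)` with respect to `‖·‖_u`. -/
def KernelAlg (A : FellBundle G) (μ : Measure G) [IsFiniteMeasureOnCompacts μ] : Type u :=
  UniformSpace.Completion (KernelC A μ)

variable {A : FellBundle G} {μ : Measure G} [IsFiniteMeasureOnCompacts μ]

instance : NonUnitalCStarAlgebra (KernelAlg A μ) := completionCStar KernelC.norm_mul_self_le

/-- The canonical map `k_c(A) → 𝕂(A)`. -/
def KernelC.toAlg : KernelC A μ →⋆ₙₐ[ℂ] KernelAlg A μ where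
  toFun k := (k : UniformSpace.Completion (KernelC A μ))
  map_smul' c k := UniformSpace.Completion.coe_smul c k
  map_zero' := UniformSpace.Completion.coe_zero
  map_add' k l := UniformSpace.Completion.coe_add k l
  map_mul' k l := completion_coe_mul k l
  map_star' k := completion_coe_star k

theorem KernelC.norm_toAlg (k : KernelC A μ) : ‖k.toAlg‖ = k.unorm :=
  UniformSpace.Completion.norm_coe k

theorem KernelC.denseRange_toAlg : DenseRange (KernelC.toAlg : KernelC A μ → KernelAlg A μ) :=
  UniformSpace.Completion.denseRange_coe

theorem KernelC.continuous_toAlg : Continuous (KernelC.toAlg : KernelC A μ → KernelAlg A μ) :=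
  UniformSpace.Completion.continuous_coe _

theorem KernelC.norm_toAlg' (k : KernelC A μ) : ‖k.toAlg‖ = ‖k‖ := KernelC.norm_toAlg k

/-! ### Extension of maps from `k_c(A)` to `𝕂(A)` -/

/-- The extension of a bounded linear operator from `k_c(A)` to `𝕂(A)`. -/
def KernelAlg.ext (T : KernelC A μ →ₗ[ℂ] KernelC A μ) : KernelAlg A μ →L[ℂ] KernelAlg A μ :=
  ((KernelC.toAlg : KernelC A μ →⋆ₙₐ[ℂ] KernelAlg A μ) : KernelC A μ →ₗ[ℂ] KernelAlg A μ).comp T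
    |>.extendOfNorm
      ((KernelC.toAlg : KernelC A μ →⋆ₙₐ[ℂ] KernelAlg A μ) : KernelC A μ →ₗ[ℂ] KernelAlg A μ)

theorem KernelAlg.ext_toAlg {T : KernelC A μ →ₗ[ℂ] KernelC A μ} {C : ℝ}
    (hT : ∀ k, ‖T k‖ ≤ C * ‖k‖) (k : KernelC A μ) : KernelAlg.ext T k.toAlg = (T k).toAlg :=
  LinearMap.extendOfNorm_eq
    (f := ((KernelC.toAlg : KernelC A μ →⋆ₙₐ[ℂ] KernelAlg A μ) :
      KernelC A μ →ₗ[ℂ] KernelAlg A μ).comp T)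
    (e := ((KernelC.toAlg : KernelC A μ →⋆ₙₐ[ℂ] KernelAlg A μ) :
      KernelC A μ →ₗ[ℂ] KernelAlg A μ)) KernelC.denseRange_toAlg
    ⟨C, fun x => by
      have h := hT x
      rw [← KernelC.norm_toAlg', ← KernelC.norm_toAlg'] at h
      exact h⟩ k

theorem KernelAlg.induction {P : KernelAlg A μ → Prop} (hP : IsClosed {x | P x})
    (h : ∀ k : KernelC A μ, P k.toAlg) (x : KernelAlg A μ) : P x :=
  KernelC.denseRange_toAlg.induction_on x hP h

theorem KernelAlg.induction₂ {P : KernelAlg A μ → KernelAlg A μ → Prop}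
    (hP : IsClosed {x : KernelAlg A μ × KernelAlg A μ | P x.1 x.2})
    (h : ∀ k l : KernelC A μ, P k.toAlg l.toAlg) (x y : KernelAlg A μ) : P x y :=
  KernelC.denseRange_toAlg.induction_on₂ hP h x y

/-! ### The structure map from `C₀(G)` -/

namespace KernelC

/-- `(f k)(s,t) = f(s) k(s,t)`. -/
def leftMul (f : C(G, ℂ)) : KernelC A μ →ₗ[ℂ] KernelC A μ where
  toFun k := ofFun (fun s t => f s • k s t)
    (k.cont.smul (φ := fun x : G × G => f x.1) (by fun_prop))
    (by
      obtain ⟨K, hK, h⟩ := k.2.2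
      exact ⟨K, hK, fun s t hst => by rw [h s t hst, smul_zero]⟩)
  map_add' k l := KernelC.ext fun s t => smul_add _ _ _
  map_smul' c k := KernelC.ext fun s t => smul_comm _ _ _

/-- `(k f)(s,t) = k(s,t) f(t)`. -/
def rightMul (f : C(G, ℂ)) : KernelC A μ →ₗ[ℂ] KernelC A μ where
  toFun k := ofFun (fun s t => f t • k s t)
    (k.cont.smul (φ := fun x : G × G => f x.2) (by fun_prop))
    (by
      obtain ⟨K, hK, h⟩ := k.2.2
      exact ⟨K, hK, fun s t hst => by rw [h s t hst, smul_zero]⟩)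
  map_add' k l := KernelC.ext fun s t => smul_add _ _ _
  map_smul' c k := KernelC.ext fun s t => smul_comm _ _ _

theorem leftMul_apply (f : C(G, ℂ)) (k : KernelC A μ) (s t : G) :
    leftMul f k s t = f s • k s t := rfl

theorem rightMul_apply (f : C(G, ℂ)) (k : KernelC A μ) (s t : G) :
    rightMul f k s t = f t • k s t := rfl

theorem rightMul_eq (f : C(G, ℂ)) (k : KernelC A μ) :
    rightMul f k = star (leftMul (star f) (star k)) := by
  refine KernelC.ext fun s t => ?_
  rw [rightMul_apply, star_apply, leftMul_apply, fstar_smul, star_apply, fstar_fstar,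
    ContinuousMap.star_apply, starRingEnd_apply, star_star]

theorem rightMul_mul (f : C(G, ℂ)) (k l : KernelC A μ) : rightMul f k * l = k * leftMul f l := by
  refine KernelC.ext fun s t => ?_
  rw [mul_apply, mul_apply]
  congr 1
  ext1 r
  rw [rightMul_apply, leftMul_apply, smul_fmul, fmul_smul]

theorem star_leftMul_mul (f : C(G, ℂ)) (k : KernelC A μ) :
    star (leftMul f k) * leftMul f k = star k * leftMul (star f * f) k := by
  have h : star (leftMul f k) = rightMul (star f) (star k) := by
    rw [rightMul_eq, star_star, star_star]
  rw [h, rightMul_mul]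
  congr 1
  refine KernelC.ext fun s t => ?_
  simp only [leftMul_apply, smul_smul]
  rfl

theorem norm_leftMul_le {f : C(G, ℂ)} {C : ℝ} (hC : 0 ≤ C) (hf : ∀ s, ‖f s‖ ≤ C)
    (k : KernelC A μ) : ‖leftMul f k‖ ≤ C * ‖k‖ := by
  let g : C(G, ℂ) := ⟨fun s => ((√(C ^ 2 - ‖f s‖ ^ 2) : ℝ) : ℂ), by fun_prop⟩
  have hg : ∀ s, (starRingEnd ℂ (f s) * f s) + (starRingEnd ℂ (g s) * g s) = ((C ^ 2 : ℝ) : ℂ) := by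
    intro s
    have h0 : 0 ≤ C ^ 2 - ‖f s‖ ^ 2 := sub_nonneg.2 (pow_le_pow_left₀ (norm_nonneg _) (hf s) 2)
    rw [← Complex.normSq_eq_conj_mul_self, ← Complex.normSq_eq_conj_mul_self]
    change _ + ((Complex.normSq ((√(C ^ 2 - ‖f s‖ ^ 2) : ℝ) : ℂ) : ℝ) : ℂ) = _
    rw [Complex.normSq_ofReal, Real.mul_self_sqrt h0, Complex.normSq_eq_norm_sq]
    push_cast; ring
  have e : star (leftMul f k) * leftMul f k + star (leftMul g k) * leftMul g k =
      ((C ^ 2 : ℝ) : ℂ) • (star k * k) := by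
    rw [star_leftMul_mul, star_leftMul_mul, ← mul_add, ← mul_smul_comm]
    congr 1
    refine KernelC.ext fun s t => ?_
    rw [add_apply, smul_apply, leftMul_apply, leftMul_apply, ← add_smul, ← hg s]
    rfl
  refine unorm_le (mul_nonneg hC (unorm_nonneg _)) fun ρ => ?_
  let _ : PartialOrder ρ.D := CStarAlgebra.spectralOrder _
  have : StarOrderedRing ρ.D := CStarAlgebra.spectralOrderedRing _
  refine le_of_sq_le_sq ?_ (mul_nonneg hC (unorm_nonneg _))
  have e' := congrArg ρ.π e
  simp only [map_add, map_mul, map_star, map_smul] at e'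
  calc ‖ρ.π (leftMul f k)‖ ^ 2
      = ‖star (ρ.π (leftMul f k)) * ρ.π (leftMul f k)‖ := by
        rw [CStarRing.norm_star_mul_self, sq]
    _ ≤ ‖((C ^ 2 : ℝ) : ℂ) • (star (ρ.π k) * ρ.π k)‖ := by
        rw [← e']
        exact CStarAlgebra.norm_le_norm_of_nonneg_of_le (star_mul_self_nonneg _)
          (le_add_of_nonneg_right (star_mul_self_nonneg _))
    _ = (C * ‖ρ.π k‖) ^ 2 := by
        rw [norm_smul, CStarRing.norm_star_mul_self, Complex.norm_real, Real.norm_eq_abs,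
          abs_of_nonneg (sq_nonneg C)]
        ring
    _ ≤ (C * ‖k‖) ^ 2 := pow_le_pow_left₀ (mul_nonneg hC (norm_nonneg _))
        (mul_le_mul_of_nonneg_left (le_unorm k ρ) hC) 2

theorem norm_rightMul_le {f : C(G, ℂ)} {C : ℝ} (hC : 0 ≤ C) (hf : ∀ s, ‖f s‖ ≤ C)
    (k : KernelC A μ) : ‖rightMul f k‖ ≤ C * ‖k‖ := by
  rw [rightMul_eq, _root_.norm_star]
  refine (norm_leftMul_le hC (fun s => ?_) _).trans_eq (by rw [_root_.norm_star])
  rw [ContinuousMap.star_apply, _root_.norm_star]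
  exact hf s

end KernelC

open ZeroAtInfty MultiplierAlgebra

theorem norm_c0_le (f : C₀(G, ℂ)) (s : G) : ‖f s‖ ≤ ‖f.toBCF‖ := f.toBCF.norm_coe_le_norm s

theorem ext_leftMul_toAlg (f : C₀(G, ℂ)) (k : KernelC A μ) :
    KernelAlg.ext (KernelC.leftMul f.toContinuousMap) k.toAlg =
      (KernelC.leftMul f.toContinuousMap k).toAlg :=
  KernelAlg.ext_toAlg (fun k => KernelC.norm_leftMul_le (norm_nonneg _) (norm_c0_le f) k) k

theorem ext_rightMul_toAlg (f : C₀(G, ℂ)) (k : KernelC A μ) :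
    KernelAlg.ext (KernelC.rightMul f.toContinuousMap) k.toAlg =
      (KernelC.rightMul f.toContinuousMap k).toAlg :=
  KernelAlg.ext_toAlg (fun k => KernelC.norm_rightMul_le (norm_nonneg _) (norm_c0_le f) k) k

/-- The multiplier `j(f)` of `𝕂(A)`. -/
def jMul (f : C₀(G, ℂ)) : 𝓜(ℂ, KernelAlg A μ) where
  fst := KernelAlg.ext (KernelC.leftMul f.toContinuousMap)
  snd := KernelAlg.ext (KernelC.rightMul f.toContinuousMap)
  central x y := by
    refine KernelAlg.induction₂ (P := fun x y => KernelAlg.ext (KernelC.rightMul f.toContinuousMap) x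
      * y = x * KernelAlg.ext (KernelC.leftMul f.toContinuousMap) y)
      (isClosed_eq (by fun_prop) (by fun_prop)) (fun k l => ?_) x y
    rw [ext_leftMul_toAlg, ext_rightMul_toAlg, ← map_mul, ← map_mul, KernelC.rightMul_mul]

theorem jMul_fst (f : C₀(G, ℂ)) (k : KernelC A μ) :
    (jMul f).fst k.toAlg = (KernelC.leftMul f.toContinuousMap k).toAlg := ext_leftMul_toAlg f k

theorem jMul_snd (f : C₀(G, ℂ)) (k : KernelC A μ) :
    (jMul f).snd k.toAlg = (KernelC.rightMul f.toContinuousMap k).toAlg := ext_rightMul_toAlg f k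

theorem multiplier_ext {m n : 𝓜(ℂ, KernelAlg A μ)}
    (h1 : ∀ k : KernelC A μ, m.fst k.toAlg = n.fst k.toAlg)
    (h2 : ∀ k : KernelC A μ, m.snd k.toAlg = n.snd k.toAlg) : m = n := by
  refine DoubleCentralizer.ext _ _ _ _ (Prod.ext ?_ ?_)
  · refine ContinuousLinearMap.ext fun x => ?_
    exact KernelAlg.induction (isClosed_eq m.fst.continuous n.fst.continuous) h1 x
  · refine ContinuousLinearMap.ext fun x => ?_
    exact KernelAlg.induction (isClosed_eq m.snd.continuous n.snd.continuous) h2 x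

variable (A μ) in
/-- The structure map `j : C₀(G) → M(𝕂(A))`, determined by `(j(f) k)(s,t) = f(s) k(s,t)` and
`(k j(f))(s,t) = k(s,t) f(t)` for `k ∈ k_c(A)`. -/
def jC0 : C₀(G, ℂ) →⋆ₙₐ[ℂ] 𝓜(ℂ, KernelAlg A μ) where
  toFun := jMul
  map_smul' c f := multiplier_ext
    (fun k => by
      rw [DoubleCentralizer.smul_fst, _root_.smul_apply, jMul_fst, jMul_fst, ← map_smul]
      exact congrArg _ (KernelC.ext fun s t => smul_assoc c (f s) (k s t)))
    (fun k => by
      rw [DoubleCentralizer.smul_snd, _root_.smul_apply, jMul_snd, jMul_snd, ← map_smul]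
      exact congrArg _ (KernelC.ext fun s t => smul_assoc c (f t) (k s t)))
  map_zero' := multiplier_ext
    (fun k => by
      rw [jMul_fst, DoubleCentralizer.zero_fst, _root_.zero_apply, ← map_zero KernelC.toAlg]
      exact congrArg _ (KernelC.ext fun s t => zero_smul _ _))
    (fun k => by
      rw [jMul_snd, DoubleCentralizer.zero_snd, _root_.zero_apply, ← map_zero KernelC.toAlg]
      exact congrArg _ (KernelC.ext fun s t => zero_smul _ _))
  map_add' f g := multiplier_ext
    (fun k => by
      rw [DoubleCentralizer.add_fst, _root_.add_apply, jMul_fst, jMul_fst, jMul_fst,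
        ← map_add]
      exact congrArg _ (KernelC.ext fun s t => add_smul _ _ _))
    (fun k => by
      rw [DoubleCentralizer.add_snd, _root_.add_apply, jMul_snd, jMul_snd, jMul_snd,
        ← map_add]
      exact congrArg _ (KernelC.ext fun s t => add_smul _ _ _))
  map_mul' f g := multiplier_ext
    (fun k => by
      rw [DoubleCentralizer.mul_fst]
      change _ = (jMul f).fst ((jMul g).fst _)
      rw [jMul_fst, jMul_fst, jMul_fst]
      exact congrArg _ (KernelC.ext fun s t => mul_smul _ _ _))
    (fun k => by
      rw [DoubleCentralizer.mul_snd]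
      change _ = (jMul g).snd ((jMul f).snd _)
      rw [jMul_snd, jMul_snd, jMul_snd]
      refine congrArg _ (KernelC.ext fun s t => ?_)
      change (f t * g t) • k s t = g t • f t • k s t
      rw [smul_smul, mul_comm])
  map_star' f := multiplier_ext
    (fun k => by
      rw [DoubleCentralizer.star_fst, ← map_star KernelC.toAlg, jMul_fst, jMul_snd,
        ← map_star KernelC.toAlg]
      refine congrArg _ ?_
      rw [KernelC.rightMul_eq, star_star, star_star]
      rfl)
    (fun k => by
      rw [DoubleCentralizer.star_snd, ← map_star KernelC.toAlg, jMul_snd, jMul_fst,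
        ← map_star KernelC.toAlg]
      have h : star (star f).toContinuousMap = f.toContinuousMap := by
        ext s; exact star_star (f s)
      rw [KernelC.rightMul_eq, h])

/-! ### The dual action -/


open Measure in
/-- The modular function of `G`, in the convention `μ(E t) = Δ(t) μ(E)`; equivalently
`∫ f(s t) ds = Δ(t)⁻¹ ∫ f(s) ds`. (Mathlib's `modularCharacterFun` is `Δ⁻¹`.) -/
def Δ (t : G) : ℝ := ((modularCharacterFun t)⁻¹ : NNReal)

theorem Δ_pos (t : G) : 0 < Δ t := NNReal.coe_pos.2 (inv_pos.2 (Measure.modularCharacterFun_pos t))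

theorem Δ_one : Δ (1 : G) = 1 := by
  rw [Δ, Measure.modularCharacterFun_map_one, inv_one, NNReal.coe_one]

theorem Δ_mul (s t : G) : Δ (s * t) = Δ s * Δ t := by
  rw [Δ, Δ, Δ, Measure.modularCharacterFun_map_mul, mul_inv, NNReal.coe_mul]

theorem integral_mul_right {F : Type*} [NormedAddCommGroup F] [NormedSpace ℝ F]
    (μ : Measure G) [μ.IsHaarMeasure] [μ.Regular] (f : G → F) (t : G) :
    ∫ s, f (s * t) ∂μ = (Δ t)⁻¹ • ∫ s, f s ∂μ := by
  have hm : Measure.map (· * t) μ = Measure.modularCharacterFun t • μ := by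
    have : (Measure.map (· * t) μ).Regular := Measure.Regular.map (Homeomorph.mulRight t)
    rw [Measure.modularCharacterFun_eq_haarScalarFactor μ _]
    exact Measure.isMulLeftInvariant_eq_smul_of_regular _ μ
  have h := (Homeomorph.mulRight t).measurableEmbedding.integral_map (μ := μ) f
  change ∫ y, f y ∂(Measure.map (· * t) μ) = ∫ s, f (s * t) ∂μ at h
  rw [← h, hm, integral_smul_nnreal_measure, Δ, NNReal.coe_inv, inv_inv]
  rfl

theorem shift_aux (s t r : G) : s * r * (t * r)⁻¹ = s * t⁻¹ := by
  rw [mul_inv_rev, mul_assoc, mul_inv_cancel_left]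

/-- Transport along an equality of fibres. -/
def fcast {g h : G} (e : g = h) (a : A.Fib g) : A.Fib h := ⟨a.val, a.prop.trans e⟩

theorem fcast_add {g h : G} (e : g = h) (a b : A.Fib g) :
    fcast e (a + b) = fcast e a + fcast e b := by subst e; rfl

theorem fcast_smul {g h : G} (e : g = h) (c : ℂ) (a : A.Fib g) :
    fcast e (c • a) = c • fcast e a := by subst e; rfl

theorem fcast_zero {g h : G} (e : g = h) : fcast e (0 : A.Fib g) = 0 := by subst e; rfl

theorem norm_fcast {g h : G} (e : g = h) (a : A.Fib g) : ‖fcast e a‖ = ‖a‖ := by subst e; rfl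

theorem fcast_integral {X : Type*} [MeasurableSpace X] {ν : Measure X} {g h : G} (e : g = h)
    (f : X → A.Fib g) : fcast e (∫ x, f x ∂ν) = ∫ x, fcast e (f x) ∂ν := by subst e; rfl

theorem Δ_coe_mul (s t : G) : ((Δ (s * t) : ℝ) : ℂ) = (Δ s : ℂ) * (Δ t : ℂ) := by
  rw [Δ_mul, Complex.ofReal_mul]

namespace KernelC

theorem val_congr (k : KernelC A μ) {s s' t t' : G} (hs : s = s') (ht : t = t') :
    (k s t).val = (k s' t').val := by subst hs ht; rfl

/-- `‖k(s,t)‖²` as an element of `C_c(G × G)`. -/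
def normSq (k : KernelC A μ) : CompactlySupportedContinuousMap (Sq G) ℝ where
  toFun x := ‖k x.1 x.2‖ ^ 2
  continuous_toFun := by
    have h : Continuous fun x : G × G => ‖k x.1 x.2‖ := k.cont.norm
    exact h.pow 2
  hasCompactSupport' := by
    obtain ⟨K, hK, h⟩ := k.2.2
    exact HasCompactSupport.intro (K := (K : Set (Sq G))) hK fun x hx => by
      rw [h x.1 x.2 hx, norm_zero, zero_pow two_ne_zero]

theorem l2norm_eq (k : KernelC A μ) : k.l2norm = √(∫ s, ∫ t, ‖k s t‖ ^ 2 ∂μ ∂μ) :=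
  congrArg Real.sqrt (integral_sqMeasure μ k.normSq)

variable {μ : Measure G} [μ.IsHaarMeasure] [μ.Regular]

/-- `(δ_t k)(s,r) = Δ(t) k(st, rt)`, on `k_c(A)`. -/
def dual (t : G) : KernelC A μ →⋆ₙₐ[ℂ] KernelC A μ where
  toFun k := ofFun (fun s r => (Δ t : ℂ) • fcast (shift_aux s r t) (k (s * t) (r * t)))
    (by
      have h : IsContSec (B := A.toBanachBundle) (ν := fun x : G × G => x.1 * x.2⁻¹)
          (fun x => fcast (shift_aux x.1 x.2 t) (k (x.1 * t) (x.2 * t))) :=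
        Continuous.comp (g := fun x : G × G => (k x.1 x.2).val)
          (f := fun x : G × G => (x.1 * t, x.2 * t)) k.cont (by fun_prop)
      exact h.const_smul _)
    (by
      obtain ⟨K, hK, h⟩ := k.2.2
      let e : G × G ≃ₜ G × G := (Homeomorph.mulRight t).prodCongr (Homeomorph.mulRight t)
      refine ⟨e ⁻¹' K, e.isCompact_preimage.2 hK, fun s r hsr => ?_⟩
      rw [h (s * t) (r * t) hsr, fcast_zero, smul_zero])
  map_smul' c k := KernelC.ext fun s r => by
    change (Δ t : ℂ) • fcast _ (c • k _ _) = c • (Δ t : ℂ) • fcast _ (k _ _)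
    rw [fcast_smul, smul_comm]
  map_zero' := KernelC.ext fun s r => by
    change (Δ t : ℂ) • fcast _ (0 : A.Fib _) = 0
    rw [fcast_zero, smul_zero]
  map_add' k l := KernelC.ext fun s r => by
    change (Δ t : ℂ) • fcast _ (k _ _ + l _ _) = _
    rw [fcast_add, smul_add]; rfl
  map_mul' k l := KernelC.ext fun s r => by
    change (Δ t : ℂ) • fcast _ ((k * l) (s * t) (r * t)) = _
    rw [mul_apply, mul_apply, fcast_integral]
    have h := integral_mul_right μ (fun u => fcast (shift_aux s r t)
      (fmul (mul_aux (s * t) u (r * t)) (k (s * t) u) (l u (r * t)))) t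
    rw [eq_inv_smul_iff₀ (Δ_pos t).ne'] at h
    rw [← h, ← Complex.coe_smul, smul_smul, ← integral_smul]
    congr 1
    ext1 u
    rw [ofFun_apply, ofFun_apply, smul_fmul, fmul_smul, smul_smul]
    rfl
  map_star' k := KernelC.ext fun s r => by
    rw [star_apply, ofFun_apply, ofFun_apply, fstar_smul, Complex.conj_ofReal]
    rfl

theorem dual_apply (t : G) (k : KernelC A μ) (s r : G) :
    dual t k s r = (Δ t : ℂ) • fcast (shift_aux s r t) (k (s * t) (r * t)) := rfl

theorem l2norm_dual (t : G) (k : KernelC A μ) : (dual t k).l2norm = k.l2norm := by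
  rw [l2norm_eq, l2norm_eq]
  congr 1
  simp only [dual_apply, norm_smul, norm_fcast, mul_pow, integral_const_mul]
  have h1 : ∀ s, ∫ r, ‖k (s * t) (r * t)‖ ^ 2 ∂μ = (Δ t)⁻¹ • ∫ r, ‖k (s * t) r‖ ^ 2 ∂μ :=
    fun s => integral_mul_right μ (fun r => ‖k (s * t) r‖ ^ 2) t
  have h2 := integral_mul_right μ (fun s => ∫ r, ‖k s r‖ ^ 2 ∂μ) t
  simp only [h1, smul_eq_mul, integral_const_mul] at h2 ⊢
  rw [h2, Complex.norm_real, Real.norm_of_nonneg (Δ_pos t).le]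
  have := (Δ_pos t).ne'
  field_simp

theorem norm_dual_le (t : G) (k : KernelC A μ) : ‖dual t k‖ ≤ ‖k‖ :=
  unorm_le (unorm_nonneg _) fun ρ =>
    le_unorm k { D := ρ.D, π := ρ.π.comp (dual t), bound := fun l =>
      (ρ.bound (dual t l)).trans_eq (l2norm_dual t l) }

theorem dual_one (k : KernelC A μ) : dual 1 k = k := by
  refine KernelC.ext fun s r => Fiber.ext ?_
  rw [dual_apply, Δ_one, Complex.ofReal_one, one_smul]
  exact val_congr k (mul_one s) (mul_one r)

theorem dual_mul (t u : G) (k : KernelC A μ) : dual (t * u) k = dual t (dual u k) := by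
  refine KernelC.ext fun s r => ?_
  rw [dual_apply, dual_apply, dual_apply, fcast_smul, smul_smul, ← Δ_coe_mul]
  congr 1
  exact Fiber.ext (val_congr k (mul_assoc _ _ _).symm (mul_assoc _ _ _).symm)

end KernelC

variable {μ : Measure G} [μ.IsHaarMeasure] [μ.Regular]

/-- The operator `δ_t` on `𝕂(A)`. -/
def dualHom (t : G) : KernelAlg A μ →⋆ₙₐ[ℂ] KernelAlg A μ :=
  let T : KernelC A μ →ₗ[ℂ] KernelC A μ := (KernelC.dual t : KernelC A μ →⋆ₙₐ[ℂ] KernelC A μ)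
  have hT : ∀ k : KernelC A μ, KernelAlg.ext T k.toAlg = (KernelC.dual t k).toAlg :=
    KernelAlg.ext_toAlg (C := 1) fun k => (KernelC.norm_dual_le t k).trans_eq (one_mul _).symm
  { toFun := KernelAlg.ext T
    map_smul' := fun c x => map_smul _ c x
    map_zero' := map_zero _
    map_add' := map_add _
    map_mul' := fun x y => by
      refine KernelAlg.induction₂ (P := fun x y => KernelAlg.ext T (x * y) =
        KernelAlg.ext T x * KernelAlg.ext T y)
        (isClosed_eq (by fun_prop) (by fun_prop)) (fun k l => ?_) x y
      rw [← map_mul, hT, hT, hT, map_mul, map_mul]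
    map_star' := fun x => by
      refine KernelAlg.induction (P := fun x => KernelAlg.ext T (star x) =
        star (KernelAlg.ext T x))
        (isClosed_eq (by fun_prop) (by fun_prop)) (fun k => ?_) x
      rw [← map_star, hT, hT, map_star, map_star] }

theorem dualHom_toAlg (t : G) (k : KernelC A μ) : dualHom t k.toAlg = (KernelC.dual t k).toAlg :=
  KernelAlg.ext_toAlg (C := 1)
    (fun k => (KernelC.norm_dual_le t k).trans_eq (one_mul _).symm) k

theorem continuous_dualHom (t : G) :
    Continuous (dualHom t : KernelAlg A μ → KernelAlg A μ) :=
  ContinuousLinearMap.continuous _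

variable (A μ) in
/-- The dual action of `G` on `𝕂(A)`, determined by `(δ_t k)(s,r) = Δ(t) k(st, rt)` for
`k ∈ k_c(A)`. -/
def dualAction : G →* (KernelAlg A μ →⋆ₙₐ[ℂ] KernelAlg A μ) where
  toFun := dualHom
  map_one' := NonUnitalStarAlgHom.ext fun x =>
    KernelAlg.induction (isClosed_eq (continuous_dualHom 1) continuous_id)
      (fun k => by rw [dualHom_toAlg, KernelC.dual_one]; rfl) x
  map_mul' t u := NonUnitalStarAlgHom.ext fun x =>
    KernelAlg.induction
      (isClosed_eq (continuous_dualHom _) ((continuous_dualHom t).comp (continuous_dualHom u)))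
      (fun k => by
        change _ = dualHom t (dualHom u _)
        rw [dualHom_toAlg, dualHom_toAlg, dualHom_toAlg, KernelC.dual_mul]) x

/-! ### Bounded measurable kernels -/

/-- The space `k_b(A)` of bounded measurable compactly supported kernels `k(s,t) ∈ A_{st⁻¹}`. As
usual for Banach bundles, measurable means: on each compact set, `k` is almost everywhere the
pointwise limit of a sequence of continuous sections. -/
structure KernelB (A : FellBundle G) (μ : Measure G) [IsFiniteMeasureOnCompacts μ] where
  toFun : ∀ s t : G, A.Fib (s * t⁻¹)
  bounded : ∃ M : ℝ, ∀ s t, ‖toFun s t‖ ≤ M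
  compactSupport : ∃ K : Set (G × G), IsCompact K ∧ ∀ s t, (s, t) ∉ K → toFun s t = 0
  measurable : ∀ K : Set (Sq G), IsCompact K → ∃ ξ : ℕ → ∀ s t : G, A.Fib (s * t⁻¹),
    (∀ n, IsContSec (ν := fun x : G × G => x.1 * x.2⁻¹) (fun x => ξ n x.1 x.2)) ∧
    ∀ᵐ x : Sq G ∂sqMeasure μ, x ∈ K →
      Tendsto (fun n => ξ n x.1 x.2) atTop (𝓝 (toFun x.1 x.2))

variable {μ : Measure G} [IsFiniteMeasureOnCompacts μ]

namespace KernelB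

instance : CoeFun (KernelB A μ) (fun _ => ∀ s t : G, A.Fib (s * t⁻¹)) := ⟨fun k => k.toFun⟩

/-- A continuous kernel as a bounded measurable one. -/
def ofKernelC (k : KernelC A μ) : KernelB A μ where
  toFun := k
  bounded := by
    obtain ⟨K, hK, h⟩ := k.2.2
    obtain ⟨M, hM⟩ := hK.bddAbove_image (f := fun x : G × G => ‖k x.1 x.2‖)
      k.cont.norm.continuousOn
    refine ⟨max M 0, fun s t => ?_⟩
    by_cases hst : (s, t) ∈ K
    · exact (hM ⟨(s, t), hst, rfl⟩).trans (le_max_left _ _)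
    · rw [h s t hst, norm_zero]; exact le_max_right _ _
  compactSupport := k.2.2
  measurable K _ := ⟨fun _ => k, fun _ => k.cont, Eventually.of_forall fun _ _ => tendsto_const_nhds⟩

/-- `∫ ‖k(s,t) - l(s,t)‖² d(s,t)` for `k ∈ k_b(A)` and `l ∈ k_c(A)`. -/
def distSq (k : KernelB A μ) (l : KernelC A μ) : ENNReal :=
  ∫⁻ x : Sq G, ‖k x.1 x.2 - l x.1 x.2‖ₑ ^ 2 ∂sqMeasure μ

/-- The filter on `k_c(A)` of the `L²`-neighbourhoods of `k ∈ k_b(A)`. -/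
def near (k : KernelB A μ) : Filter (KernelC A μ) := comap k.distSq (𝓝 0)

theorem continuous_sec_sub {ξ η : ∀ s t : G, A.Fib (s * t⁻¹)}
    (hξ : IsContSec (ν := fun x : G × G => x.1 * x.2⁻¹) (fun x => ξ x.1 x.2))
    (hη : IsContSec (ν := fun x : G × G => x.1 * x.2⁻¹) (fun x => η x.1 x.2)) :
    Continuous fun x : Sq G => ‖ξ x.1 x.2 - η x.1 x.2‖ₑ := by
  have h : Continuous fun x : G × G => ‖ξ x.1 x.2 - η x.1 x.2‖ := (hξ.sub hη).norm
  have h2 : Continuous fun x : Sq G => ENNReal.ofReal ‖ξ x.1 x.2 - η x.1 x.2‖ :=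
    ENNReal.continuous_ofReal.comp h
  simpa only [ofReal_norm] using h2

theorem aemeasurable_sub (k : KernelB A μ) (l : KernelC A μ) :
    AEMeasurable (fun x : Sq G => ‖k x.1 x.2 - l x.1 x.2‖ₑ ^ 2) (sqMeasure μ) := by
  obtain ⟨K, hK, hkK⟩ := k.compactSupport
  obtain ⟨L, hL, hlL⟩ := l.2.2
  let S : Set (Sq G) := (K ∪ L : Set (G × G))
  have hc : IsCompact S := hK.union hL
  obtain ⟨ξ, hξ, hlim⟩ := k.measurable _ hc
  have h0 : AEMeasurable (fun x : Sq G => ‖k x.1 x.2 - l x.1 x.2‖ₑ)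
      ((sqMeasure μ).restrict S) := by
    refine aemeasurable_of_tendsto_metrizable_ae atTop
      (f := fun n (x : Sq G) => ‖ξ n x.1 x.2 - l x.1 x.2‖ₑ)
      (fun n => (continuous_sec_sub (hξ n) l.cont).measurable.aemeasurable) ?_
    rw [ae_restrict_iff' hc.measurableSet]
    filter_upwards [hlim] with x hx hxK
    exact ((hx hxK).sub_const _).enorm
  have h1 := (aemeasurable_indicator_iff hc.measurableSet).2 (h0.pow_const 2)
  refine h1.congr (Eventually.of_forall fun x => ?_)
  by_cases hx : x ∈ S
  · exact Set.indicator_of_mem hx _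
  · rw [Set.indicator_of_notMem hx]
    have h1 : (x.1, x.2) ∉ K := fun h => hx (Or.inl h)
    have h2 : (x.1, x.2) ∉ L := fun h => hx (Or.inr h)
    change 0 = ‖k x.1 x.2 - l x.1 x.2‖ₑ ^ 2
    rw [hkK x.1 x.2 h1, hlL x.1 x.2 h2]
    simp

theorem exists_near (k : KernelB A μ) : ∃ l : ℕ → KernelC A μ,
    Tendsto (fun n => k.distSq (l n)) atTop (𝓝 0) := by
  obtain ⟨M, hM⟩ := k.bounded
  obtain ⟨K, hK, hkK⟩ := k.compactSupport
  have hMpos : (0 : ℝ) < max M 1 := lt_of_lt_of_le one_pos (le_max_right _ _)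
  have hM' : ∀ s t, ‖k s t‖ ≤ max M 1 := fun s t => (hM s t).trans (le_max_left _ _)
  obtain ⟨χ, hχ1, -, hχc, hχ01⟩ :=
    exists_continuous_one_zero_of_isCompact hK (isClosed_empty (X := G × G)) (by simp)
  let C : Set (Sq G) := tsupport χ
  have hC : IsCompact C := hχc
  obtain ⟨ξ, hξ, hlim⟩ := k.measurable C hC
  let φ : ℕ → G × G → ℝ := fun n x => χ x * (max M 1 / max (max M 1) ‖ξ n x.1 x.2‖)
  have hφ : ∀ n, Continuous (φ n) := fun n => by
    have hn : Continuous fun x : G × G => ‖ξ n x.1 x.2‖ := (hξ n).norm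
    refine χ.continuous.mul (continuous_const.div (continuous_const.max hn) fun x => ?_)
    exact (lt_of_lt_of_le hMpos (le_max_left _ _)).ne'
  have hoff : ∀ n s t, (s, t) ∉ tsupport χ → (φ n (s, t) : ℂ) • ξ n s t = 0 := fun n s t h => by
    have : φ n (s, t) = 0 := by
      change χ (s, t) * _ = 0
      rw [image_eq_zero_of_notMem_tsupport h, zero_mul]
    rw [this, Complex.ofReal_zero, zero_smul]
  let l : ℕ → KernelC A μ := fun n => KernelC.ofFun (fun s t => (φ n (s, t) : ℂ) • ξ n s t)
    ((hξ n).smul (φ := fun x => (φ n x : ℂ)) (Complex.continuous_ofReal.comp (hφ n)))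
    ⟨tsupport χ, hχc, hoff n⟩
  have hl : ∀ n s t, ‖l n s t‖ ≤ max M 1 := fun n s t => by
    change ‖(φ n (s, t) : ℂ) • ξ n s t‖ ≤ _
    have hp : 0 < max (max M 1) ‖ξ n s t‖ := lt_of_lt_of_le hMpos (le_max_left _ _)
    have h1 := hχ01 (s, t)
    rw [norm_smul, Complex.norm_real, Real.norm_eq_abs, abs_mul, abs_of_nonneg h1.1,
      abs_of_nonneg (div_nonneg hMpos.le hp.le)]
    calc χ (s, t) * (max M 1 / max (max M 1) ‖ξ n s t‖) * ‖ξ n s t‖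
        ≤ 1 * (max M 1 / max (max M 1) ‖ξ n s t‖) * max (max M 1) ‖ξ n s t‖ := by
          gcongr
          · exact h1.2
          · exact le_max_right _ _
      _ = max M 1 := by rw [one_mul, div_mul_cancel₀ _ hp.ne']
  refine ⟨l, ?_⟩
  have hzero : (0 : ENNReal) = ∫⁻ _ : Sq G, 0 ∂sqMeasure μ := by simp
  rw [hzero]
  refine tendsto_lintegral_of_dominated_convergence'
    (C.indicator fun _ => ENNReal.ofReal (2 * max M 1) ^ 2)
    (fun n => k.aemeasurable_sub (l n)) ?_ ?_ ?_
  · refine fun n => Eventually.of_forall fun x => ?_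
    by_cases hx : x ∈ C
    · rw [Set.indicator_of_mem hx]
      refine pow_le_pow_left₀ zero_le ?_ 2
      rw [← ofReal_norm]
      refine ENNReal.ofReal_le_ofReal ((norm_sub_le _ _).trans ?_)
      have := hM' x.1 x.2
      have := hl n x.1 x.2
      linarith
    · rw [Set.indicator_of_notMem hx]
      have h1 : k x.1 x.2 = 0 := by
        refine hkK _ _ fun hxK => hx ?_
        refine subset_tsupport _ ?_
        change χ x ≠ 0
        have : χ x = 1 := hχ1 hxK
        rw [this]; exact one_ne_zero
      have h2 : l n x.1 x.2 = 0 := hoff n x.1 x.2 hx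
      change ‖k x.1 x.2 - l n x.1 x.2‖ₑ ^ 2 ≤ 0
      rw [h1, h2]
      simp
  · rw [lintegral_indicator hC.measurableSet, setLIntegral_const]
    exact ENNReal.mul_ne_top (ENNReal.pow_ne_top ENNReal.ofReal_ne_top) hC.measure_lt_top.ne
  · filter_upwards [hlim] with x hx
    have hgoal : Tendsto (fun n => ‖k x.1 x.2 - l n x.1 x.2‖ₑ ^ 2) atTop
        (𝓝 (‖k x.1 x.2 - k x.1 x.2‖ₑ ^ 2)) := by
      refine ENNReal.Tendsto.pow (Tendsto.enorm (tendsto_const_nhds.sub ?_))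
      by_cases hxC : x ∈ C
      · have hx := hx hxC
        have h1 : Tendsto (fun n => φ n x) atTop
            (𝓝 (χ x * (max M 1 / max (max M 1) ‖k x.1 x.2‖))) :=
          tendsto_const_nhds.mul (tendsto_const_nhds.div (tendsto_const_nhds.max hx.norm)
            (lt_of_lt_of_le hMpos (le_max_left _ _)).ne')
        rw [max_eq_left (hM' x.1 x.2), div_self hMpos.ne', mul_one] at h1
        have h2 : Tendsto (fun n => (φ n x : ℂ) • ξ n x.1 x.2) atTop
            (𝓝 ((χ x : ℂ) • k x.1 x.2)) :=
          ((Complex.continuous_ofReal.tendsto _).comp h1).smul hx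
        have h3 : ((χ x : ℝ) : ℂ) • k x.1 x.2 = k x.1 x.2 := by
          by_cases hxK : x ∈ (K : Set (G × G))
          · have : χ x = 1 := hχ1 hxK
            rw [this, Complex.ofReal_one, one_smul]
          · rw [hkK x.1 x.2 hxK, smul_zero]
        rw [h3] at h2
        exact h2
      · have h1 : k x.1 x.2 = 0 := by
          refine hkK _ _ fun hxK => hxC ?_
          refine subset_tsupport _ ?_
          change χ x ≠ 0
          have : χ x = 1 := hχ1 hxK
          rw [this]; exact one_ne_zero
        have h2 : ∀ n, l n x.1 x.2 = 0 := fun n => hoff n x.1 x.2 hxC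
        simp only [h1, h2]
        exact tendsto_const_nhds
    simpa using hgoal

instance (k : KernelB A μ) : k.near.NeBot := by
  obtain ⟨l, hl⟩ := k.exists_near
  exact NeBot.mono (map_neBot (f := atTop) (m := l)) (tendsto_comap_iff.2 hl)

theorem norm_toAlg_sub_le (k : KernelB A μ) (l l' : KernelC A μ) :
    ENNReal.ofReal (‖l.toAlg - l'.toAlg‖ ^ 2) ≤ 2 * (k.distSq l + k.distSq l') := by
  have h1 : ‖l.toAlg - l'.toAlg‖ ^ 2 ≤ ∫ x : Sq G, ‖(l - l') x.1 x.2‖ ^ 2 ∂sqMeasure μ := by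
    rw [← map_sub, KernelC.norm_toAlg]
    refine (pow_le_pow_left₀ (KernelC.unorm_nonneg _) (KernelC.unorm_le_l2norm _) 2).trans_eq ?_
    exact Real.sq_sqrt (integral_nonneg fun _ => sq_nonneg _)
  refine (ENNReal.ofReal_le_ofReal h1).trans ?_
  have hi : Integrable (fun x : Sq G => ‖(l - l') x.1 x.2‖ ^ 2) (sqMeasure μ) :=
    (l - l').normSq.continuous.integrable_of_hasCompactSupport (l - l').normSq.hasCompactSupport
  rw [ofReal_integral_eq_lintegral_ofReal hi (Eventually.of_forall fun _ => sq_nonneg _),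
    distSq, distSq, ← lintegral_add_left' (k.aemeasurable_sub l)]
  refine le_trans (lintegral_mono fun x => ?_) (lintegral_const_mul'' 2
    ((k.aemeasurable_sub l).add (k.aemeasurable_sub l'))).le
  have h2 : ‖(l - l') x.1 x.2‖ ≤ ‖k x.1 x.2 - l x.1 x.2‖ + ‖k x.1 x.2 - l' x.1 x.2‖ := by
    have : (l - l') x.1 x.2 = (k x.1 x.2 - l' x.1 x.2) - (k x.1 x.2 - l x.1 x.2) := by
      rw [KernelC.sub_apply]; abel
    rw [this, add_comm]
    exact norm_sub_le _ _
  have h3 : ‖(l - l') x.1 x.2‖ ^ 2 ≤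
      2 * (‖k x.1 x.2 - l x.1 x.2‖ ^ 2 + ‖k x.1 x.2 - l' x.1 x.2‖ ^ 2) :=
    (pow_le_pow_left₀ (norm_nonneg _) h2 2).trans add_sq_le
  refine (ENNReal.ofReal_le_ofReal h3).trans_eq ?_
  rw [ENNReal.ofReal_mul zero_le_two, ENNReal.ofReal_add (sq_nonneg _) (sq_nonneg _),
    ENNReal.ofReal_pow (norm_nonneg _), ENNReal.ofReal_pow (norm_nonneg _), ofReal_norm,
    ofReal_norm, ENNReal.ofReal_ofNat]
  rfl

/-- The element of `𝕂(A)` given by `k ∈ k_b(A)`: the limit in `𝕂(A)` of the elements given by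
`l ∈ k_c(A)`, as `l → k` in `L²`. -/
def toAlg (k : KernelB A μ) : KernelAlg A μ := lim (map KernelC.toAlg k.near)

theorem cauchy_near (k : KernelB A μ) :
    Cauchy (map (KernelC.toAlg : KernelC A μ → KernelAlg A μ) k.near) := by
  refine Metric.cauchy_iff.2 ⟨map_neBot, fun ε hε => ?_⟩
  have hd : Tendsto k.distSq k.near (𝓝 0) := tendsto_comap
  have hε' : (0 : ENNReal) < ENNReal.ofReal (ε ^ 2) / 8 :=
    ENNReal.div_pos (ENNReal.ofReal_pos.2 (by positivity)).ne' (by simp)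
  refine ⟨KernelC.toAlg '' {l | k.distSq l < ENNReal.ofReal (ε ^ 2) / 8},
    image_mem_map (hd.eventually_lt_const hε'), ?_⟩
  rintro _ ⟨l, hl, rfl⟩ _ ⟨l', hl', rfl⟩
  have h := k.norm_toAlg_sub_le l l'
  have h2 : ENNReal.ofReal (‖l.toAlg - l'.toAlg‖ ^ 2) < ENNReal.ofReal (ε ^ 2) := by
    refine h.trans_lt ?_
    calc 2 * (k.distSq l + k.distSq l')
        ≤ 2 * (ENNReal.ofReal (ε ^ 2) / 8 + ENNReal.ofReal (ε ^ 2) / 8) := by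
          gcongr
          · exact hl.le
          · exact hl'.le
      _ = ENNReal.ofReal (ε ^ 2 / 2) := by
          rw [← ENNReal.ofReal_ofNat 8, ← ENNReal.ofReal_div_of_pos (by norm_num),
            ← ENNReal.ofReal_add (by positivity) (by positivity), ← ENNReal.ofReal_ofNat 2,
            ← ENNReal.ofReal_mul zero_le_two]
          congr 1
          ring
      _ < ENNReal.ofReal (ε ^ 2) := by
          refine (ENNReal.ofReal_lt_ofReal_iff (by positivity)).2 ?_
          have : 0 < ε ^ 2 := by positivity
          linarith
  rw [dist_eq_norm]
  exact lt_of_pow_lt_pow_left₀ 2 hε.le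
    ((ENNReal.ofReal_lt_ofReal_iff (by positivity)).1 h2)

/-- If `l → k` in `L²`, then `l → k` in `𝕂(A)`. -/
theorem tendsto_toAlg (k : KernelB A μ) : Tendsto KernelC.toAlg k.near (𝓝 k.toAlg) :=
  le_nhds_lim (CompleteSpace.complete k.cauchy_near)

/-- On `k_c(A)`, the two maps to `𝕂(A)` agree. -/
theorem toAlg_ofKernelC (l : KernelC A μ) : (ofKernelC l).toAlg = l.toAlg := by
  refine tendsto_nhds_unique (ofKernelC l).tendsto_toAlg ?_
  have h0 : pure l ≤ (ofKernelC l).near := by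
    have : (ofKernelC l).distSq l = 0 := by
      change ∫⁻ x : Sq G, ‖l x.1 x.2 - l x.1 x.2‖ₑ ^ 2 ∂sqMeasure μ = 0
      simp
    have h : Tendsto (ofKernelC l).distSq (pure l) (𝓝 0) := by
      rw [← this]
      exact tendsto_pure_nhds _ _
    exact tendsto_iff_comap.1 h
  have h1 : Tendsto KernelC.toAlg (pure l) (𝓝 (ofKernelC l).toAlg) :=
    (ofKernelC l).tendsto_toAlg.mono_left h0
  rw [← tendsto_nhds_unique h1 (tendsto_pure_nhds _ _)]
  exact (ofKernelC l).tendsto_toAlg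

end KernelB

/-- A kernel of `A_σ` as a function on `G_σ × G_σ`: for `x` over `g` and `y` over `h`, the element
`k(x, y) ∈ A_{gh⁻¹}` is the one with `k(g, h) = [k(x, y), x y⁻¹]` in `A_σ`. -/
def lifted {σ : Twist G} (k : ∀ g h : G, (A.twisted σ).Fib (g * h⁻¹)) {g h : G} (x y : σ.H)
    (hx : σ.q x = g) (hy : σ.q y = h) : A.Fib (g * h⁻¹) :=
  coordEquiv (x * y⁻¹) (by rw [map_mul, map_inv, hx, hy]) (k g h)

/-- `k(g, h) = [k(x, y), x y⁻¹]`. -/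
theorem tmk_lifted {σ : Twist G} (k : ∀ g h : G, (A.twisted σ).Fib (g * h⁻¹)) {g h : G}
    (x y : σ.H) (hx : σ.q x = g) (hy : σ.q y = h) :
    tfun (x * y⁻¹) (by rw [map_mul, map_inv, hx, hy]) (lifted k x y hx hy) = k g h :=
  tfun_coordEquiv _ _ _

end FellBundle

end

/-!
The fibre of the twisted bundle over `g h⁻¹` is identified with `A_{gh⁻¹}` by the coordinate `θ_{g,h}`
with respect to the lift `𝔰(g) 𝔰(h)⁻¹`. Because `𝔰(s) 𝔰(r)⁻¹ · 𝔰(r) 𝔰(t)⁻¹ = 𝔰(s) 𝔰(t)⁻¹`, the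
maps `θ` are compatible with the products and involutions of kernels, but they do not preserve
continuity, so the map `k ↦ θ k` does not map `k_c(A_σ)` to `k_c(A)`. It does so after a
regularization. Let `P : σ.H → ℂ` be continuous and equivariant, `P(z x) = z P(x)` for `z ∈ 𝕋`, and let
`u = P ∘ 𝔰`. The phases of `u(g) conj(u(h))` cancel the dependence of `θ_{g,h}` on the lifts, and
`u(g) conj(u(h)) θ_{g,h}(k(g,h))` is a continuous kernel for every continuous kernel `k`
(`FellBundle.regularizes_coordIso`).

There are sufficiently many such `P`. Averaging bump functions over the circle gives one that does not
vanish at a prescribed point (`Twist.exists_isEquivariant`), which replaces the local triviality of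
the circle bundle. Combining finitely many of them with measurable coefficients, and approximating the
coefficients by continuous functions in `L¹`, one finds for every compact set `C` a sequence `P_n`
with `|P_n| ≤ 1` and `P_n ∘ 𝔰 → 1` almost everywhere on `C` (`Twist.exists_seq_isEquivariant`).

A family `θ` with such regularizers is a `FellBundle.BorelIso`. By dominated convergence the
regularized kernels converge to `θ k` with respect to `‖·‖₂`. As `|u_n|² → 1` in the convolution
integral, the limit is a `*`-homomorphism on continuous kernels, bounded by `‖·‖₂`, and the universal
property of the kernel algebra extends it to `𝕂(A_σ) → 𝕂(A)` (`FellBundle.BorelIso.mapAlg`). Almost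
everywhere convergence on `G × G` is deduced from that on `G` by regularity
(`ae_sqMeasure_of_ae`), since Fubini's theorem is not available for a Haar measure that is not
`σ`-finite. The inverse of `θ` is regularized by `conj(u_n)`, hence the induced map is an isomorphism.

The action `δω` is the dual action on `𝕂(A_σ)` transported through this isomorphism. Its formula on
bounded kernels expresses that `𝔰(g) 𝔰(h)⁻¹` and `𝔰(gt) 𝔰(ht)⁻¹` differ by the phase
`ω(g,t) conj(ω(h,t))` (`FellBundle.coordIso_fcast_tfun`), and strong continuity follows from that of
the dual action, which holds on continuous kernels by uniform convergence.
-/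

noncomputable section

/-! ### The Radon product measure -/

section SqMeasure

open CompactlySupported

variable {G : Type u} [TopologicalSpace G] [T2Space G] [LocallyCompactSpace G] [MeasurableSpace G]
  [BorelSpace G] (μ : Measure G) [IsFiniteMeasureOnCompacts μ]

/-- The Radon product measure of an open rectangle is at most the product of the measures: by inner
regularity it suffices to integrate functions in `C_c(G × G)` that are at most `1_U ⊗ 1_V`. -/
theorem sqMeasure_prod_le {U V : Set G} (hU : IsOpen U) (hV : IsOpen V) (hμU : μ U ≠ ⊤)
    (hμV : μ V ≠ ⊤) : sqMeasure μ (U ×ˢ V : Set (G × G)) ≤ μ U * μ V := by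
  have ho : IsOpen (X := Sq G) (U ×ˢ V : Set (G × G)) := hU.prod hV
  rw [ho.measure_eq_iSup_isCompact]
  refine iSup₂_le fun K hKU => iSup_le fun hK => ?_
  obtain ⟨f, hf1, hf0, hfc, hf⟩ := exists_continuous_one_zero_of_isCompact hK ho.isClosed_compl
    (Set.disjoint_compl_right_iff_subset.2 hKU)
  let F : C_c(Sq G, ℝ) := ⟨f, hfc⟩
  have hF : ∀ s t, F (s, t) ≤ U.indicator (fun _ => V.indicator (fun _ => (1 : ℝ)) t) s := by
    intro s t
    by_cases h : (s, t) ∈ U ×ˢ V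
    · rw [Set.indicator_of_mem h.1, Set.indicator_of_mem h.2]
      exact (hf (s, t)).2
    · rw [show F (s, t) = 0 from hf0 h]
      exact Set.indicator_nonneg (fun _ _ => Set.indicator_nonneg (fun _ _ => zero_le_one) _) _
  refine (RealRMK.rieszMeasure_le_of_eq_one (sqFunctional μ) (f := F) (fun x => (hf x).1) hK
    hf1).trans ?_
  have hV' : Integrable (V.indicator fun _ => (1 : ℝ)) μ :=
    (integrable_indicator_iff hV.measurableSet).2 (integrableOn_const hμV)
  have h1 : ∀ s, ∫ t, F (s, t) ∂μ ≤ U.indicator (fun _ => μ.real V) s := by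
    intro s
    by_cases hs : s ∈ U
    · rw [Set.indicator_of_mem hs]
      refine (integral_mono (integrable_inner μ F s) hV' fun t => ?_).trans_eq ?_
      · have := hF s t
        rwa [Set.indicator_of_mem hs] at this
      · rw [integral_indicator hV.measurableSet]; simp
    · rw [Set.indicator_of_notMem hs]
      refine integral_nonpos fun t => ?_
      have := hF s t
      rwa [Set.indicator_of_notMem hs] at this
  have h2 : sqFunctional μ F ≤ μ.real U * μ.real V := by
    refine (integral_mono (integrable_outer μ F) ((integrable_indicator_iff hU.measurableSet).2
      (integrableOn_const hμU)) h1).trans_eq ?_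
    rw [integral_indicator hU.measurableSet, setIntegral_const, smul_eq_mul]
  refine (ENNReal.ofReal_le_ofReal h2).trans_eq ?_
  rw [ENNReal.ofReal_mul measureReal_nonneg, ofReal_measureReal hμU, ofReal_measureReal hμV]

/-- A property that holds almost everywhere on `G` holds for both coordinates almost everywhere on
each compact subset of `G × G`. Fubini's theorem for products of `σ`-algebras does not apply to
`sqMeasure`; the statement follows from outer regularity instead. -/
theorem ae_sqMeasure_of_ae [μ.OuterRegular] {p : G → Prop} (hp : ∀ᵐ g ∂μ, p g) {K : Set (Sq G)}
    (hK : IsCompact K) : ∀ᵐ x ∂sqMeasure μ, x ∈ K → p x.1 ∧ p x.2 := by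
  have hK1 : IsCompact (Prod.fst '' (K : Set (G × G)) ∪ Prod.snd '' (K : Set (G × G))) :=
    (IsCompact.image (X := G × G) hK continuous_fst).union
      (IsCompact.image (X := G × G) hK continuous_snd)
  obtain ⟨V, hCV, hVo, hVμ⟩ := hK1.exists_open_superset_measure_lt_top μ
  have hN : μ {g | ¬ p g} = 0 := hp
  have key : ∀ ε : NNReal, 0 < ε → ∃ U : Set G, {g | ¬ p g} ⊆ U ∧ IsOpen U ∧
      μ U * μ V ≤ ε ∧ μ U ≠ ⊤ := by
    intro ε hε
    have hpos : (0 : ENNReal) < ε / (μ V + 1) :=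
      ENNReal.div_pos (ENNReal.coe_ne_zero.2 hε.ne') (by simp [hVμ.ne])
    obtain ⟨U, hNU, hUo, hU⟩ := Set.exists_isOpen_lt_of_lt (μ := μ) {g | ¬ p g} _
      (hN.trans_lt hpos)
    refine ⟨U, hNU, hUo, ?_, hU.ne_top⟩
    calc μ U * μ V ≤ ε / (μ V + 1) * (μ V + 1) := by gcongr; exact le_self_add
      _ ≤ ε := by rw [mul_comm]; exact ENNReal.mul_div_le
  have h0 : ∀ (W : Set G → Set (Sq G)), (∀ U, IsOpen U → μ U ≠ ⊤ → sqMeasure μ (W U) ≤ μ U * μ V) →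
      (∀ U, {g | ¬ p g} ⊆ U → W {g | ¬ p g} ⊆ W U) → sqMeasure μ (W {g | ¬ p g}) = 0 := by
    intro W h1 h2
    refine le_antisymm (ENNReal.le_of_forall_pos_le_add fun ε hε _ => ?_) zero_le
    obtain ⟨U, hNU, hUo, hU, hU'⟩ := key ε hε
    rw [zero_add]
    exact (measure_mono (h2 U hNU)).trans ((h1 U hUo hU').trans hU)
  have h1 := h0 (fun U => (U ×ˢ V : Set (G × G)))
    (fun U hUo hU => sqMeasure_prod_le μ hUo hVo hU hVμ.ne) (fun U h => Set.prod_mono h le_rfl)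
  have h2 := h0 (fun U => (V ×ˢ U : Set (G × G)))
    (fun U hUo hU => (sqMeasure_prod_le μ hVo hUo hVμ.ne hU).trans_eq (mul_comm _ _))
    (fun U h => Set.prod_mono le_rfl h)
  refine measure_mono_null (fun x hx => ?_) (measure_union_null h1 h2)
  change ¬ (x ∈ K → p x.1 ∧ p x.2) at hx
  rw [Classical.not_imp, not_and_or] at hx
  obtain ⟨hxK, h | h⟩ := hx
  · exact Or.inl ⟨h, hCV (Or.inr ⟨x, hxK, rfl⟩)⟩
  · exact Or.inr ⟨hCV (Or.inl ⟨x, hxK, rfl⟩), h⟩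

end SqMeasure

section SqShift

open CompactlySupported FellBundle

variable {G : Type u} [Group G] [TopologicalSpace G] [IsTopologicalGroup G] [T2Space G]
  [LocallyCompactSpace G] [MeasurableSpace G] [BorelSpace G]

/-- The homeomorphism `(s, r) ↦ (s t, r t)` of `G × G`. -/
def sqMulRight (t : G) : Sq G ≃ₜ Sq G :=
  Homeomorph.prodCongr (X := G) (Y := G) (Homeomorph.mulRight t) (Homeomorph.mulRight t)

theorem map_sqMulRight (μ : Measure G) [μ.IsHaarMeasure] [μ.Regular] (t : G) :
    (sqMeasure μ).map (sqMulRight t) = ((Δ t).toNNReal⁻¹ ^ 2) • sqMeasure μ := by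
  have : ((sqMeasure μ).map (sqMulRight t)).Regular := Measure.Regular.map (sqMulRight t)
  refine Measure.ext_of_integral_eq_on_compactlySupported fun f => ?_
  rw [(sqMulRight t).measurableEmbedding.integral_map, integral_smul_nnreal_measure,
    integral_sqMeasure]
  let F : C_c(Sq G, ℝ) := ⟨⟨fun x => f (sqMulRight t x), f.continuous.comp (sqMulRight t).continuous⟩,
    f.hasCompactSupport.comp_homeomorph (sqMulRight t)⟩
  refine (integral_sqMeasure μ F).trans ?_
  change ∫ s, ∫ r, f (s * t, r * t) ∂μ ∂μ = _
  have h1 : ∀ s, ∫ r, f (s * t, r * t) ∂μ = (Δ t)⁻¹ • ∫ r, f (s * t, r) ∂μ :=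
    fun s => integral_mul_right μ (fun r => f (s * t, r)) t
  have h2 := integral_mul_right μ (fun s => ∫ r, f (s, r) ∂μ) t
  simp only [h1]
  rw [integral_smul, h2, smul_smul, NNReal.smul_def]
  congr 1
  rw [NNReal.coe_pow, NNReal.coe_inv, Real.coe_toNNReal _ (Δ_pos t).le, sq]

theorem ae_sqMulRight (μ : Measure G) [μ.IsHaarMeasure] [μ.Regular] (t : G) {p : Sq G → Prop}
    (hp : ∀ᵐ x ∂sqMeasure μ, p x) : ∀ᵐ x ∂sqMeasure μ, p (sqMulRight t x) := by
  refine ae_of_ae_map (f := sqMulRight t) (sqMulRight t).measurable.aemeasurable ?_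
  rw [map_sqMulRight]
  exact Measure.ae_smul_measure hp _

theorem lintegral_sqMulRight (μ : Measure G) [μ.IsHaarMeasure] [μ.Regular] (t : G)
    (f : Sq G → ENNReal) : ∫⁻ x, f (sqMulRight t x) ∂sqMeasure μ =
      (ENNReal.ofReal (Δ t))⁻¹ ^ 2 * ∫⁻ x, f x ∂sqMeasure μ := by
  have h := (sqMulRight t).measurableEmbedding.lintegral_map (μ := sqMeasure μ) f
  rw [← h, map_sqMulRight, lintegral_smul_measure]
  have hne : (Δ t).toNNReal ≠ 0 := (Real.toNNReal_pos.2 (Δ_pos t)).ne'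
  rw [ENNReal.smul_def, smul_eq_mul, ENNReal.coe_pow, ENNReal.coe_inv hne]
  rfl

open Pointwise in
/-- The modular function is continuous: `Δ(t)⁻¹ ∫ f(s) ds = ∫ f(s t) ds` depends continuously
on `t` for `f ∈ C_c(G)`. -/
theorem FellBundle.continuous_Δ : Continuous (Δ : G → ℝ) := by
  let K : TopologicalSpace.PositiveCompacts G := Classical.arbitrary _
  let μ : Measure G := Measure.haarMeasure K
  obtain ⟨f, hf1, -, hfc, hf⟩ := exists_continuous_one_zero_of_isCompact
    (isCompact_singleton (x := (1 : G))) isClosed_empty (by simp)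
  have hpos : 0 < ∫ s, f s ∂μ :=
    f.continuous.integral_pos_of_hasCompactSupport_nonneg_nonzero hfc (fun x => (hf x).1)
      (x := 1) (by rw [hf1 rfl]; exact one_ne_zero)
  have hc : Continuous fun t => ∫ s, f (s * t) ∂μ := by
    refine continuous_iff_continuousAt.2 fun t₀ => ?_
    obtain ⟨N, hN, hNt⟩ := exists_compact_mem_nhds t₀
    have h : ContinuousOn (fun t => ∫ s, f (s * t) ∂μ) N := by
      refine continuousOn_integral_of_compact_support (k := tsupport f * N⁻¹)
        (hfc.isCompact.mul hN.inv) (by fun_prop) fun t s ht hs => ?_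
      by_contra h
      exact hs ⟨s * t, subset_tsupport f h, t⁻¹, Set.inv_mem_inv.2 ht, by simp⟩
    exact h.continuousAt hNt
  have e : ∀ t, Δ t = (∫ s, f s ∂μ) / ∫ s, f (s * t) ∂μ := fun t => by
    rw [integral_mul_right μ f t, smul_eq_mul]
    have := (Δ_pos t).ne'
    field_simp
  have hne : ∀ t, ∫ s, f (s * t) ∂μ ≠ 0 := fun t => by
    rw [integral_mul_right μ f t, smul_eq_mul]
    exact mul_ne_zero (inv_ne_zero (Δ_pos t).ne') hpos.ne'
  rw [show (Δ : G → ℝ) = _ from funext e]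
  exact continuous_const.div hc hne

end SqShift

namespace FellBundle

open BanachBundle

/-! ### Approximation of bounded measurable kernels -/

section Approximation

variable {G : Type u} [Group G] [TopologicalSpace G] [IsTopologicalGroup G] [T2Space G]
  [LocallyCompactSpace G] [MeasurableSpace G] [BorelSpace G]
  {A : FellBundle G} {μ : Measure G} [IsFiniteMeasureOnCompacts μ]

theorem continuous_fcast {g h : G} (e : g = h) : Continuous (fcast e : A.Fib g → A.Fib h) := by
  subst e; exact continuous_id

theorem fcast_sub {g h : G} (e : g = h) (a b : A.Fib g) :
    fcast e (a - b) = fcast e a - fcast e b := by subst e; rfl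

theorem KernelB.ext {k l : KernelB A μ} (h : ∀ s t, k s t = l s t) : k = l := by
  obtain ⟨k, _, _, _⟩ := k
  obtain ⟨l, _, _, _⟩ := l
  obtain rfl : k = l := funext fun s => funext fun t => h s t
  rfl

theorem KernelB.tendsto_toAlg_of_distSq {ι : Type*} {F : Filter ι} {k : KernelB A μ}
    {l : ι → KernelC A μ} (h : Tendsto (fun n => k.distSq (l n)) F (𝓝 0)) :
    Tendsto (fun n => (l n).toAlg) F (𝓝 k.toAlg) :=
  k.tendsto_toAlg.comp (tendsto_comap_iff.2 h)

/-- The extension of `k_c(A) → 𝕂(A)` to `k_b(A)` satisfies the estimate of `‖·‖₂` type, up to the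
factor `2` that comes from the square of a sum. -/
theorem KernelB.norm_toAlg_sub_sq_le (k : KernelB A μ) (l : KernelC A μ) :
    ENNReal.ofReal (‖k.toAlg - l.toAlg‖ ^ 2) ≤ 2 * k.distSq l := by
  obtain ⟨m, hm⟩ := k.exists_near
  have h1 : Tendsto (fun n => ENNReal.ofReal (‖(m n).toAlg - l.toAlg‖ ^ 2)) atTop
      (𝓝 (ENNReal.ofReal (‖k.toAlg - l.toAlg‖ ^ 2))) :=
    (ENNReal.continuous_ofReal.tendsto _).comp
      ((((KernelB.tendsto_toAlg_of_distSq hm).sub_const _).norm).pow 2)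
  have h2 : Tendsto (fun n => 2 * (k.distSq (m n) + k.distSq l)) atTop
      (𝓝 (2 * (0 + k.distSq l))) :=
    ENNReal.Tendsto.const_mul (hm.add tendsto_const_nhds) (Or.inr (by simp))
  rw [zero_add] at h2
  exact le_of_tendsto_of_tendsto' h1 h2 fun n => k.norm_toAlg_sub_le (m n) l

/-- A continuous map out of `𝕂(A)` is determined on `k_b(A)` by square-integral estimates on
`k_c(A)`. -/
theorem KernelB.map_toAlg_eq {D : Type*} [NormedAddCommGroup D] {T : KernelAlg A μ → D}
    (hT : Continuous T) (k : KernelB A μ) (y : D) {c : ENNReal} (hc : c ≠ ⊤)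
    (h : ∀ l : KernelC A μ, ENNReal.ofReal (‖T l.toAlg - y‖ ^ 2) ≤ c * k.distSq l) :
    T k.toAlg = y := by
  obtain ⟨m, hm⟩ := k.exists_near
  have h1 : Tendsto (fun n => ENNReal.ofReal (‖T (m n).toAlg - y‖ ^ 2)) atTop
      (𝓝 (ENNReal.ofReal (‖T k.toAlg - y‖ ^ 2))) :=
    (ENNReal.continuous_ofReal.tendsto _).comp
      (((((hT.tendsto _).comp (KernelB.tendsto_toAlg_of_distSq hm)).sub_const _).norm).pow 2)
  have h2 : Tendsto (fun n => c * k.distSq (m n)) atTop (𝓝 (c * 0)) :=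
    ENNReal.Tendsto.const_mul hm (Or.inr hc)
  rw [mul_zero] at h2
  have h3 := le_of_tendsto_of_tendsto' h1 h2 fun n => h (m n)
  rw [nonpos_iff_eq_zero, ENNReal.ofReal_eq_zero] at h3
  have h4 : ‖T k.toAlg - y‖ = 0 := by
    have := sq_nonneg ‖T k.toAlg - y‖
    exact pow_eq_zero_iff two_ne_zero |>.1 (le_antisymm h3 this)
  exact sub_eq_zero.1 (norm_eq_zero.1 h4)

theorem KernelC.l2norm_le {k : KernelC A μ} {K : Set (Sq G)} (hK : IsCompact K)
    (hkK : ∀ s t, (s, t) ∉ K → k s t = 0) {M : ℝ} (hM0 : 0 ≤ M) (hM : ∀ s t, ‖k s t‖ ≤ M) :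
    k.l2norm ≤ M * √((sqMeasure μ).real K) := by
  have hi : Integrable (fun x : Sq G => ‖k x.1 x.2‖ ^ 2) (sqMeasure μ) :=
    k.normSq.continuous.integrable_of_hasCompactSupport k.normSq.hasCompactSupport
  have hj : Integrable (Set.indicator K fun _ => M ^ 2) (sqMeasure μ) :=
    (integrable_indicator_iff hK.measurableSet).2 (integrableOn_const hK.measure_lt_top.ne)
  have h : ∫ x : Sq G, ‖k x.1 x.2‖ ^ 2 ∂sqMeasure μ ≤
      M ^ 2 * (sqMeasure μ).real K := by
    refine (integral_mono hi hj fun x => ?_).trans_eq ?_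
    · by_cases hx : x ∈ K
      · rw [Set.indicator_of_mem hx]
        exact pow_le_pow_left₀ (norm_nonneg _) (hM _ _) 2
      · rw [Set.indicator_of_notMem hx]
        have := hkK x.1 x.2 hx
        simp [this]
    · rw [integral_indicator hK.measurableSet, setIntegral_const, smul_eq_mul, mul_comm]
  refine (Real.sqrt_le_sqrt h).trans_eq ?_
  rw [Real.sqrt_mul (sq_nonneg M), Real.sqrt_sq hM0]

theorem KernelC.norm_toAlg_le_l2norm (k : KernelC A μ) : ‖k.toAlg‖ ≤ k.l2norm :=
  (KernelC.norm_toAlg k).trans_le k.unorm_le_l2norm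

/-- The extension to `𝕂(A)` of a `*`-homomorphism from `k_c(A)` into a `C*`-algebra that is bounded
by the norm `‖·‖₂`. -/
def KernelAlg.lift {D : Type u} [NonUnitalCStarAlgebra D] (π : KernelC A μ →⋆ₙₐ[ℂ] D)
    (hπ : ∀ k, ‖π k‖ ≤ k.l2norm) : KernelAlg A μ →⋆ₙₐ[ℂ] D :=
  let e : KernelC A μ →ₗ[ℂ] KernelAlg A μ := (KernelC.toAlg : KernelC A μ →⋆ₙₐ[ℂ] KernelAlg A μ)
  let T : KernelAlg A μ →L[ℂ] D := LinearMap.extendOfNorm (π : KernelC A μ →ₗ[ℂ] D) e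
  have hT : ∀ k : KernelC A μ, T k.toAlg = π k :=
    LinearMap.extendOfNorm_eq (f := (π : KernelC A μ →ₗ[ℂ] D)) (e := e) KernelC.denseRange_toAlg
      ⟨1, fun k => by
        rw [one_mul]
        exact (KernelC.le_unorm k { D := D, π := π, bound := hπ }).trans_eq
          (KernelC.norm_toAlg k).symm⟩
  { toFun := T
    map_smul' := fun c x => map_smul _ c x
    map_zero' := map_zero _
    map_add' := map_add _
    map_mul' := fun x y => by
      refine KernelAlg.induction₂ (P := fun x y => T (x * y) = T x * T y)
        (isClosed_eq (by fun_prop) (by fun_prop)) (fun k l => ?_) x y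
      rw [← map_mul, hT, hT, hT, map_mul]
    map_star' := fun x => by
      refine KernelAlg.induction (P := fun x => T (star x) = star (T x))
        (isClosed_eq (by fun_prop) (by fun_prop)) (fun k => ?_) x
      rw [← map_star, hT, hT, map_star] }

theorem KernelAlg.lift_toAlg {D : Type u} [NonUnitalCStarAlgebra D] (π : KernelC A μ →⋆ₙₐ[ℂ] D)
    (hπ : ∀ k, ‖π k‖ ≤ k.l2norm) (k : KernelC A μ) : KernelAlg.lift π hπ k.toAlg = π k :=
  LinearMap.extendOfNorm_eq (f := (π : KernelC A μ →ₗ[ℂ] D))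
    (e := ((KernelC.toAlg : KernelC A μ →⋆ₙₐ[ℂ] KernelAlg A μ) : KernelC A μ →ₗ[ℂ] KernelAlg A μ))
    KernelC.denseRange_toAlg
    ⟨1, fun k => by
      rw [one_mul]
      exact (KernelC.le_unorm k { D := D, π := π, bound := hπ }).trans_eq
        (KernelC.norm_toAlg k).symm⟩ k

end Approximation

/-! ### The dual action -/

section Dual

variable {G : Type u} [Group G] [TopologicalSpace G] [IsTopologicalGroup G] [T2Space G]
  [LocallyCompactSpace G] [MeasurableSpace G] [BorelSpace G]
  {A : FellBundle G} {μ : Measure G} [μ.IsHaarMeasure] [μ.Regular]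

/-- `(δ_t k)(s,r) = Δ(t) k(st, rt)`, on `k_b(A)`. -/
def KernelB.dual (t : G) (k : KernelB A μ) : KernelB A μ where
  toFun s r := (Δ t : ℂ) • fcast (shift_aux s r t) (k (s * t) (r * t))
  bounded := by
    obtain ⟨M, hM⟩ := k.bounded
    refine ⟨‖(Δ t : ℂ)‖ * M, fun s r => ?_⟩
    rw [norm_smul, norm_fcast]
    exact mul_le_mul_of_nonneg_left (hM _ _) (norm_nonneg _)
  compactSupport := by
    obtain ⟨K, hK, h⟩ := k.compactSupport
    refine ⟨sqMulRight t ⁻¹' K, (sqMulRight t).isCompact_preimage.2 hK, fun s r hsr => ?_⟩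
    rw [h (s * t) (r * t) hsr, fcast_zero, smul_zero]
  measurable K hK := by
    obtain ⟨ξ, hξ, hlim⟩ := k.measurable _ (hK.image (sqMulRight t).continuous)
    refine ⟨fun n s r => (Δ t : ℂ) • fcast (shift_aux s r t) (ξ n (s * t) (r * t)),
      fun n => ?_, ?_⟩
    · have h : IsContSec (B := A.toBanachBundle) (ν := fun x : G × G => x.1 * x.2⁻¹)
          (fun x => fcast (shift_aux x.1 x.2 t) (ξ n (x.1 * t) (x.2 * t))) :=
        Continuous.comp (g := fun x : G × G => (ξ n x.1 x.2).val)
          (f := fun x : G × G => (x.1 * t, x.2 * t)) (hξ n) (by fun_prop)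
      exact h.const_smul _
    · filter_upwards [ae_sqMulRight μ t hlim] with x hx hxK
      exact (((continuous_fcast (A := A) (shift_aux x.1 x.2 t)).tendsto _).comp
        (hx ⟨x, hxK, rfl⟩)).const_smul _

theorem KernelB.dual_apply (t : G) (k : KernelB A μ) (s r : G) :
    KernelB.dual t k s r = (Δ t : ℂ) • fcast (shift_aux s r t) (k (s * t) (r * t)) := rfl

theorem KernelB.distSq_dual (t : G) (k : KernelB A μ) (l : KernelC A μ) :
    (k.dual t).distSq (KernelC.dual t l) = k.distSq l := by
  have h : ∀ x : Sq G, ‖k.dual t x.1 x.2 - KernelC.dual t l x.1 x.2‖ₑ ^ 2 =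
      ENNReal.ofReal (Δ t) ^ 2 * ‖k (sqMulRight t x).1 (sqMulRight t x).2 -
        l (sqMulRight t x).1 (sqMulRight t x).2‖ₑ ^ 2 := fun x => by
    rw [KernelB.dual_apply, KernelC.dual_apply, ← smul_sub, ← fcast_sub, ← mul_pow]
    congr 1
    rw [enorm_smul]
    congr 1
    · rw [← ofReal_norm, Complex.norm_real, Real.norm_of_nonneg (Δ_pos t).le]
    · rw [← ofReal_norm, norm_fcast, ofReal_norm]
      rfl
  have hpos : ENNReal.ofReal (Δ t) ≠ 0 := (ENNReal.ofReal_pos.2 (Δ_pos t)).ne'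
  rw [KernelB.distSq, lintegral_congr h, lintegral_const_mul' _ _ (by finiteness),
    lintegral_sqMulRight μ t (fun x => ‖k x.1 x.2 - l x.1 x.2‖ₑ ^ 2), ← mul_assoc, ← mul_pow,
    ENNReal.mul_inv_cancel hpos ENNReal.ofReal_ne_top, one_pow, one_mul]
  rfl

theorem dualHom_toAlg_kernelB (t : G) (k : KernelB A μ) :
    dualHom t k.toAlg = (k.dual t).toAlg := by
  refine k.map_toAlg_eq (continuous_dualHom t) _ (c := 2) (by simp) fun l => ?_
  rw [dualHom_toAlg, norm_sub_rev, ← KernelB.distSq_dual t k l]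
  exact (k.dual t).norm_toAlg_sub_sq_le _

open Pointwise in
/-- For `t` in a compact neighbourhood `N` of `1`, the kernels `δ_t k` are supported in a common
compact rectangle, and they converge uniformly to `k`; hence they converge with respect to `‖·‖₂`. -/
theorem tendsto_toAlg_dual (k : KernelC A μ) :
    Tendsto (fun t => (KernelC.dual t k).toAlg) (𝓝 1) (𝓝 k.toAlg) := by
  obtain ⟨N, hN, hN1⟩ := exists_compact_mem_nhds (1 : G)
  obtain ⟨C, hC, h1, h2⟩ := k.exists_box
  let K : Set G := C * N⁻¹
  have hK : IsCompact K := hC.mul hN.inv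
  have hmem : ∀ t ∈ N, ∀ s, s ∉ K → s * t ∉ C := fun t ht s hs h =>
    hs ⟨s * t, h, t⁻¹, Set.inv_mem_inv.2 ht, by simp⟩
  have hsupp : ∀ t ∈ N, ∀ s r, (s, r) ∉ K ×ˢ K → (KernelC.dual t k - k) s r = 0 := by
    intro t ht s r hsr
    rw [KernelC.sub_apply, KernelC.dual_apply]
    have h0 : k (s * t) (r * t) = 0 ∧ k s r = 0 := by
      by_cases hs : s ∈ K
      · have hr : r ∉ K := fun hr => hsr ⟨hs, hr⟩
        exact ⟨h2 _ _ (hmem t ht r hr),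
          h2 _ _ (by simpa using hmem 1 (mem_of_mem_nhds hN1) r hr)⟩
      · exact ⟨h1 _ _ (hmem t ht s hs),
          h1 _ _ (by simpa using hmem 1 (mem_of_mem_nhds hN1) s hs)⟩
    rw [h0.1, h0.2, fcast_zero, smul_zero, sub_zero]
  have hcont : Continuous fun w : G × (G × G) =>
      ‖(KernelC.dual w.1 k - k) w.2.1 w.2.2‖ := by
    have c1 : IsContSec (B := A.toBanachBundle) (ν := fun w : G × (G × G) => w.2.1 * w.2.2⁻¹)
        (fun w => fcast (shift_aux w.2.1 w.2.2 w.1) (k (w.2.1 * w.1) (w.2.2 * w.1))) :=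
      Continuous.comp (g := fun x : G × G => (k x.1 x.2).val)
        (f := fun w : G × (G × G) => (w.2.1 * w.1, w.2.2 * w.1)) k.cont (by fun_prop)
    have cΔ : Continuous fun w : G × (G × G) => Δ w.1 :=
      Continuous.comp (g := Δ) continuous_Δ continuous_fst
    have c2 := c1.smul (φ := fun w => (Δ w.1 : ℂ)) (Complex.continuous_ofReal.comp cΔ)
    have c3 : IsContSec (B := A.toBanachBundle) (ν := fun w : G × (G × G) => w.2.1 * w.2.2⁻¹)
        (fun w => k w.2.1 w.2.2) := k.cont.comp (j := fun w : G × (G × G) => w.2) continuous_snd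
    exact (c2.sub c3).norm
  refine Metric.tendsto_nhds.2 fun ε hε => ?_
  obtain ⟨δ, hδ, hδε⟩ : ∃ δ > 0,
      δ * √((sqMeasure μ).real (K ×ˢ K : Set (G × G))) < ε := by
    refine ⟨ε / (√((sqMeasure μ).real (K ×ˢ K : Set (G × G))) + 1), by positivity, ?_⟩
    rw [div_mul_eq_mul_div, div_lt_iff₀ (by positivity)]
    linarith
  have hunif : ∀ᶠ t in 𝓝 (1 : G), ∀ x ∈ K ×ˢ K, ‖(KernelC.dual t k - k) x.1 x.2‖ < δ := by
    refine (hK.prod hK).eventually_forall_of_forall_eventually fun x _ => ?_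
    refine hcont.continuousAt.eventually_lt continuousAt_const ?_
    rw [KernelC.dual_one, sub_self, KernelC.zero_apply, norm_zero]
    exact hδ
  filter_upwards [hunif, hN1] with t ht htN
  rw [dist_eq_norm, ← map_sub]
  refine (KernelC.norm_toAlg_le_l2norm _).trans_lt ((KernelC.l2norm_le (K := (K ×ˢ K : Set (G × G)))
    (hK.prod hK) (hsupp t htN)
    hδ.le fun s r => ?_).trans_lt hδε)
  by_cases hsr : (s, r) ∈ K ×ˢ K
  · exact (ht _ hsr).le
  · rw [hsupp t htN s r hsr, norm_zero]; exact hδ.le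

/-- The dual action is strongly continuous. -/
theorem continuous_dualAction (x : KernelAlg A μ) :
    Continuous fun t => dualAction A μ t x := by
  have h1 : Tendsto (fun t => dualAction A μ t x) (𝓝 1) (𝓝 x) := by
    refine Metric.tendsto_nhds.2 fun ε hε => ?_
    obtain ⟨k, hk⟩ := KernelC.denseRange_toAlg.exists_dist_lt x (by positivity : 0 < ε / 3)
    filter_upwards [Metric.tendsto_nhds.1 (tendsto_toAlg_dual k) (ε / 3) (by positivity)]
      with t ht
    have h2 : dist (dualAction A μ t x) (dualAction A μ t k.toAlg) < ε / 3 := by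
      rw [dist_eq_norm, ← map_sub]
      exact (NonUnitalStarAlgHom.norm_apply_le _ _).trans_lt (by rwa [← dist_eq_norm])
    have e : dualAction A μ t k.toAlg = (KernelC.dual t k).toAlg := dualHom_toAlg t k
    rw [e] at h2
    have h3 := dist_triangle4 (dualAction A μ t x) (KernelC.dual t k).toAlg k.toAlg x
    rw [dist_comm k.toAlg x] at h3
    linarith
  refine continuous_iff_continuousAt.2 fun t₀ => ?_
  have h2 : Tendsto (fun t => t₀⁻¹ * t) (𝓝 t₀) (𝓝 1) := by
    have : Continuous fun t => t₀⁻¹ * t := by fun_prop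
    simpa using this.tendsto t₀
  have h3 := ((continuous_dualHom (A := A) (μ := μ) t₀).tendsto x).comp (h1.comp h2)
  have e : ∀ t, dualHom t₀ (dualAction A μ (t₀⁻¹ * t) x) = dualAction A μ t x := fun t => by
    change (dualAction A μ t₀ * dualAction A μ (t₀⁻¹ * t)) x = _
    rw [← map_mul, mul_inv_cancel_left]
  have e' : dualHom t₀ x = dualAction A μ t₀ x := rfl
  rw [e'] at h3
  exact h3.congr e

end Dual

end FellBundle

namespace FellBundle

open BanachBundle

/-! ### Borel isomorphisms of kernel bundles -/

section BorelIso

variable {G : Type u} [Group G] [TopologicalSpace G] [IsTopologicalGroup G]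

/-- The function `u` on `G` regularizes the family of fibre maps `θ`: multiplication by
`u ⊗ ū` turns `θ` into a map which preserves continuity of sections. -/
def Regularizes {A B : FellBundle G} (θ : ∀ g h : G, A.Fib (g * h⁻¹) → B.Fib (g * h⁻¹))
    (u : G → ℂ) : Prop :=
  ∀ k : ∀ g h : G, A.Fib (g * h⁻¹),
    IsContSec (ν := fun x : G × G => x.1 * x.2⁻¹) (fun x => k x.1 x.2) →
    IsContSec (ν := fun x : G × G => x.1 * x.2⁻¹)
      (fun x => (u x.1 * starRingEnd ℂ (u x.2)) • θ x.1 x.2 (k x.1 x.2))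

variable [MeasurableSpace G]

/-- The sequence `u` is bounded by `1`, converges to `1` almost everywhere on `C`, and regularizes
the isomorphisms `θ` as well as, after conjugation, their inverses. -/
structure IsRegularizer {A B : FellBundle G}
    (θ : ∀ g h : G, A.Fib (g * h⁻¹) ≃ₗᵢ[ℂ] B.Fib (g * h⁻¹)) (μ : Measure G) (C : Set G)
    (u : ℕ → G → ℂ) : Prop where
  measurable : ∀ n, Measurable (u n)
  norm_le : ∀ n g, ‖u n g‖ ≤ 1
  tendsto : ∀ᵐ g ∂μ, g ∈ C → Tendsto (fun n => u n g) atTop (𝓝 1)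
  reg : ∀ n, Regularizes (fun g h => θ g h) (u n)
  reg_symm : ∀ n, Regularizes (fun g h => (θ g h).symm) (fun g => starRingEnd ℂ (u n g))

/-- A Borel isomorphism between the bundles of kernels of two Fell bundles: isometric isomorphisms
`A_{gh⁻¹} ≃ B_{gh⁻¹}`, possibly discontinuous in `(g, h)`, which are compatible with the products
and involutions of kernels, and which over each compact set are almost everywhere limits of
continuous bundle maps of the form `u(g) conj(u(h)) θ_{g,h}`. -/
structure BorelIso (A B : FellBundle G) (μ : Measure G) where
  θ : ∀ g h : G, A.Fib (g * h⁻¹) ≃ₗᵢ[ℂ] B.Fib (g * h⁻¹)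
  map_fmul : ∀ (s r t : G) (a : A.Fib (s * r⁻¹)) (b : A.Fib (r * t⁻¹)),
    θ s t (fmul (KernelC.mul_aux s r t) a b) = fmul (KernelC.mul_aux s r t) (θ s r a) (θ r t b)
  map_fstar : ∀ (s t : G) (a : A.Fib (t * s⁻¹)),
    θ s t (fstar (KernelC.star_aux s t) a) = fstar (KernelC.star_aux s t) (θ t s a)
  exists_regularizer : ∀ C : Set G, IsCompact C → ∃ u : ℕ → G → ℂ, IsRegularizer θ μ C u

variable {A B : FellBundle G} {μ : Measure G}

namespace BorelIso

/-- The inverse of a Borel isomorphism. -/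
def symm (T : BorelIso A B μ) : BorelIso B A μ where
  θ g h := (T.θ g h).symm
  map_fmul s r t a b := by
    rw [LinearIsometryEquiv.symm_apply_eq, T.map_fmul, LinearIsometryEquiv.apply_symm_apply,
      LinearIsometryEquiv.apply_symm_apply]
  map_fstar s t a := by
    rw [LinearIsometryEquiv.symm_apply_eq, T.map_fstar, LinearIsometryEquiv.apply_symm_apply]
  exists_regularizer C hC := by
    obtain ⟨u, hu⟩ := T.exists_regularizer C hC
    refine ⟨fun n g => starRingEnd ℂ (u n g),
      fun n => Complex.continuous_conj.measurable.comp (hu.measurable n),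
      fun n g => by rw [RCLike.norm_conj]; exact hu.norm_le n g, ?_, hu.reg_symm, fun n => ?_⟩
    · filter_upwards [hu.tendsto] with g hg hgC
      simpa [Function.comp_def] using (Complex.continuous_conj.tendsto _).comp (hg hgC)
    · simp only [Complex.conj_conj, LinearIsometryEquiv.symm_symm]
      exact hu.reg n

/-- The continuous kernel `u(g) conj(u(h)) θ_{g,h}(k(g,h))`. -/
def smooth (T : BorelIso A B μ) {u : G → ℂ} (hu : Regularizes (fun g h => T.θ g h) u)
    (k : KernelC A μ) : KernelC B μ :=
  KernelC.ofFun (fun g h => (u g * starRingEnd ℂ (u h)) • T.θ g h (k g h)) (hu k k.cont) (by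
    obtain ⟨K, hK, h⟩ := k.2.2
    exact ⟨K, hK, fun s t hst => by rw [h s t hst, map_zero, smul_zero]⟩)

theorem smooth_apply (T : BorelIso A B μ) {u : G → ℂ} (hu : Regularizes (fun g h => T.θ g h) u)
    (k : KernelC A μ) (g h : G) :
    T.smooth hu k g h = (u g * starRingEnd ℂ (u h)) • T.θ g h (k g h) := rfl

theorem smooth_add (T : BorelIso A B μ) {u : G → ℂ} (hu : Regularizes (fun g h => T.θ g h) u)
    (k l : KernelC A μ) : T.smooth hu (k + l) = T.smooth hu k + T.smooth hu l :=
  KernelC.ext fun g h => by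
    rw [KernelC.add_apply, smooth_apply, smooth_apply, smooth_apply, KernelC.add_apply, map_add,
      smul_add]

theorem smooth_smul (T : BorelIso A B μ) {u : G → ℂ} (hu : Regularizes (fun g h => T.θ g h) u)
    (c : ℂ) (k : KernelC A μ) : T.smooth hu (c • k) = c • T.smooth hu k :=
  KernelC.ext fun g h => by
    rw [KernelC.smul_apply, smooth_apply, smooth_apply, KernelC.smul_apply, map_smul, smul_comm]

theorem smooth_star (T : BorelIso A B μ) {u : G → ℂ} (hu : Regularizes (fun g h => T.θ g h) u)
    (k : KernelC A μ) : T.smooth hu (star k) = star (T.smooth hu k) :=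
  KernelC.ext fun g h => by
    rw [KernelC.star_apply, smooth_apply, smooth_apply, KernelC.star_apply, T.map_fstar, fstar_smul,
      map_mul, Complex.conj_conj, mul_comm]

theorem norm_smooth_le (T : BorelIso A B μ) {u : G → ℂ}
    (hu : Regularizes (fun g h => T.θ g h) u) (hu1 : ∀ g, ‖u g‖ ≤ 1) (k : KernelC A μ) (g h : G) :
    ‖T.smooth hu k g h‖ ≤ ‖k g h‖ := by
  rw [smooth_apply, norm_smul, LinearIsometryEquiv.norm_map, norm_mul, RCLike.norm_conj]
  exact mul_le_of_le_one_left (norm_nonneg _) (mul_le_one₀ (hu1 g) (norm_nonneg _) (hu1 h))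

end BorelIso

variable [T2Space G] [LocallyCompactSpace G] [BorelSpace G] [IsFiniteMeasureOnCompacts μ]

theorem KernelC.exists_compact_support (k : KernelC A μ) :
    ∃ C : Set G, IsCompact C ∧ ∀ s t, ¬ (s ∈ C ∧ t ∈ C) → k s t = 0 := by
  obtain ⟨C, hC, h1, h2⟩ := k.exists_box
  refine ⟨C, hC, fun s t h => ?_⟩
  by_cases hs : s ∈ C
  · exact h2 _ _ fun ht => h ⟨hs, ht⟩
  · exact h1 _ _ hs

theorem KernelC.exists_norm_le (k : KernelC A μ) : ∃ M : ℝ, 0 ≤ M ∧ ∀ s t, ‖k s t‖ ≤ M := by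
  obtain ⟨M, hM⟩ := (KernelB.ofKernelC k).bounded
  exact ⟨M, (norm_nonneg _).trans (hM 1 1), hM⟩

theorem enorm_add_sq_le {E : Type*} [SeminormedAddCommGroup E] (a b : E) :
    ‖a + b‖ₑ ^ 2 ≤ 2 * ‖a‖ₑ ^ 2 + 2 * ‖b‖ₑ ^ 2 := by
  have h : ‖a + b‖ ^ 2 ≤ 2 * ‖a‖ ^ 2 + 2 * ‖b‖ ^ 2 := by
    rw [← mul_add]
    exact (pow_le_pow_left₀ (norm_nonneg _) (norm_add_le a b) 2).trans add_sq_le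
  have h2 := ENNReal.ofReal_le_ofReal h
  rw [ENNReal.ofReal_add (by positivity) (by positivity), ENNReal.ofReal_mul zero_le_two,
    ENNReal.ofReal_mul zero_le_two, ENNReal.ofReal_pow (norm_nonneg _),
    ENNReal.ofReal_pow (norm_nonneg _), ENNReal.ofReal_pow (norm_nonneg _), ofReal_norm,
    ofReal_norm, ofReal_norm, ENNReal.ofReal_ofNat] at h2
  exact h2

namespace BorelIso

variable (T : BorelIso A B μ)

theorem l2norm_smooth_le {u : G → ℂ} (hu : Regularizes (fun g h => T.θ g h) u)
    (hu1 : ∀ g, ‖u g‖ ≤ 1) (k : KernelC A μ) : (T.smooth hu k).l2norm ≤ k.l2norm := by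
  refine Real.sqrt_le_sqrt (integral_mono ?_ ?_ fun x => ?_)
  · exact (T.smooth hu k).normSq.continuous.integrable_of_hasCompactSupport
      (T.smooth hu k).normSq.hasCompactSupport
  · exact k.normSq.continuous.integrable_of_hasCompactSupport k.normSq.hasCompactSupport
  · exact pow_le_pow_left₀ (norm_nonneg _) (T.norm_smooth_le hu hu1 k x.1 x.2) 2

/-- Regularized products: up to an error which vanishes in the limit, `smooth` is multiplicative,
because `|u_n|² → 1` in the convolution integral. -/
theorem tendsto_smooth_mul {C : Set G} (hC : IsCompact C) {u : ℕ → G → ℂ}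
    (hu : IsRegularizer T.θ μ C u) {k l : KernelC A μ}
    (hk : ∀ s t, ¬ (s ∈ C ∧ t ∈ C) → k s t = 0) (hl : ∀ s t, ¬ (s ∈ C ∧ t ∈ C) → l s t = 0) :
    Tendsto (fun n => (T.smooth (hu.reg n) k * T.smooth (hu.reg n) l -
      T.smooth (hu.reg n) (k * l)).toAlg) atTop (𝓝 0) := by
  obtain ⟨M, hM0, hM⟩ := k.exists_norm_le
  obtain ⟨L, hL0, hL⟩ := l.exists_norm_le
  -- the factor `conj(u_n(r)) u_n(r)` produced by the two inner phases of the convolution, minus `1`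
  let c : ℕ → G → ℂ := fun n r => starRingEnd ℂ (u n r) * u n r - 1
  have hcm : ∀ n, Measurable (c n) := fun n =>
    ((Complex.continuous_conj.measurable.comp (hu.measurable n)).mul (hu.measurable n)).sub_const 1
  have hc2 : ∀ n r, ‖c n r‖ ≤ 2 := fun n r => by
    refine (norm_sub_le _ _).trans ?_
    rw [norm_mul, RCLike.norm_conj, norm_one]
    have := mul_le_one₀ (hu.norm_le n r) (norm_nonneg _) (hu.norm_le n r)
    linarith
  have hci : ∀ n, IntegrableOn (fun r => ‖c n r‖) C μ := fun n =>
    Measure.integrableOn_of_bounded (M := 2) hC.measure_lt_top.ne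
      (hcm n).norm.aestronglyMeasurable (Eventually.of_forall fun r => by simpa using hc2 n r)
  have hε : Tendsto (fun n => ∫ r in C, ‖c n r‖ ∂μ) atTop (𝓝 0) := by
    have h := tendsto_integral_of_dominated_convergence (μ := μ.restrict C)
      (F := fun n r => ‖c n r‖) (f := fun _ => 0) (fun _ => (2 : ℝ))
      (fun n => (hcm n).norm.aestronglyMeasurable) (integrableOn_const hC.measure_lt_top.ne)
      (fun n => Eventually.of_forall fun r => by simpa using hc2 n r) (by
        rw [ae_restrict_iff' hC.measurableSet]
        filter_upwards [hu.tendsto] with r hr hrC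
        have h1 := (((Complex.continuous_conj.tendsto _).comp (hr hrC)).mul (hr hrC)).sub_const 1
        simpa [c] using h1.norm)
    simpa using h
  have hbound : ∀ n, ‖(T.smooth (hu.reg n) k * T.smooth (hu.reg n) l -
      T.smooth (hu.reg n) (k * l)).toAlg‖ ≤ (M * L * ∫ r in C, ‖c n r‖ ∂μ) *
        √((sqMeasure μ).real (C ×ˢ C : Set (G × G))) := by
    intro n
    refine (KernelC.norm_toAlg_le_l2norm _).trans (KernelC.l2norm_le (K := (C ×ˢ C : Set (G × G)))
      (hC.prod hC) ?_ (by positivity) ?_)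
    · intro s t hst
      have h1 : ∀ r, fmul (KernelC.mul_aux s r t) (k s r) (l r t) = 0 := fun r => by
        by_cases hs : s ∈ C
        · rw [hl r t fun h => hst ⟨hs, h.2⟩, KernelC.fmul_zero']
        · rw [hk s r fun h => hs h.1, KernelC.zero_fmul']
      have h2 : ∀ r, fmul (KernelC.mul_aux s r t) (T.smooth (hu.reg n) k s r)
          (T.smooth (hu.reg n) l r t) = 0 := fun r => by
        rw [smooth_apply, smooth_apply, smul_fmul, fmul_smul, ← T.map_fmul, h1, map_zero,
          smul_zero, smul_zero]
      rw [KernelC.sub_apply, KernelC.mul_apply, smooth_apply, KernelC.mul_apply]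
      simp only [h1, h2, integral_zero, map_zero, smul_zero, sub_zero]
    · intro s t
      have e : (T.smooth (hu.reg n) (k * l)) s t = ∫ r, (u n s * starRingEnd ℂ (u n t)) •
          T.θ s t (fmul (KernelC.mul_aux s r t) (k s r) (l r t)) ∂μ := by
        rw [smooth_apply, KernelC.mul_apply, integral_smul]
        congr 1
        exact ((T.θ s t).toContinuousLinearEquiv.toContinuousLinearMap.integral_comp_comm
          (KernelC.integrable_integrand k l s t)).symm
      have hi : Integrable (fun r => (u n s * starRingEnd ℂ (u n t)) •
          T.θ s t (fmul (KernelC.mul_aux s r t) (k s r) (l r t))) μ :=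
        ((T.θ s t).toContinuousLinearEquiv.toContinuousLinearMap.integrable_comp
          (KernelC.integrable_integrand k l s t)).smul _
      rw [KernelC.sub_apply, e, KernelC.mul_apply,
        ← integral_sub (KernelC.integrable_integrand _ _ s t) hi, ← integral_const_mul,
        ← integral_indicator hC.measurableSet]
      refine norm_integral_le_of_norm_le
        ((integrable_indicator_iff hC.measurableSet).2 ((hci n).const_mul _))
        (Eventually.of_forall fun r => ?_)
      have e2 : fmul (KernelC.mul_aux s r t) (T.smooth (hu.reg n) k s r)
          (T.smooth (hu.reg n) l r t) - (u n s * starRingEnd ℂ (u n t)) •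
          T.θ s t (fmul (KernelC.mul_aux s r t) (k s r) (l r t)) =
          (u n s * starRingEnd ℂ (u n t) * c n r) •
            T.θ s t (fmul (KernelC.mul_aux s r t) (k s r) (l r t)) := by
        rw [smooth_apply, smooth_apply, smul_fmul, fmul_smul, ← T.map_fmul, smul_smul, ← sub_smul]
        congr 1
        simp only [c]
        ring
      rw [e2, norm_smul, LinearIsometryEquiv.norm_map]
      by_cases hr : r ∈ C
      · rw [Set.indicator_of_mem hr, norm_mul, norm_mul, RCLike.norm_conj]
        have h1 := mul_le_one₀ (hu.norm_le n s) (norm_nonneg _) (hu.norm_le n t)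
        calc ‖u n s‖ * ‖u n t‖ * ‖c n r‖ * ‖fmul (KernelC.mul_aux s r t) (k s r) (l r t)‖
            ≤ 1 * ‖c n r‖ * (M * L) := by
              gcongr
              exact (norm_fmul_le _ _ _).trans
                (mul_le_mul (hM s r) (hL r t) (norm_nonneg _) hM0)
          _ = M * L * ‖c n r‖ := by ring
      · rw [Set.indicator_of_notMem hr, hk s r fun h => hr h.2, KernelC.zero_fmul', norm_zero,
          mul_zero]
  refine squeeze_zero_norm hbound ?_
  have := (hε.const_mul (M * L)).mul_const (√((sqMeasure μ).real (C ×ˢ C : Set (G × G))))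
  simpa using this

variable [μ.OuterRegular]

/-- The map `k_b(A) → k_b(B)` induced by a Borel isomorphism. The image of `k` is measurable because
regularized continuous sections are continuous and converge almost everywhere. -/
def mapB (k : KernelB A μ) : KernelB B μ where
  toFun g h := T.θ g h (k g h)
  bounded := by
    obtain ⟨M, hM⟩ := k.bounded
    exact ⟨M, fun s t => by rw [LinearIsometryEquiv.norm_map]; exact hM s t⟩
  compactSupport := by
    obtain ⟨K, hK, h⟩ := k.compactSupport
    exact ⟨K, hK, fun s t hst => by rw [h s t hst, map_zero]⟩
  measurable K hK := by
    obtain ⟨ξ, hξ, hlim⟩ := k.measurable K hK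
    let C : Set G := Prod.fst '' (K : Set (G × G)) ∪ Prod.snd '' (K : Set (G × G))
    have hC : IsCompact C := (IsCompact.image (X := G × G) hK continuous_fst).union
      (IsCompact.image (X := G × G) hK continuous_snd)
    obtain ⟨u, hu⟩ := T.exists_regularizer C hC
    refine ⟨fun n g h => (u n g * starRingEnd ℂ (u n h)) • T.θ g h (ξ n g h),
      fun n => hu.reg n _ (hξ n), ?_⟩
    filter_upwards [hlim, ae_sqMeasure_of_ae μ hu.tendsto hK] with x hx hux hxK
    have h1 := (hux hxK).1 (Or.inl ⟨x, hxK, rfl⟩)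
    have h2 := (hux hxK).2 (Or.inr ⟨x, hxK, rfl⟩)
    have h3 := (h1.mul ((Complex.continuous_conj.tendsto _).comp h2)).smul
      (((T.θ x.1 x.2).continuous.tendsto _).comp (hx hxK))
    simpa using h3

theorem mapB_apply (k : KernelB A μ) (g h : G) : T.mapB k g h = T.θ g h (k g h) := rfl

theorem mapB_symm_mapB (k : KernelB A μ) : T.symm.mapB (T.mapB k) = k :=
  KernelB.ext fun g h => (T.θ g h).symm_apply_apply _

/-- By dominated convergence, the regularizations of `k ∈ k_c(A)` converge to its image in `k_b(B)`
with respect to `‖·‖₂`. -/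
theorem tendsto_distSq_smooth {C : Set G} (hC : IsCompact C) {u : ℕ → G → ℂ}
    (hu : IsRegularizer T.θ μ C u) {k : KernelC A μ}
    (hk : ∀ s t, ¬ (s ∈ C ∧ t ∈ C) → k s t = 0) :
    Tendsto (fun n => (T.mapB (KernelB.ofKernelC k)).distSq (T.smooth (hu.reg n) k)) atTop
      (𝓝 0) := by
  have hzero : (0 : ENNReal) = ∫⁻ _ : Sq G, 0 ∂sqMeasure μ := by simp
  have hi : Integrable (fun x : Sq G => ‖k x.1 x.2‖ ^ 2) (sqMeasure μ) :=
    k.normSq.continuous.integrable_of_hasCompactSupport k.normSq.hasCompactSupport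
  rw [hzero]
  refine tendsto_lintegral_of_dominated_convergence'
    (fun x : Sq G => ENNReal.ofReal (4 * ‖k x.1 x.2‖ ^ 2))
    (fun n => KernelB.aemeasurable_sub _ _) (fun n => Eventually.of_forall fun x => ?_)
    (hi.const_mul 4).lintegral_lt_top.ne ?_
  · change ‖T.θ x.1 x.2 (k x.1 x.2) - T.smooth (hu.reg n) k x.1 x.2‖ₑ ^ 2 ≤ _
    rw [← ofReal_norm, ← ENNReal.ofReal_pow (norm_nonneg _)]
    refine ENNReal.ofReal_le_ofReal ?_
    have h1 := norm_sub_le (T.θ x.1 x.2 (k x.1 x.2)) (T.smooth (hu.reg n) k x.1 x.2)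
    have h2 := T.norm_smooth_le (hu.reg n) (hu.norm_le n) k x.1 x.2
    rw [LinearIsometryEquiv.norm_map] at h1
    calc _ ≤ (2 * ‖k x.1 x.2‖) ^ 2 := pow_le_pow_left₀ (norm_nonneg _) (by linarith) 2
      _ = 4 * ‖k x.1 x.2‖ ^ 2 := by ring
  · filter_upwards [ae_sqMeasure_of_ae μ hu.tendsto
      (K := (C ×ˢ C : Set (G × G))) (hC.prod hC)] with x hx
    change Tendsto (fun n => ‖T.θ x.1 x.2 (k x.1 x.2) - (u n x.1 * starRingEnd ℂ (u n x.2)) •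
      T.θ x.1 x.2 (k x.1 x.2)‖ₑ ^ 2) atTop (𝓝 0)
    by_cases hxC : x.1 ∈ C ∧ x.2 ∈ C
    · have h0 := hx hxC
      have h1 := ((h0.1 hxC.1).mul
        ((Complex.continuous_conj.tendsto _).comp (h0.2 hxC.2))).smul_const
          (T.θ x.1 x.2 (k x.1 x.2))
      have h2 := ENNReal.Tendsto.pow (n := 2)
        ((tendsto_const_nhds (x := T.θ x.1 x.2 (k x.1 x.2))).sub h1).enorm
      simpa using h2
    · rw [hk _ _ hxC]
      simp

theorem tendsto_toAlg_smooth {C : Set G} (hC : IsCompact C) {u : ℕ → G → ℂ}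
    (hu : IsRegularizer T.θ μ C u) {k : KernelC A μ}
    (hk : ∀ s t, ¬ (s ∈ C ∧ t ∈ C) → k s t = 0) :
    Tendsto (fun n => (T.smooth (hu.reg n) k).toAlg) atTop
      (𝓝 (T.mapB (KernelB.ofKernelC k)).toAlg) :=
  KernelB.tendsto_toAlg_of_distSq (T.tendsto_distSq_smooth hC hu hk)

/-- Any two continuous kernels have a common regularizer over a compact set that carries both. -/
theorem exists_regularizer_pair (k l : KernelC A μ) : ∃ C : Set G, IsCompact C ∧
    (∃ u, IsRegularizer T.θ μ C u) ∧ (∀ s t, ¬ (s ∈ C ∧ t ∈ C) → k s t = 0) ∧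
    ∀ s t, ¬ (s ∈ C ∧ t ∈ C) → l s t = 0 := by
  obtain ⟨C, hC, hk⟩ := k.exists_compact_support
  obtain ⟨D, hD, hl⟩ := l.exists_compact_support
  exact ⟨C ∪ D, hC.union hD, T.exists_regularizer _ (hC.union hD),
    fun s t h => hk s t fun h' => h ⟨Or.inl h'.1, Or.inl h'.2⟩,
    fun s t h => hl s t fun h' => h ⟨Or.inr h'.1, Or.inr h'.2⟩⟩

/-- The `*`-homomorphism `k_c(A) → 𝕂(B)` induced by a Borel isomorphism. Its algebraic properties are
limits of those of the regularizations. -/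
def mapC : KernelC A μ →⋆ₙₐ[ℂ] KernelAlg B μ where
  toFun k := (T.mapB (KernelB.ofKernelC k)).toAlg
  map_smul' c k := by
    obtain ⟨C, hC, ⟨u, hu⟩, hk, -⟩ := T.exists_regularizer_pair k k
    have hck : ∀ s t, ¬ (s ∈ C ∧ t ∈ C) → (c • k) s t = 0 := fun s t h => by
      rw [KernelC.smul_apply, hk s t h, smul_zero]
    refine tendsto_nhds_unique (T.tendsto_toAlg_smooth hC hu hck) ?_
    refine ((T.tendsto_toAlg_smooth hC hu hk).const_smul c).congr fun n => ?_
    rw [smooth_smul, map_smul]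
  map_zero' := by
    rw [← map_zero (KernelC.toAlg : KernelC B μ →⋆ₙₐ[ℂ] KernelAlg B μ),
      ← KernelB.toAlg_ofKernelC]
    exact congrArg _ (KernelB.ext fun g h => (T.θ g h).map_zero)
  map_add' k l := by
    obtain ⟨C, hC, ⟨u, hu⟩, hk, hl⟩ := T.exists_regularizer_pair k l
    have hkl : ∀ s t, ¬ (s ∈ C ∧ t ∈ C) → (k + l) s t = 0 := fun s t h => by
      rw [KernelC.add_apply, hk s t h, hl s t h, add_zero]
    refine tendsto_nhds_unique (T.tendsto_toAlg_smooth hC hu hkl) ?_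
    refine ((T.tendsto_toAlg_smooth hC hu hk).add (T.tendsto_toAlg_smooth hC hu hl)).congr
      fun n => ?_
    rw [smooth_add, map_add]
  map_mul' k l := by
    obtain ⟨C, hC, ⟨u, hu⟩, hk, hl⟩ := T.exists_regularizer_pair k l
    have hkl : ∀ s t, ¬ (s ∈ C ∧ t ∈ C) → (k * l) s t = 0 := fun s t h => by
      rw [KernelC.mul_apply]
      refine integral_eq_zero_of_ae (Eventually.of_forall fun r => ?_)
      change fmul _ _ _ = 0
      by_cases hs : s ∈ C
      · rw [hl r t fun h' => h ⟨hs, h'.2⟩, KernelC.fmul_zero']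
      · rw [hk s r fun h' => hs h'.1, KernelC.zero_fmul']
    have h1 := ((T.tendsto_toAlg_smooth hC hu hk).mul (T.tendsto_toAlg_smooth hC hu hl)).sub
      (T.tendsto_toAlg_smooth hC hu hkl)
    have h2 := (T.tendsto_smooth_mul hC hu hk hl).congr fun n => by rw [map_sub, map_mul]
    exact (sub_eq_zero.1 (tendsto_nhds_unique h1 h2)).symm
  map_star' k := by
    obtain ⟨C, hC, ⟨u, hu⟩, hk, -⟩ := T.exists_regularizer_pair k k
    have hks : ∀ s t, ¬ (s ∈ C ∧ t ∈ C) → (star k) s t = 0 := fun s t h => by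
      rw [KernelC.star_apply, hk t s fun h' => h h'.symm]
      exact (fstarL (A := A) (KernelC.star_aux s t)).map_zero
    refine tendsto_nhds_unique (T.tendsto_toAlg_smooth hC hu hks) ?_
    refine ((T.tendsto_toAlg_smooth hC hu hk).star).congr fun n => ?_
    rw [smooth_star, map_star]

theorem norm_mapC_le (k : KernelC A μ) : ‖T.mapC k‖ ≤ k.l2norm := by
  obtain ⟨C, hC, ⟨u, hu⟩, hk, -⟩ := T.exists_regularizer_pair k k
  exact le_of_tendsto' (T.tendsto_toAlg_smooth hC hu hk).norm fun n =>
    (KernelC.norm_toAlg_le_l2norm _).trans (T.l2norm_smooth_le (hu.reg n) (hu.norm_le n) k)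

/-- The `*`-homomorphism `𝕂(A) → 𝕂(B)` induced by a Borel isomorphism. -/
def mapAlg : KernelAlg A μ →⋆ₙₐ[ℂ] KernelAlg B μ := KernelAlg.lift T.mapC T.norm_mapC_le

theorem continuous_mapAlg : Continuous T.mapAlg :=
  AddMonoidHomClass.continuous_of_bound T.mapAlg 1 fun x => by
    rw [one_mul]; exact NonUnitalStarAlgHom.norm_apply_le _ _

theorem mapAlg_toAlg (k : KernelC A μ) :
    T.mapAlg k.toAlg = (T.mapB (KernelB.ofKernelC k)).toAlg :=
  KernelAlg.lift_toAlg T.mapC T.norm_mapC_le k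

theorem distSq_mapB_le (k : KernelB A μ) (l : KernelC A μ) (m : KernelC B μ) :
    (T.mapB k).distSq m ≤ 2 * k.distSq l + 2 * (T.mapB (KernelB.ofKernelC l)).distSq m := by
  have h1 := (k.aemeasurable_sub l).const_mul 2
  rw [KernelB.distSq, KernelB.distSq, KernelB.distSq, ← lintegral_const_mul' _ _ (by simp),
    ← lintegral_const_mul' _ _ (by simp), ← lintegral_add_left' h1]
  refine lintegral_mono fun x => ?_
  have e : T.mapB k x.1 x.2 - m x.1 x.2 = T.θ x.1 x.2 (k x.1 x.2 - l x.1 x.2) +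
      (T.mapB (KernelB.ofKernelC l) x.1 x.2 - m x.1 x.2) := by
    rw [map_sub, mapB_apply, mapB_apply]
    exact (sub_add_sub_cancel _ _ _).symm
  change ‖T.mapB k x.1 x.2 - m x.1 x.2‖ₑ ^ 2 ≤ _
  rw [e]
  refine (enorm_add_sq_le _ _).trans_eq ?_
  rw [LinearIsometryEquiv.enorm_map]

/-- On bounded measurable kernels, the induced map is still given pointwise by `θ`. Both sides are
compared with the regularizations of continuous kernels close to `k`. -/
theorem mapAlg_toAlg_kernelB (k : KernelB A μ) : T.mapAlg k.toAlg = (T.mapB k).toAlg := by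
  refine k.map_toAlg_eq T.continuous_mapAlg _ (c := 4) (by simp) fun l => ?_
  obtain ⟨C, hC, ⟨u, hu⟩, hl, -⟩ := T.exists_regularizer_pair l l
  have h1 : Tendsto (fun n => ENNReal.ofReal
      (‖(T.smooth (hu.reg n) l).toAlg - (T.mapB k).toAlg‖ ^ 2)) atTop
      (𝓝 (ENNReal.ofReal (‖T.mapAlg l.toAlg - (T.mapB k).toAlg‖ ^ 2))) := by
    rw [mapAlg_toAlg]
    exact (ENNReal.continuous_ofReal.tendsto _).comp
      ((((T.tendsto_toAlg_smooth hC hu hl).sub_const _).norm).pow 2)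
  have h2 : Tendsto (fun n => 2 * (2 * k.distSq l +
      2 * (T.mapB (KernelB.ofKernelC l)).distSq (T.smooth (hu.reg n) l))) atTop
      (𝓝 (2 * (2 * k.distSq l + 2 * 0))) :=
    ENNReal.Tendsto.const_mul (tendsto_const_nhds.add (ENNReal.Tendsto.const_mul
      (T.tendsto_distSq_smooth hC hu hl) (Or.inr (by simp)))) (Or.inr (by simp))
  have h3 : (2 : ENNReal) * (2 * k.distSq l + 2 * 0) = 4 * k.distSq l := by
    rw [mul_zero, add_zero, ← mul_assoc]
    norm_num
  rw [h3] at h2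
  refine le_of_tendsto_of_tendsto' h1 h2 fun n => ?_
  rw [norm_sub_rev]
  exact ((T.mapB k).norm_toAlg_sub_sq_le _).trans
    (mul_le_mul_right (T.distSq_mapB_le k l _) 2)

theorem mapAlg_symm_mapAlg (x : KernelAlg A μ) : T.symm.mapAlg (T.mapAlg x) = x :=
  KernelAlg.induction (P := fun x => T.symm.mapAlg (T.mapAlg x) = x)
    (isClosed_eq (T.symm.continuous_mapAlg.comp T.continuous_mapAlg) continuous_id)
    (fun k => by
      rw [mapAlg_toAlg, mapAlg_toAlg_kernelB, mapB_symm_mapB, KernelB.toAlg_ofKernelC]) x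

/-- The `*`-isomorphism `𝕂(A) ≃ 𝕂(B)` induced by a Borel isomorphism. -/
def algEquiv : KernelAlg A μ ≃⋆ₐ[ℂ] KernelAlg B μ where
  toFun := T.mapAlg
  invFun := T.symm.mapAlg
  left_inv := T.mapAlg_symm_mapAlg
  right_inv := T.symm.mapAlg_symm_mapAlg
  map_mul' := map_mul T.mapAlg
  map_add' := map_add T.mapAlg
  map_smul' := map_smul T.mapAlg
  map_star' := map_star T.mapAlg

open ZeroAtInfty

theorem mapAlg_jC0_fst (f : C₀(G, ℂ)) (x : KernelAlg A μ) :
    T.mapAlg ((jC0 A μ f).fst x) = (jC0 B μ f).fst (T.mapAlg x) := by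
  refine KernelAlg.induction
    (P := fun x => T.mapAlg ((jC0 A μ f).fst x) = (jC0 B μ f).fst (T.mapAlg x))
    (isClosed_eq (T.continuous_mapAlg.comp (jC0 A μ f).fst.continuous)
      ((jC0 B μ f).fst.continuous.comp T.continuous_mapAlg)) (fun k => ?_) x
  obtain ⟨C, hC, ⟨u, hu⟩, hk, -⟩ := T.exists_regularizer_pair k k
  have hfk : ∀ s t, ¬ (s ∈ C ∧ t ∈ C) → (KernelC.leftMul f.toContinuousMap k) s t = 0 :=
    fun s t h => by rw [KernelC.leftMul_apply, hk s t h, smul_zero]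
  have e : (jC0 A μ f).fst k.toAlg = (KernelC.leftMul f.toContinuousMap k).toAlg := jMul_fst f k
  rw [e, mapAlg_toAlg, mapAlg_toAlg]
  refine tendsto_nhds_unique (T.tendsto_toAlg_smooth hC hu hfk) ?_
  refine (((jC0 B μ f).fst.continuous.tendsto _).comp
    (T.tendsto_toAlg_smooth hC hu hk)).congr fun n => ?_
  refine (jMul_fst f _).trans (congrArg _ (KernelC.ext fun s t => ?_))
  rw [KernelC.leftMul_apply, smooth_apply, smooth_apply, KernelC.leftMul_apply, map_smul,
    smul_comm]

theorem mapAlg_jC0_snd (f : C₀(G, ℂ)) (x : KernelAlg A μ) :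
    T.mapAlg ((jC0 A μ f).snd x) = (jC0 B μ f).snd (T.mapAlg x) := by
  refine KernelAlg.induction
    (P := fun x => T.mapAlg ((jC0 A μ f).snd x) = (jC0 B μ f).snd (T.mapAlg x))
    (isClosed_eq (T.continuous_mapAlg.comp (jC0 A μ f).snd.continuous)
      ((jC0 B μ f).snd.continuous.comp T.continuous_mapAlg)) (fun k => ?_) x
  obtain ⟨C, hC, ⟨u, hu⟩, hk, -⟩ := T.exists_regularizer_pair k k
  have hfk : ∀ s t, ¬ (s ∈ C ∧ t ∈ C) → (KernelC.rightMul f.toContinuousMap k) s t = 0 :=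
    fun s t h => by rw [KernelC.rightMul_apply, hk s t h, smul_zero]
  have e : (jC0 A μ f).snd k.toAlg = (KernelC.rightMul f.toContinuousMap k).toAlg := jMul_snd f k
  rw [e, mapAlg_toAlg, mapAlg_toAlg]
  refine tendsto_nhds_unique (T.tendsto_toAlg_smooth hC hu hfk) ?_
  refine (((jC0 B μ f).snd.continuous.tendsto _).comp
    (T.tendsto_toAlg_smooth hC hu hk)).congr fun n => ?_
  refine (jMul_snd f _).trans (congrArg _ (KernelC.ext fun s t => ?_))
  rw [KernelC.rightMul_apply, smooth_apply, smooth_apply, KernelC.rightMul_apply, map_smul,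
    smul_comm]

end BorelIso

end BorelIso

end FellBundle

/-! ### Density of continuous functions in `L^p` -/

/-- In a locally compact Hausdorff space, continuous functions are dense in `L^p`, `p < ∞`, for
every regular measure; unlike in `MemLp.exists_boundedContinuous_eLpNorm_sub_le`, the space need not be
normal. -/
theorem MeasureTheory.MemLp.exists_continuous_eLpNorm_sub_le_of_locallyCompact {X E : Type*}
    [TopologicalSpace X] [T2Space X] [LocallyCompactSpace X] [MeasurableSpace X] [BorelSpace X]
    [NormedAddCommGroup E] [NormedSpace ℝ E] {μ : Measure X} [μ.Regular] {p : ENNReal}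
    (hp : p ≠ ⊤) {f : X → E} (hf : MemLp f p μ) {ε : ENNReal} (hε : ε ≠ 0) :
    ∃ g : X → E, eLpNorm (f - g) p μ ≤ ε ∧ Continuous g ∧ AEStronglyMeasurable g μ := by
  refine hf.induction_dense hp (fun g => Continuous g ∧ AEStronglyMeasurable g μ) ?_
    (fun f g hf hg => ⟨hf.1.add hg.1, hf.2.add hg.2⟩) (fun f hf => hf.2) hε
  intro c t ht htμ ε hε
  obtain ⟨η, ηpos, hη⟩ := exists_eLpNorm_indicator_le (μ := μ) hp c hε
  have hη2 : (η : ENNReal) / 2 ≠ 0 := by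
    simpa using ηpos.ne'
  obtain ⟨s, hst, hsc, hscl, hs⟩ := ht.exists_isCompact_isClosed_sdiff_lt htμ.ne hη2
  obtain ⟨V, hsV, hVo, -, hV⟩ := hscl.measurableSet.exists_isOpen_sdiff_lt
    (hsc.measure_lt_top (μ := μ)).ne hη2
  obtain ⟨g, hg1, hg0, -, hg⟩ := exists_continuous_one_zero_of_isCompact hsc hVo.isClosed_compl
    (Set.disjoint_compl_right_iff_subset.2 hsV)
  refine ⟨fun x => g x • c, ?_, g.continuous.smul continuous_const,
    g.continuous.aestronglyMeasurable.smul_const c⟩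
  refine (eLpNorm_mono fun x => ?_).trans (hη ((V \ s) ∪ (t \ s)) ?_)
  · rw [Pi.sub_apply]
    by_cases hxs : x ∈ s
    · have h1 : g x = 1 := hg1 hxs
      rw [h1, one_smul, Set.indicator_of_mem (hst hxs), sub_self, norm_zero]
      exact norm_nonneg _
    · by_cases hx : x ∈ V ∪ t
      · have hmem : x ∈ (V \ s) ∪ (t \ s) := hx.imp (fun h => ⟨h, hxs⟩) (fun h => ⟨h, hxs⟩)
        rw [Set.indicator_of_mem hmem]
        by_cases hxt : x ∈ t
        · rw [Set.indicator_of_mem hxt]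
          have e : g x • c - c = (g x - 1) • c := by rw [sub_smul, one_smul]
          rw [e, norm_smul]
          refine mul_le_of_le_one_left (norm_nonneg _) ?_
          rw [Real.norm_eq_abs, abs_le]
          constructor <;> linarith [(hg x).1, (hg x).2]
        · rw [Set.indicator_of_notMem hxt, sub_zero, norm_smul]
          refine mul_le_of_le_one_left (norm_nonneg _) ?_
          rw [Real.norm_of_nonneg (hg x).1]
          exact (hg x).2
      · have h0 : g x = 0 := hg0 fun h => hx (Or.inl h)
        rw [h0, zero_smul, Set.indicator_of_notMem fun h => hx (Or.inr h), sub_zero, norm_zero]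
        exact norm_nonneg _
  · exact (measure_union_le _ _).trans ((add_le_add hV.le hs.le).trans_eq (ENNReal.add_halves _))

/-! ### Equivariant functions on a central extension -/

namespace Twist

section Equivariant

variable {G : Type u} [Group G] [TopologicalSpace G] {σ : Twist G}

/-- Equivariance `P(z x) = z P(x)` for `z ∈ 𝕋`: the function `P` is a section of the line bundle
associated with the circle bundle `q : σ.H → G`. -/
def IsEquivariant (P : σ.H → ℂ) : Prop := ∀ (z : Circle) (x : σ.H), P (σ.ι z * x) = z * P x

theorem IsEquivariant.norm_eq {P : σ.H → ℂ} (hP : IsEquivariant P) {x y : σ.H}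
    (h : σ.q y = σ.q x) : ‖P y‖ = ‖P x‖ := by
  obtain ⟨z, rfl⟩ := σ.exists_ι h
  rw [hP, norm_mul, Circle.norm_coe, one_mul]

/-- The radial retraction of an equivariant function to the unit disc. -/
theorem IsEquivariant.clip {P : σ.H → ℂ} (hP : IsEquivariant P) :
    IsEquivariant fun x => P x / (max 1 ‖P x‖ : ℝ) := fun z x => by
  have h : ‖P (σ.ι z * x)‖ = ‖P x‖ := by rw [hP, norm_mul, Circle.norm_coe, one_mul]
  change P (σ.ι z * x) / (max 1 ‖P (σ.ι z * x)‖ : ℝ) = z * (P x / (max 1 ‖P x‖ : ℝ))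
  rw [h, hP, mul_div_assoc]

theorem continuous_clip {X : Type*} [TopologicalSpace X] {P : X → ℂ} (hP : Continuous P) :
    Continuous fun x => P x / (max 1 ‖P x‖ : ℝ) := by
  refine hP.div (Complex.continuous_ofReal.comp (continuous_const.max hP.norm)) fun x => ?_
  exact Complex.ofReal_ne_zero.2 (zero_lt_one.trans_le (le_max_left _ _)).ne'

theorem norm_clip_le (w : ℂ) : ‖w / (max 1 ‖w‖ : ℝ)‖ ≤ 1 := by
  have h : (0 : ℝ) < max 1 ‖w‖ := zero_lt_one.trans_le (le_max_left _ _)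
  rw [norm_div, Complex.norm_real, Real.norm_of_nonneg h.le, div_le_one h]
  exact le_max_right _ _

theorem norm_clip_sub_one_le (w : ℂ) : ‖w / (max 1 ‖w‖ : ℝ) - 1‖ ≤ 2 * ‖w - 1‖ := by
  rcases le_total ‖w‖ 1 with h | h
  · rw [max_eq_left h, Complex.ofReal_one, div_one]
    linarith [norm_nonneg (w - 1)]
  · rw [max_eq_right h]
    have h0 : (‖w‖ : ℂ) ≠ 0 := Complex.ofReal_ne_zero.2 (zero_lt_one.trans_le h).ne'
    have e : w / (‖w‖ : ℝ) - 1 = (w - 1) - (w / (‖w‖ : ℝ)) * ((‖w‖ - 1 : ℝ) : ℂ) := by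
      push_cast
      field_simp
      ring
    have h1 : ‖w‖ - 1 ≤ ‖w - 1‖ := by simpa using norm_sub_norm_le w 1
    rw [e]
    refine (norm_sub_le _ _).trans ?_
    rw [norm_mul, norm_div, Complex.norm_real, Complex.norm_real, norm_norm,
      div_self (zero_lt_one.trans_le h).ne', one_mul, Real.norm_of_nonneg (sub_nonneg.2 h)]
    linarith

/-- There are enough continuous equivariant functions: average `z̄ f(z x)` over the circle, where `f`
is a bump function at `x₀` whose support meets the orbit of `x₀` only near `x₀`. This replaces the
local triviality of the circle bundle `q`. -/
theorem exists_isEquivariant (x₀ : σ.H) : ∃ P : σ.H → ℂ, Continuous P ∧ IsEquivariant P ∧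
    P x₀ = 1 ∧ ∀ x, ‖P x‖ ≤ 1 := by
  let _ : MeasurableSpace Circle := borel Circle
  have _ : BorelSpace Circle := ⟨rfl⟩
  let ν : Measure Circle := Measure.haar
  -- the part of the orbit of `x₀` on which `f` has to vanish, so that `Re(z̄) f(z x₀) ≥ 0` for all `z`
  let S : Set σ.H := (fun z : Circle => σ.ι z * x₀) '' {z | (z : ℂ).re ≤ 1 / 2}
  have hS : IsCompact S := by
    refine IsCompact.image (IsClosed.isCompact (isClosed_le ?_ continuous_const)) ?_
    · exact Complex.continuous_re.comp continuous_subtype_val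
    · exact σ.continuous_ι.mul continuous_const
  have hd : Disjoint {x₀} S := by
    refine Set.disjoint_singleton_left.2 ?_
    rintro ⟨z, hz, hzx⟩
    have : z = 1 := σ.injective_ι (by rw [map_one]; exact mul_eq_right.1 hzx)
    rw [this] at hz
    norm_num at hz
  obtain ⟨f, hf1, hf0, -, hf⟩ :=
    exists_continuous_one_zero_of_isCompact (isCompact_singleton (x := x₀)) hS.isClosed hd
  let P : σ.H → ℂ := fun x => ∫ z : Circle, starRingEnd ℂ (z : ℂ) * (f (σ.ι z * x) : ℂ) ∂ν
  have hint : Continuous (Function.uncurry fun (x : σ.H) (z : Circle) =>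
      starRingEnd ℂ (z : ℂ) * (f (σ.ι z * x) : ℂ)) := by
    have h1 := σ.continuous_ι
    refine (Complex.continuous_conj.comp (continuous_subtype_val.comp continuous_snd)).mul
      (Complex.continuous_ofReal.comp (f.continuous.comp ?_))
    exact (h1.comp continuous_snd).mul continuous_fst
  have hPc : Continuous P := continuousOn_univ.1
    (continuousOn_integral_of_compact_support isCompact_univ hint.continuousOn
      fun x z _ hz => absurd (Set.mem_univ z) hz)
  have hPe : IsEquivariant P := fun w x => by
    have h := integral_mul_right_eq_self (μ := ν)
      (fun z : Circle => starRingEnd ℂ ((z * w⁻¹ : Circle) : ℂ) * (f (σ.ι z * x) : ℂ)) w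
    have e1 : ∀ z : Circle, starRingEnd ℂ (z : ℂ) * (f (σ.ι z * (σ.ι w * x)) : ℂ) =
        starRingEnd ℂ ((z * w * w⁻¹ : Circle) : ℂ) * (f (σ.ι (z * w) * x) : ℂ) := fun z => by
      rw [mul_inv_cancel_right, map_mul σ.ι, mul_assoc]
    have e2 : ∀ z : Circle, starRingEnd ℂ ((z * w⁻¹ : Circle) : ℂ) * (f (σ.ι z * x) : ℂ) =
        w * (starRingEnd ℂ (z : ℂ) * (f (σ.ι z * x) : ℂ)) := fun z => by
      rw [Circle.coe_mul, map_mul, Circle.coe_inv_eq_conj, Complex.conj_conj]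
      ring
    change ∫ z : Circle, starRingEnd ℂ (z : ℂ) * (f (σ.ι z * (σ.ι w * x)) : ℂ) ∂ν = w * P x
    rw [integral_congr_ae (Eventually.of_forall e1), h, integral_congr_ae (Eventually.of_forall e2),
      integral_const_mul]
  have hP0 : P x₀ ≠ 0 := by
    intro h0
    have hre : (P x₀).re = ∫ z : Circle, (z : ℂ).re * f (σ.ι z * x₀) ∂ν := by
      have hi : Integrable (fun z : Circle => starRingEnd ℂ (z : ℂ) * (f (σ.ι z * x₀) : ℂ)) ν :=
        (hint.comp (Continuous.prodMk_right x₀)).integrable_of_hasCompactSupport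
          (HasCompactSupport.of_compactSpace _)
      have := Complex.reCLM.integral_comp_comm hi
      refine this.symm.trans (integral_congr_ae (Eventually.of_forall fun z => ?_))
      change (starRingEnd ℂ (z : ℂ) * (f (σ.ι z * x₀) : ℂ)).re = _
      rw [Complex.re_mul_ofReal, Complex.conj_re]
    have hc : Continuous fun z : Circle => (z : ℂ).re * f (σ.ι z * x₀) :=
      (Complex.continuous_re.comp continuous_subtype_val).mul
        (f.continuous.comp (σ.continuous_ι.mul continuous_const))
    have hpos : 0 < ∫ z : Circle, (z : ℂ).re * f (σ.ι z * x₀) ∂ν := by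
      refine hc.integral_pos_of_hasCompactSupport_nonneg_nonzero
        (HasCompactSupport.of_compactSpace _) (fun z => ?_) (x := 1) ?_
      · change (0 : ℝ) ≤ (z : ℂ).re * f (σ.ι z * x₀)
        by_cases hz : (z : ℂ).re ≤ 1 / 2
        · have h1 : f (σ.ι z * x₀) = 0 := hf0 ⟨z, hz, rfl⟩
          rw [h1, mul_zero]
        · exact mul_nonneg (by linarith) (hf _).1
      · have h1 : f x₀ = 1 := hf1 rfl
        rw [map_one, one_mul, h1]
        norm_num
    rw [← hre, h0] at hpos
    exact lt_irrefl _ hpos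
  have hQe : IsEquivariant fun x => P x / P x₀ := fun z x => by
    change P (σ.ι z * x) / P x₀ = z * (P x / P x₀)
    rw [hPe, mul_div_assoc]
  refine ⟨_, continuous_clip (hPc.div_const (P x₀)), hQe.clip, ?_, fun x => norm_clip_le _⟩
  simp only [div_self hP0]
  norm_num

variable [T2Space G] [LocallyCompactSpace G] [MeasurableSpace G] [BorelSpace G]
  {μ : Measure G} [μ.Regular] {s : G → σ.H}

/-- On compact sets, a Borel section of `q` is approximated in `L¹` by continuous sections of the
associated line bundle. -/
theorem exists_isEquivariant_eLpNorm_le (hs : Measurable s) (hq : ∀ g, σ.q (s g) = g) {C : Set G}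
    (hC : IsCompact C) {ε : ENNReal} (hε : ε ≠ 0) : ∃ P : σ.H → ℂ, Continuous P ∧ IsEquivariant P ∧
    (∀ x, ‖P x‖ ≤ 1) ∧ eLpNorm (fun g => P (s g) - 1) 1 (μ.restrict C) ≤ ε := by
  choose F hFc hFe hF1 hFn using fun g : G => exists_isEquivariant (s g)
  obtain ⟨t, ht⟩ : ∃ t : Finset G, C ⊆ ⋃ i ∈ t, σ.q '' {x | 1 / 2 < ‖F i x‖} := by
    refine hC.elim_finite_subcover _ (fun i => σ.isOpenMap_q _
      (isOpen_lt continuous_const (hFc i).norm)) fun g _ => Set.mem_iUnion.2 ⟨g, s g, ?_, hq g⟩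
    change 1 / 2 < ‖F g (s g)‖
    rw [hF1, norm_one]
    norm_num
  let S : G → ℝ := fun g => ∑ i ∈ t, ‖F i (s g)‖ ^ 2
  have hS : ∀ g ∈ C, 1 / 4 ≤ S g := fun g hg => by
    obtain ⟨i, hi, x, hx, hxg⟩ := Set.mem_iUnion₂.1 (ht hg)
    have h1 : ‖F i (s g)‖ = ‖F i x‖ := (hFe i).norm_eq ((hq g).trans hxg.symm)
    have h2 : (1 / 2 : ℝ) < ‖F i (s g)‖ := by rw [h1]; exact hx
    calc (1 / 4 : ℝ) ≤ ‖F i (s g)‖ ^ 2 := by nlinarith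
      _ ≤ S g := Finset.single_le_sum (f := fun i => ‖F i (s g)‖ ^ 2)
          (fun j _ => sq_nonneg _) hi
  have hFm : ∀ i, Measurable fun g => F i (s g) := fun i => (hFc i).measurable.comp hs
  have hSm : Measurable S := Finset.measurable_fun_sum t fun i _ => (hFm i).norm.pow_const 2
  -- `1 = ∑ c i · F i (s g)` on `C` with bounded measurable coefficients, which are then approximated
  -- by continuous functions on `G`
  let c : G → G → ℂ := fun i => C.indicator fun g => starRingEnd ℂ (F i (s g)) / (S g : ℂ)
  have hcm : ∀ i, Measurable (c i) := fun i =>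
    ((Complex.continuous_conj.measurable.comp (hFm i)).div
      (Complex.continuous_ofReal.measurable.comp hSm)).indicator hC.measurableSet
  have hcL : ∀ i, MemLp (c i) 1 μ := fun i => by
    rw [memLp_indicator_iff_restrict hC.measurableSet]
    have hfin : IsFiniteMeasure (μ.restrict C) := isFiniteMeasure_restrict.2 hC.measure_lt_top.ne
    refine MemLp.of_bound (((Complex.continuous_conj.measurable.comp (hFm i)).div
      (Complex.continuous_ofReal.measurable.comp hSm)).aestronglyMeasurable) 4 ?_
    rw [ae_restrict_iff' hC.measurableSet]
    refine Eventually.of_forall fun g hg => ?_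
    change ‖starRingEnd ℂ (F i (s g)) / (S g : ℂ)‖ ≤ 4
    have h1 := hS g hg
    rw [norm_div, RCLike.norm_conj, Complex.norm_real, Real.norm_of_nonneg (by linarith),
      div_le_iff₀ (by linarith)]
    linarith [hFn i (s g)]
  have hε' : ε / (2 * (t.card + 1)) ≠ 0 := ENNReal.div_ne_zero.2 ⟨hε, by finiteness⟩
  choose β hβ hβc _ using fun i =>
    (hcL i).exists_continuous_eLpNorm_sub_le_of_locallyCompact ENNReal.one_ne_top hε'
  let P : σ.H → ℂ := fun x => ∑ i ∈ t, β i (σ.q x) * F i x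
  have hPc : Continuous P := continuous_finsetSum t fun i _ =>
    ((hβc i).comp σ.continuous_q).mul (hFc i)
  have hPe : IsEquivariant P := fun z x => by
    change ∑ i ∈ t, β i (σ.q (σ.ι z * x)) * F i (σ.ι z * x) = z * ∑ i ∈ t, β i (σ.q x) * F i x
    rw [Finset.mul_sum]
    refine Finset.sum_congr rfl fun i _ => ?_
    rw [map_mul, σ.q_ι, one_mul, hFe]
    ring
  refine ⟨_, continuous_clip hPc, hPe.clip, fun x => norm_clip_le _, ?_⟩
  have hpt : ∀ g ∈ C, ‖P (s g) / (max 1 ‖P (s g)‖ : ℝ) - 1‖ ≤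
      ∑ i ∈ t, 2 * ‖(c i - β i) g‖ := fun g hg => by
    have h1 : ∑ i ∈ t, c i g * F i (s g) = 1 := by
      have hne : (S g : ℂ) ≠ 0 := Complex.ofReal_ne_zero.2 (by linarith [hS g hg])
      have : ∀ i, c i g * F i (s g) = ((‖F i (s g)‖ ^ 2 : ℝ) : ℂ) / (S g : ℂ) := fun i => by
        simp only [c, Set.indicator_of_mem hg]
        rw [div_mul_eq_mul_div, ← Complex.normSq_eq_conj_mul_self, Complex.normSq_eq_norm_sq]
      rw [Finset.sum_congr rfl fun i _ => this i, ← Finset.sum_div, ← Complex.ofReal_sum,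
        div_self hne]
    have h2 : P (s g) - 1 = ∑ i ∈ t, (β i g - c i g) * F i (s g) := by
      rw [← h1]
      simp only [P, hq, sub_mul, Finset.sum_sub_distrib]
    refine (norm_clip_sub_one_le _).trans ?_
    rw [h2, ← Finset.mul_sum]
    refine mul_le_mul_of_nonneg_left ((norm_sum_le _ _).trans
      (Finset.sum_le_sum fun i _ => ?_)) zero_le_two
    rw [norm_mul, Pi.sub_apply, norm_sub_rev]
    exact mul_le_of_le_one_right (norm_nonneg _) (hFn i _)
  rw [eLpNorm_one_eq_lintegral_enorm]
  calc ∫⁻ g in C, ‖P (s g) / (max 1 ‖P (s g)‖ : ℝ) - 1‖ₑ ∂μ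
      ≤ ∫⁻ g in C, ∑ i ∈ t, 2 * ‖(c i - β i) g‖ₑ ∂μ := by
        refine setLIntegral_mono' hC.measurableSet fun g hg => ?_
        rw [← ofReal_norm]
        refine (ENNReal.ofReal_le_ofReal (hpt g hg)).trans_eq ?_
        rw [ENNReal.ofReal_sum_of_nonneg fun i _ => by positivity]
        refine Finset.sum_congr rfl fun i _ => ?_
        rw [ENNReal.ofReal_mul zero_le_two, ofReal_norm, ENNReal.ofReal_ofNat]
    _ ≤ ∫⁻ g, ∑ i ∈ t, 2 * ‖(c i - β i) g‖ₑ ∂μ := setLIntegral_le_lintegral _ _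
    _ = ∑ i ∈ t, 2 * eLpNorm (c i - β i) 1 μ := by
        rw [lintegral_finsetSum t fun i _ =>
          (((hcm i).sub (hβc i).measurable).enorm).const_mul 2]
        refine Finset.sum_congr rfl fun i _ => ?_
        rw [lintegral_const_mul' _ _ (by simp), eLpNorm_one_eq_lintegral_enorm]
    _ ≤ ∑ i ∈ t, 2 * (ε / (2 * (t.card + 1))) :=
        Finset.sum_le_sum fun i _ => mul_le_mul_right (hβ i) 2
    _ = (2 * t.card) * (ε / (2 * (t.card + 1))) := by
        rw [Finset.sum_const, nsmul_eq_mul]; ring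
    _ ≤ (2 * (t.card + 1)) * (ε / (2 * (t.card + 1))) := by
        gcongr; exact le_self_add
    _ ≤ ε := ENNReal.mul_div_le

/-- On compact sets, a Borel section of `q` is almost everywhere a limit of continuous sections of
the associated line bundle. -/
theorem exists_seq_isEquivariant (hs : Measurable s) (hq : ∀ g, σ.q (s g) = g) {C : Set G}
    (hC : IsCompact C) : ∃ P : ℕ → σ.H → ℂ, (∀ n, Continuous (P n)) ∧
    (∀ n, IsEquivariant (P n)) ∧ (∀ n x, ‖P n x‖ ≤ 1) ∧
    ∀ᵐ g ∂μ, g ∈ C → Tendsto (fun n => P n (s g)) atTop (𝓝 1) := by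
  choose P hPc hPe hP1 hP using fun n : ℕ => exists_isEquivariant_eLpNorm_le (μ := μ) hs hq hC
    (ε := (n + 1 : ENNReal)⁻¹) (ENNReal.inv_ne_zero.2 (by finiteness))
  have hlim : Tendsto (fun n => eLpNorm ((fun g => P n (s g)) - fun _ => 1) 1 (μ.restrict C)) atTop
      (𝓝 0) := by
    refine tendsto_of_tendsto_of_tendsto_of_le_of_le tendsto_const_nhds ?_ (fun _ => zero_le) hP
    have h := (tendsto_add_atTop_iff_nat 1).2 ENNReal.tendsto_inv_nat_nhds_zero
    simpa using h
  have hm : ∀ n, AEStronglyMeasurable (fun g => P n (s g)) (μ.restrict C) := fun n =>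
    ((hPc n).measurable.comp hs).aestronglyMeasurable
  obtain ⟨ns, -, hns⟩ := (tendstoInMeasure_of_tendsto_eLpNorm one_ne_zero hm
    aestronglyMeasurable_const hlim).exists_seq_tendsto_ae
  refine ⟨fun n => P (ns n), fun n => hPc _, fun n => hPe _, fun n => hP1 _, ?_⟩
  rwa [ae_restrict_iff' hC.measurableSet] at hns

end Equivariant

end Twist

/-! ### The coordinates of the twisted bundle -/

namespace FellBundle

open BanachBundle

section Coordinates

variable {G : Type u} [Group G] [TopologicalSpace G] {A : FellBundle G} {σ : Twist G}

theorem coordEquiv_shift {g : G} (x : σ.H) (hx : σ.q x = g) (z : Circle)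
    (hx' : σ.q (σ.ι z * x) = g) (a : Fiber (twP (A := A) (σ := σ)) g) :
    coordEquiv (σ.ι z * x) hx' a = ((z⁻¹ : Circle) : ℂ) • coordEquiv x hx a := by
  obtain ⟨a, rfl⟩ := exists_tfun a x hx
  rw [← tfun_shift x hx a z hx', coordEquiv_tfun, tfun_shift x hx a z hx', coordEquiv_tfun]

theorem coordEquiv_congr {g : G} {x y : σ.H} (h : x = y) (hx : σ.q x = g) (hy : σ.q y = g)
    (a : Fiber (twP (A := A) (σ := σ)) g) : coordEquiv x hx a = coordEquiv y hy a := by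
  subst h; rfl

theorem coordEquiv_val {g : G} (x : σ.H) (hx : σ.q x = g)
    (a : Fiber (twP (A := A) (σ := σ)) g) (hx' : σ.q x = twP a.val) :
    (coordEquiv x hx' ⟨a.val, rfl⟩).val = (coordEquiv x hx a).val := by
  obtain ⟨a, rfl⟩ := a; rfl

/-- The coordinate of `e ∈ A_σ` with respect to a lift `x` depends continuously on both. -/
theorem continuous_coordEquiv : Continuous
    fun w : {w : TwE A σ × σ.H // twP w.1 = σ.q w.2} =>
      (coordEquiv (A := A) w.1.2 w.2.symm ⟨w.1.1, rfl⟩).val := by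
  let D : Set (TwE A σ × σ.H) := {w | twP w.1 = σ.q w.2}
  let m : PullE A σ × σ.H → TwE A σ × σ.H := Prod.map tmk id
  have hm : IsOpenQuotientMap m := isOpenQuotientMap_tmk.prodMap IsOpenQuotientMap.id
  have hmD : IsOpenQuotientMap (D.restrictPreimage m) :=
    ⟨D.restrictPreimage_surjective hm.surjective, hm.continuous.restrictPreimage,
      hm.isOpenMap.restrictPreimage D⟩
  refine hmD.continuous_comp_iff.1 ?_
  have hq : ∀ w : m ⁻¹' D, σ.q w.1.2 = σ.q w.1.1.1.2 := fun w => w.2.symm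
  -- the phase between the two lifts is continuous, as `ι` is a topological embedding
  choose z hz using fun w : m ⁻¹' D => σ.exists_ι (hq w)
  have cx : Continuous fun w : m ⁻¹' D => w.1.1.1.2 := continuous_snd.comp
    (continuous_subtype_val.comp (continuous_fst.comp continuous_subtype_val))
  have cy : Continuous fun w : m ⁻¹' D => w.1.2 := continuous_snd.comp continuous_subtype_val
  have ca : Continuous fun w : m ⁻¹' D => w.1.1.1.1 := continuous_fst.comp
    (continuous_subtype_val.comp (continuous_fst.comp continuous_subtype_val))
  have hzc : Continuous z := by
    rw [σ.isInducing_ι.continuous_iff]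
    refine (cy.mul cx.inv).congr fun w => ?_
    change w.1.2 * (w.1.1.1.2)⁻¹ = σ.ι (z w)
    rw [hz w, mul_inv_cancel_right]
  let f : ∀ w : m ⁻¹' D, A.Fib (σ.q w.1.1.1.2) := fun w => ⟨w.1.1.1.1, w.1.1.2⟩
  have hf : IsContSec f := ca
  have hc := hf.smul (φ := fun w => (((z w)⁻¹ : Circle) : ℂ))
    ((continuous_subtype_val : Continuous ((↑) : Circle → ℂ)).comp hzc.inv)
  refine Continuous.congr hc fun w => ?_
  have hx' : σ.q (σ.ι (z w) * w.1.1.1.2) = twP (tmk w.1.1) := by rw [← hz w]; exact hq w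
  change _ = (coordEquiv (A := A) w.1.2 (hq w) ⟨tmk w.1.1, rfl⟩).val
  refine (congrArg Fiber.val ((coordEquiv_congr (hz w) (hq w) hx' _).trans
    ((coordEquiv_shift w.1.1.1.2 rfl (z w) hx' _).trans (congrArg _ ?_)))).symm
  exact coordEquiv_tfun w.1.1.1.2 rfl (f w)

theorem tfun_shift' {g : G} (x : σ.H) (hx : σ.q x = g) (a : A.Fib g) (z : Circle)
    (hx' : σ.q (σ.ι z * x) = g) : tfun (σ.ι z * x) hx' a = (z : ℂ) • tfun x hx a := by
  have h := tfun_shift x hx ((z : ℂ) • a) z hx'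
  rwa [smul_smul, ← Circle.coe_mul, inv_mul_cancel, Circle.coe_one, one_smul, tfun_smul] at h

theorem ι_mul_mul_inv (v w : Circle) (x y : σ.H) :
    σ.ι v * x * (σ.ι w * y)⁻¹ = σ.ι (v * w⁻¹) * (x * y⁻¹) := by
  have h := σ.central w⁻¹ (x * y⁻¹)
  rw [mul_inv_rev, ← map_inv, map_mul, mul_assoc, mul_assoc, h]
  simp only [mul_assoc]

variable [IsTopologicalGroup G]

/-- The identification `[a, x] ↦ a` of `A_{σ,g}` with `A_g` by means of a lift `x` of `g`, as an
isometry. -/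
def coordIso {g : G} (x : σ.H) (hx : σ.q x = g) : (A.twisted σ).Fib g ≃ₗᵢ[ℂ] A.Fib g where
  toFun := coordEquiv x hx
  invFun := tfun x hx
  left_inv := tfun_coordEquiv x hx
  right_inv := coordEquiv_tfun x hx
  map_add' a b := by
    obtain ⟨a, rfl⟩ := exists_tfun a x hx
    obtain ⟨b, rfl⟩ := exists_tfun b x hx
    rw [coordEquiv_tfun, coordEquiv_tfun]
    exact (congrArg _ (tfun_add x hx a b).symm).trans (coordEquiv_tfun x hx _)
  map_smul' c a := by
    obtain ⟨a, rfl⟩ := exists_tfun a x hx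
    rw [coordEquiv_tfun, RingHom.id_apply]
    exact (congrArg _ (tfun_smul x hx c a).symm).trans (coordEquiv_tfun x hx _)
  norm_map' a := by
    obtain ⟨a, rfl⟩ := exists_tfun a x hx
    exact (congrArg norm (coordEquiv_tfun x hx a)).trans (norm_tfun x hx a).symm

theorem coordIso_fmul {g h k : G} (hk : g * h = k) {x y w : σ.H} (hx : σ.q x = g) (hy : σ.q y = h)
    (hw : σ.q w = k) (hxy : x * y = w) (a : (A.twisted σ).Fib g) (b : (A.twisted σ).Fib h) :
    coordIso w hw (fmul hk a b) = fmul hk (coordIso x hx a) (coordIso y hy b) := by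
  obtain ⟨a, rfl⟩ := exists_tfun a x hx
  obtain ⟨b, rfl⟩ := exists_tfun b y hy
  change coordEquiv w hw (fmul (A := A.twisted σ) hk (tfun x hx a) (tfun y hy b)) =
    fmul hk (coordEquiv x hx (tfun x hx a)) (coordEquiv y hy (tfun y hy b))
  rw [coordEquiv_tfun, coordEquiv_tfun]
  have e : fmul (A := A.twisted σ) hk (tfun x hx a) (tfun y hy b) = tfun w hw (fmul hk a b) :=
    Fiber.ext (congrArg tmk (Subtype.ext (Prod.ext rfl hxy)))
  rw [e]
  exact coordEquiv_tfun w hw _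

theorem coordIso_fstar {g k : G} (hk : g⁻¹ = k) {x w : σ.H} (hx : σ.q x = g)
    (hw : σ.q w = k) (hxw : x⁻¹ = w) (a : (A.twisted σ).Fib g) :
    coordIso w hw (fstar hk a) = fstar hk (coordIso x hx a) := by
  obtain ⟨a, rfl⟩ := exists_tfun a x hx
  change coordEquiv w hw (fstar (A := A.twisted σ) hk (tfun x hx a)) =
    fstar hk (coordEquiv x hx (tfun x hx a))
  rw [coordEquiv_tfun]
  have e : fstar (A := A.twisted σ) hk (tfun x hx a) = tfun w hw (fstar hk a) :=
    Fiber.ext (congrArg tmk (Subtype.ext (Prod.ext rfl hxw)))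
  rw [e]
  exact coordEquiv_tfun w hw _

theorem coordIso_fcast {g h : G} (e : g = h) (x : σ.H) (hx : σ.q x = h) (hx' : σ.q x = g)
    (a : (A.twisted σ).Fib g) : coordIso x hx (fcast e a) = fcast e (coordIso x hx' a) := by
  subst e; rfl

theorem q_mul_inv {s : G → σ.H} (hq : ∀ g, σ.q (s g) = g) (g h : G) :
    σ.q (s g * (s h)⁻¹) = g * h⁻¹ := by rw [map_mul, map_inv, hq, hq]

theorem isOpenQuotientMap_q (σ : Twist G) : IsOpenQuotientMap σ.q :=
  ⟨σ.surjective_q, σ.continuous_q, σ.isOpenMap_q⟩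

/-- The phases of an equivariant function `P` at the lifts `x` and `y` compensate for the dependence
of the coordinate with respect to `x y⁻¹` on these lifts. -/
theorem smul_coordEquiv_eq {P : σ.H → ℂ} (hP : Twist.IsEquivariant P) {g : G} {x y x' y' : σ.H}
    (hx : σ.q x' = σ.q x) (hy : σ.q y' = σ.q y) (h : σ.q (x * y⁻¹) = g)
    (h' : σ.q (x' * y'⁻¹) = g) (a : Fiber (twP (A := A) (σ := σ)) g) :
    (P x' * starRingEnd ℂ (P y')) • coordEquiv (x' * y'⁻¹) h' a =
      (P x * starRingEnd ℂ (P y)) • coordEquiv (x * y⁻¹) h a := by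
  obtain ⟨v, rfl⟩ := σ.exists_ι hx
  obtain ⟨w, rfl⟩ := σ.exists_ι hy
  have h2 : σ.q (σ.ι (v * w⁻¹) * (x * y⁻¹)) = g := by rw [← ι_mul_mul_inv]; exact h'
  rw [coordEquiv_congr (ι_mul_mul_inv v w x y) h' h2, coordEquiv_shift _ h, smul_smul, hP, hP,
    mul_inv, inv_inv, Circle.coe_mul, Circle.coe_inv_eq_conj, map_mul]
  congr 1
  have hv : (v : ℂ) * starRingEnd ℂ (v : ℂ) = 1 := by
    rw [← Circle.coe_inv_eq_conj, ← Circle.coe_mul, mul_inv_cancel, Circle.coe_one]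
  have hw : (w : ℂ) * starRingEnd ℂ (w : ℂ) = 1 := by
    rw [← Circle.coe_inv_eq_conj, ← Circle.coe_mul, mul_inv_cancel, Circle.coe_one]
  linear_combination (P x * starRingEnd ℂ (P y)) * ((w : ℂ) * starRingEnd ℂ (w : ℂ) * hv + hw)

theorem smul_tfun_eq {P : σ.H → ℂ} (hP : Twist.IsEquivariant P) {g : G} {x y x' y' : σ.H}
    (hx : σ.q x' = σ.q x) (hy : σ.q y' = σ.q y) (h : σ.q (x * y⁻¹) = g)
    (h' : σ.q (x' * y'⁻¹) = g) (a : A.Fib g) :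
    (starRingEnd ℂ (P x') * P y') • tfun (x' * y'⁻¹) h' a =
      (starRingEnd ℂ (P x) * P y) • tfun (x * y⁻¹) h a := by
  obtain ⟨v, rfl⟩ := σ.exists_ι hx
  obtain ⟨w, rfl⟩ := σ.exists_ι hy
  have h2 : σ.q (σ.ι (v * w⁻¹) * (x * y⁻¹)) = g := by rw [← ι_mul_mul_inv]; exact h'
  have e : tfun (σ.ι v * x * (σ.ι w * y)⁻¹) h' a = tfun (σ.ι (v * w⁻¹) * (x * y⁻¹)) h2 a := by
    congr 1; exact ι_mul_mul_inv v w x y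
  rw [e, tfun_shift' _ h, smul_smul, hP, hP, Circle.coe_mul, Circle.coe_inv_eq_conj, map_mul]
  congr 1
  have hv : (v : ℂ) * starRingEnd ℂ (v : ℂ) = 1 := by
    rw [← Circle.coe_inv_eq_conj, ← Circle.coe_mul, mul_inv_cancel, Circle.coe_one]
  have hw : (w : ℂ) * starRingEnd ℂ (w : ℂ) = 1 := by
    rw [← Circle.coe_inv_eq_conj, ← Circle.coe_mul, mul_inv_cancel, Circle.coe_one]
  linear_combination (starRingEnd ℂ (P x) * P y) * ((w : ℂ) * starRingEnd ℂ (w : ℂ) * hv + hw)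

/-- The functions `P ∘ s`, for `P` continuous and equivariant, regularize the coordinates with respect
to `s(g) s(h)⁻¹`: over `σ.H × σ.H` the phases of `P` trade the Borel lift `s(g) s(h)⁻¹` for the
tautological lift `x y⁻¹`, which is continuous. -/
theorem regularizes_coordIso {s : G → σ.H} (hq : ∀ g, σ.q (s g) = g) {P : σ.H → ℂ}
    (hPc : Continuous P) (hP : Twist.IsEquivariant P) :
    Regularizes (A := A.twisted σ) (B := A)
      (fun g h => coordIso (s g * (s h)⁻¹) (q_mul_inv hq g h)) (fun g => P (s g)) := by
  intro k hk
  refine ((isOpenQuotientMap_q σ).prodMap (isOpenQuotientMap_q σ)).continuous_comp_iff.1 ?_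
  have hqq : ∀ w : σ.H × σ.H, σ.q (w.1 * w.2⁻¹) = σ.q w.1 * (σ.q w.2)⁻¹ := fun w => by
    rw [map_mul, map_inv]
  have c1 : Continuous fun w : σ.H × σ.H => (k (σ.q w.1) (σ.q w.2)).val :=
    Continuous.comp (g := fun x : G × G => (k x.1 x.2).val)
      (f := fun w : σ.H × σ.H => (σ.q w.1, σ.q w.2)) hk
      ((σ.continuous_q.comp continuous_fst).prodMk (σ.continuous_q.comp continuous_snd))
  have hp : ∀ w : σ.H × σ.H, twP (k (σ.q w.1) (σ.q w.2)).val = σ.q (w.1 * w.2⁻¹) := fun w =>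
    (k (σ.q w.1) (σ.q w.2)).prop.trans (hqq w).symm
  have c2 : Continuous fun w : σ.H × σ.H =>
      (⟨((k (σ.q w.1) (σ.q w.2)).val, w.1 * w.2⁻¹), hp w⟩ :
        {w : TwE A σ × σ.H // twP w.1 = σ.q w.2}) :=
    Continuous.subtype_mk (Continuous.prodMk c1 (continuous_fst.mul continuous_snd.inv)) _
  have c3 : IsContSec (B := A.toBanachBundle) (ν := fun w : σ.H × σ.H => σ.q w.1 * (σ.q w.2)⁻¹)
      (fun w => coordEquiv (A := A) (w.1 * w.2⁻¹) (hqq w) (k (σ.q w.1) (σ.q w.2))) := by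
    refine (continuous_coordEquiv.comp c2).congr fun w => ?_
    exact coordEquiv_val (w.1 * w.2⁻¹) (hqq w) (k (σ.q w.1) (σ.q w.2)) (hp w).symm
  have c4 := c3.smul (φ := fun w => P w.1 * starRingEnd ℂ (P w.2))
    ((hPc.comp continuous_fst).mul (Complex.continuous_conj.comp (hPc.comp continuous_snd)))
  refine Continuous.congr c4 fun w => congrArg Fiber.val ?_
  exact smul_coordEquiv_eq hP (hq (σ.q w.1)).symm (hq (σ.q w.2)).symm _ _ _

theorem regularizes_coordIso_symm {s : G → σ.H} (hq : ∀ g, σ.q (s g) = g) {P : σ.H → ℂ}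
    (hPc : Continuous P) (hP : Twist.IsEquivariant P) :
    Regularizes (A := A) (B := A.twisted σ)
      (fun g h => (coordIso (s g * (s h)⁻¹) (q_mul_inv hq g h)).symm)
      (fun g => starRingEnd ℂ (P (s g))) := by
  intro k hk
  refine ((isOpenQuotientMap_q σ).prodMap (isOpenQuotientMap_q σ)).continuous_comp_iff.1 ?_
  have hqq : ∀ w : σ.H × σ.H, σ.q (w.1 * w.2⁻¹) = σ.q w.1 * (σ.q w.2)⁻¹ := fun w => by
    rw [map_mul, map_inv]
  have c1 : Continuous fun w : σ.H × σ.H => (k (σ.q w.1) (σ.q w.2)).val :=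
    Continuous.comp (g := fun x : G × G => (k x.1 x.2).val)
      (f := fun w : σ.H × σ.H => (σ.q w.1, σ.q w.2)) hk
      ((σ.continuous_q.comp continuous_fst).prodMk (σ.continuous_q.comp continuous_snd))
  have c3 : IsContSec (B := twistedBanach A σ)
      (ν := fun w : σ.H × σ.H => σ.q w.1 * (σ.q w.2)⁻¹)
      (fun w => tfun (w.1 * w.2⁻¹) (hqq w) (k (σ.q w.1) (σ.q w.2))) :=
    isOpenQuotientMap_tmk.continuous.comp (Continuous.subtype_mk
      (Continuous.prodMk c1 (continuous_fst.mul continuous_snd.inv)) _)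
  have c4 := c3.smul (φ := fun w => starRingEnd ℂ (P w.1) * P w.2)
    ((Complex.continuous_conj.comp (hPc.comp continuous_fst)).mul (hPc.comp continuous_snd))
  refine Continuous.congr c4 fun w => congrArg Fiber.val ?_
  refine (smul_tfun_eq (A := A) hP (hq (σ.q w.1)) (hq (σ.q w.2)) (hqq w)
    (q_mul_inv hq _ _) _).symm.trans ?_
  change _ = (starRingEnd ℂ (P (s (σ.q w.1))) * starRingEnd ℂ (starRingEnd ℂ (P (s (σ.q w.2))))) •
    (coordIso (A := A) (s (σ.q w.1) * (s (σ.q w.2))⁻¹) (q_mul_inv hq _ _)).symm _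
  rw [Complex.conj_conj]
  rfl

variable [T2Space G] [LocallyCompactSpace G] [MeasurableSpace G] [BorelSpace G]

/-- The Borel isomorphism `k(g, h) ↦ k(s(g), s(h))` between the kernels of `A_σ` and those of `A`,
given by a Borel section `s` of the extension. -/
def twistIso (A : FellBundle G) (μ : Measure G) [μ.Regular] {s : G → σ.H} (hs : Measurable s)
    (hq : ∀ g, σ.q (s g) = g) : BorelIso (A.twisted σ) A μ where
  θ g h := coordIso (s g * (s h)⁻¹) (q_mul_inv hq g h)
  map_fmul t r v a b := coordIso_fmul _ _ _ _ (by rw [mul_assoc, inv_mul_cancel_left]) a b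
  map_fstar t v a := coordIso_fstar _ _ _ (by rw [mul_inv_rev, inv_inv]) a
  exists_regularizer C hC := by
    obtain ⟨P, hPc, hPe, hP1, hP⟩ := Twist.exists_seq_isEquivariant (μ := μ) hs hq hC
    exact ⟨fun n g => P n (s g), fun n => (hPc n).measurable.comp hs, fun n g => hP1 n _, hP,
      fun n => regularizes_coordIso hq (hPc n) (hPe n),
      fun n => regularizes_coordIso_symm hq (hPc n) (hPe n)⟩

/-- Right translation of both variables changes the coordinate with respect to `s(g) s(h)⁻¹` by the
phase `conj(ω(g,t)) ω(h,t)`, since `s(g) s(h)⁻¹ = ω(g,t) conj(ω(h,t)) s(gt) s(ht)⁻¹`. -/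
theorem coordIso_fcast_tfun {s : G → σ.H} (hq : ∀ g, σ.q (s g) = g) (g h t : G)
    (a : A.Fib (g * t * (h * t)⁻¹)) :
    coordIso (s g * (s h)⁻¹) (q_mul_inv hq g h) (fcast (A := A.twisted σ) (shift_aux g h t)
      ((coordIso (s (g * t) * (s (h * t))⁻¹) (q_mul_inv hq (g * t) (h * t))).symm a)) =
    (starRingEnd ℂ (Twist.cocycle hq g t : ℂ) * (Twist.cocycle hq h t : ℂ)) •
      fcast (shift_aux g h t) a := by
  have h0 := q_mul_inv hq (g * t) (h * t)
  have e : s g * (s h)⁻¹ = σ.ι (Twist.cocycle hq g t * (Twist.cocycle hq h t)⁻¹) *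
      (s (g * t) * (s (h * t))⁻¹) := by
    rw [← ι_mul_mul_inv, Twist.ι_cocycle, Twist.ι_cocycle]
    group
  have h1 : σ.q (s g * (s h)⁻¹) = g * t * (h * t)⁻¹ := by rw [q_mul_inv hq, shift_aux]
  have h2 : σ.q (σ.ι (Twist.cocycle hq g t * (Twist.cocycle hq h t)⁻¹) *
      (s (g * t) * (s (h * t))⁻¹)) = g * t * (h * t)⁻¹ := by rw [← e]; exact h1
  rw [coordIso_fcast _ _ _ h1]
  change fcast _ (coordEquiv (s g * (s h)⁻¹) h1 (tfun (s (g * t) * (s (h * t))⁻¹) h0 a)) = _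
  rw [coordEquiv_congr e h1 h2, coordEquiv_shift _ h0, coordEquiv_tfun, fcast_smul, mul_inv,
    inv_inv, Circle.coe_mul, Circle.coe_inv_eq_conj]

end Coordinates

/-! ### Transport of the dual action -/

namespace BorelIso

variable {G : Type u} [Group G] [TopologicalSpace G] [IsTopologicalGroup G] [T2Space G]
  [LocallyCompactSpace G] [MeasurableSpace G] [BorelSpace G] {A B : FellBundle G} {μ : Measure G}
  [μ.IsHaarMeasure] [μ.Regular] (T : BorelIso A B μ)

/-- The action of `G` on `𝕂(B)` that corresponds to the dual action on `𝕂(A)`. -/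
def transportDual : G →* (KernelAlg B μ →⋆ₙₐ[ℂ] KernelAlg B μ) where
  toFun t := (T.mapAlg.comp (dualAction A μ t)).comp T.symm.mapAlg
  map_one' := NonUnitalStarAlgHom.ext fun x => by
    change T.mapAlg (dualAction A μ 1 (T.symm.mapAlg x)) = x
    rw [map_one]
    exact T.symm.mapAlg_symm_mapAlg x
  map_mul' t r := NonUnitalStarAlgHom.ext fun x => by
    change T.mapAlg (dualAction A μ (t * r) (T.symm.mapAlg x)) =
      T.mapAlg (dualAction A μ t (T.symm.mapAlg
        (T.mapAlg (dualAction A μ r (T.symm.mapAlg x)))))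
    rw [T.mapAlg_symm_mapAlg, map_mul]
    rfl

theorem transportDual_apply (t : G) (x : KernelAlg B μ) :
    T.transportDual t x = T.mapAlg (dualAction A μ t (T.symm.mapAlg x)) := rfl

theorem continuous_transportDual (x : KernelAlg B μ) : Continuous fun t => T.transportDual t x :=
  T.continuous_mapAlg.comp (continuous_dualAction (T.symm.mapAlg x))

/-- On bounded measurable kernels, the transported action is computed pointwise. -/
theorem transportDual_toAlg (t : G) (k : KernelB B μ) :
    T.transportDual t k.toAlg = (T.mapB ((T.symm.mapB k).dual t)).toAlg := by
  rw [transportDual_apply, T.symm.mapAlg_toAlg_kernelB, ← T.mapAlg_toAlg_kernelB]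
  exact congrArg _ (dualHom_toAlg_kernelB t _)

end BorelIso

end FellBundle

end

theorem mainTheorem3 {G : Type*} [Group G] [TopologicalSpace G] [IsTopologicalGroup G]
    [LocallyCompactSpace G] [T2Space G] [MeasurableSpace G] [BorelSpace G]
    (μ : Measure G) [μ.IsHaarMeasure] [μ.Regular]
    (A : FellBundle G) (σ : Twist G)
    (𝔰 : G → σ.H) (h𝔰 : Measurable 𝔰) (hq : ∀ g, σ.q (𝔰 g) = g) :
    ∃ Φ : FellBundle.KernelAlg (A.twisted σ) μ ≃⋆ₐ[ℂ] FellBundle.KernelAlg A μ,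
      -- `Φ(k)(g, h) = k(𝔰(g), 𝔰(h))`
      (∀ k : FellBundle.KernelB (A.twisted σ) μ, ∃ k' : FellBundle.KernelB A μ,
        (∀ g h, k' g h = FellBundle.lifted k (𝔰 g) (𝔰 h) (hq g) (hq h)) ∧
        Φ k.toAlg = k'.toAlg) ∧
      -- `Φ` intertwines the structure maps
      (∀ (f : ZeroAtInftyContinuousMap G ℂ) (x : FellBundle.KernelAlg (A.twisted σ) μ),
        Φ ((FellBundle.jC0 (A.twisted σ) μ f).fst x) = (FellBundle.jC0 A μ f).fst (Φ x) ∧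
        Φ ((FellBundle.jC0 (A.twisted σ) μ f).snd x) = (FellBundle.jC0 A μ f).snd (Φ x)) ∧
      -- `Φ` sends the dual action to the action `δω` with
      -- `δω_t(k)(g, h) = Δ(t) conj(ω(g, t)) ω(h, t) k(gt, ht)`
      ∃ δω : G →* (FellBundle.KernelAlg A μ →⋆ₙₐ[ℂ] FellBundle.KernelAlg A μ),
        (∀ x, Continuous fun t => δω t x) ∧
        (∀ (t : G) (k : FellBundle.KernelB A μ), ∃ k' : FellBundle.KernelB A μ,
          (∀ g h, k' g h =
            ((FellBundle.Δ t : ℂ) * starRingEnd ℂ (Twist.cocycle hq g t : ℂ) *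
              (Twist.cocycle hq h t : ℂ)) •
              FellBundle.fcast (FellBundle.shift_aux g h t) (k (g * t) (h * t))) ∧
          δω t k.toAlg = k'.toAlg) ∧
        ∀ (t : G) (x : FellBundle.KernelAlg (A.twisted σ) μ),
          Φ (FellBundle.dualAction (A.twisted σ) μ t x) = δω t (Φ x) := by
  let T := FellBundle.twistIso A μ h𝔰 hq
  refine ⟨T.algEquiv, fun k => ⟨T.mapB k, fun g h => rfl, T.mapAlg_toAlg_kernelB k⟩,
    fun f x => ⟨T.mapAlg_jC0_fst f x, T.mapAlg_jC0_snd f x⟩, T.transportDual,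
    T.continuous_transportDual,
    fun t k => ⟨T.mapB ((T.symm.mapB k).dual t), fun g h => ?_, T.transportDual_toAlg t k⟩,
    fun t x => ?_⟩
  · refine ((T.θ g h).map_smul (FellBundle.Δ t : ℂ) _).trans ?_
    rw [mul_assoc (FellBundle.Δ t : ℂ), mul_smul]
    refine congrArg _ ?_
    exact FellBundle.coordIso_fcast_tfun hq g h t (k (g * t) (h * t))
  · change T.mapAlg _ = T.transportDual t (T.mapAlg x)
    rw [T.transportDual_apply, T.mapAlg_symm_mapAlg]
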